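/- Let $(M,g)$ be a smooth 4-dimensional space-time of signature $(-,+,+,+)$, time-oriented and oriented with volume form $\eta$, and let $\{u_1,\dots,u_4\}$ be a smooth global frame on $M$ with dual coframe $\{\theta^a\}$; put $g_{ab}=g(u_a,u_b)$ and raise and lower frame indices with it. Let $R_{cda}{}^b=\theta^b(R(u_c,u_d)u_a)$ be the frame components of the Riemann tensor of the Levi-Civita connection, $R_{ca}=R_{cda}{}^d$, $R=g^{ab}R_{ab}$, $S_{ab}=\frac12(R_{ab}-\frac16 g_{ab}R)$, $S_a=\theta^bS_{ba}$, $\mathcal R_a{}^b=\frac12R_{cda}{}^b\,\theta^c\wedge\theta^d$. Define the Weyl 2-forms $$\mathcal W_a{}^b=\mathcal R_a{}^b+\theta^b\wedge S_a-\theta_a\wedge S^b ,$$ the 1-forms (with $*(\theta^a\wedge\theta^b\wedge\theta^c)=\eta^{abc}{}_d\,\theta^d$) $$\Omega^{de}{}_{abc}=\tfrac12 g_{bc}*(\mathcal W^{de}\wedge\theta_a)+\delta^e_b*(\mathcal W_c{}^d\wedge\theta_a)+\delta^e_c*(\mathcal W_b{}^d\wedge\theta_a),$$ and the Bel–Robinson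 3-form $\mathcal T_{abc}=\Omega^{ed}{}_{abc}\wedge\mathcal W_{ed}$ on $M$. Let $a,b,c$ be (not necessarily distinct) frame indices such that $u_a,u_b,u_c$ are causal and future-directed everywhere, and let $\Sigma\subset M$ be a smooth (injectively immersed) hypersurface, possibly with boundary, which at each of its points is either spacelike or null (points of both types may occur). Then $\Sigma$ has an orientation for which a basis $(v_1,v_2,v_3)$ of $T_p\Sigma$ is positive if and only if $\eta(v_1,v_2,v_3,n)>0$, for every $p\in\Sigma$ and every future-directed causal $n\in T_pM$ not tangent to $\Sigma$ (at spacelike points one may take for $n$ the future unit normal), and for this orientation $$\int_\Sigma\mathcal T_{abc}\ \ge\ 0 ,$$ the integral being well defined in $[0,+\infty]$. -/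

import Mathlib

open scoped Manifold ContDiff

noncomputable section

/-! ### Exterior algebra and the Bel-Robinson 3-form on one tangent space -/

/-- The wedge product of a `k`-form and an `l`-form on `V` (sum over shuffles, so that
`(α ∧ β)(X, Y) = α X * β Y - α Y * β X` for 1-forms). -/
def wedge {V : Type*} [AddCommGroup V] [Module ℝ V] {k l : ℕ}
    (α : V [⋀^Fin k]→ₗ[ℝ] ℝ) (β : V [⋀^Fin l]→ₗ[ℝ] ℝ) : V [⋀^Fin (k + l)]→ₗ[ℝ] ℝ :=
  ((LinearMap.mul' ℝ ℝ).compAlternatingMap (α.domCoprod β)).domDomCongr finSumFinEquiv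

/-- A linear functional seen as a 1-form. -/
def oneForm {V : Type*} [AddCommGroup V] [Module ℝ V] (φ : V →ₗ[ℝ] ℝ) :
    V [⋀^Fin 1]→ₗ[ℝ] ℝ :=
  AlternatingMap.ofSubsingleton ℝ V ℝ (0 : Fin 1) φ

/-- The data on one tangent space `V` of a 4-dimensional space-time out of which the Bel-Robinson
3-form is computed: a frame `e`, the metric `g`, the volume form `η` and the frame components
`riem c d a b = R_{cda}^b` of the Riemann tensor. -/
structure FrameData (V : Type*) [AddCommGroup V] [Module ℝ V] where
  e : Module.Basis (Fin 4) ℝ V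
  g : LinearMap.BilinForm ℝ V
  η : V [⋀^Fin 4]→ₗ[ℝ] ℝ
  riem : Fin 4 → Fin 4 → Fin 4 → Fin 4 → ℝ

namespace FrameData

variable {V : Type*} [AddCommGroup V] [Module ℝ V] (A : FrameData V)

/-- `g_{ab}`. -/
def gLow : Matrix (Fin 4) (Fin 4) ℝ := Matrix.of fun a b => A.g (A.e a) (A.e b)

/-- `g^{ab}`. -/
def gUp : Matrix (Fin 4) (Fin 4) ℝ := A.gLow⁻¹

/-- The dual coframe `θ^a`. -/
def theta (a : Fin 4) : V [⋀^Fin 1]→ₗ[ℝ] ℝ := oneForm (A.e.coord a)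

/-- `θ_a = g_{ab} θ^b`. -/
def thetaLow (a : Fin 4) : V [⋀^Fin 1]→ₗ[ℝ] ℝ := ∑ b, A.gLow a b • A.theta b

/-- The Hodge dual of a 3-form, that is, the linear extension of
`*(θ^a ∧ θ^b ∧ θ^c) = η^{abc}_d θ^d`; explicitly
`*β = (1/3!) g^{ai} g^{bj} g^{ck} β_{ijk} η(e_a, e_b, e_c, ·)`. -/
def star (β : V [⋀^Fin 3]→ₗ[ℝ] ℝ) : V [⋀^Fin 1]→ₗ[ℝ] ℝ :=
  (1 / 6 : ℝ) • ∑ a : Fin 3 → Fin 4,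
    (∑ i : Fin 3 → Fin 4, (∏ k, A.gUp (a k) (i k)) * β (fun k => A.e (i k))) •
      ((A.η.curryLeft (A.e (a 0))).curryLeft (A.e (a 1))).curryLeft (A.e (a 2))

/-- The curvature 2-forms `ℛ_a^b = (1/2) R_{cda}^b θ^c ∧ θ^d`. -/
def curvForm (a b : Fin 4) : V [⋀^Fin 2]→ₗ[ℝ] ℝ :=
  (1 / 2 : ℝ) • ∑ c, ∑ d, A.riem c d a b • wedge (A.theta c) (A.theta d)

/-- The Ricci tensor `R_{ca} = R_{cda}^d`. -/
def ricci (c a : Fin 4) : ℝ := ∑ d, A.riem c d a d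

/-- The scalar curvature `R = g^{ab} R_{ab}`. -/
def scalar : ℝ := ∑ a, ∑ b, A.gUp a b * A.ricci a b

/-- The Schouten tensor `S_{ab} = (1/2) (R_{ab} - (1/6) g_{ab} R)`. -/
def schouten (a b : Fin 4) : ℝ := (1 / 2) * (A.ricci a b - (1 / 6) * A.gLow a b * A.scalar)

/-- The 1-forms `S_a = θ^b S_{ba}`. -/
def schoutenForm (a : Fin 4) : V [⋀^Fin 1]→ₗ[ℝ] ℝ := ∑ b, A.schouten b a • A.theta b

/-- The 1-forms `S^b = g^{ba} S_a`. -/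
def schoutenFormUp (b : Fin 4) : V [⋀^Fin 1]→ₗ[ℝ] ℝ := ∑ a, A.gUp b a • A.schoutenForm a

/-- The Weyl 2-forms `𝒲_a^b = ℛ_a^b + θ^b ∧ S_a - θ_a ∧ S^b`. -/
def weylForm (a b : Fin 4) : V [⋀^Fin 2]→ₗ[ℝ] ℝ :=
  A.curvForm a b + wedge (A.theta b) (A.schoutenForm a) - wedge (A.thetaLow a) (A.schoutenFormUp b)

/-- `𝒲_{ab} = 𝒲_a^c g_{cb}`. -/
def weylFormLow (a b : Fin 4) : V [⋀^Fin 2]→ₗ[ℝ] ℝ := ∑ c, A.gLow c b • A.weylForm a c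

/-- `𝒲^{ab} = g^{ac} 𝒲_c^b`. -/
def weylFormUp (a b : Fin 4) : V [⋀^Fin 2]→ₗ[ℝ] ℝ := ∑ c, A.gUp a c • A.weylForm c b

/-- The 1-forms `Ω^{de}_{abc} = (1/2) g_{bc} *(𝒲^{de} ∧ θ_a) + 2 δ^e_{(b} *(𝒲_{c)}^d ∧ θ_a)`,
where round brackets denote symmetrization with the factor `1/2`. -/
def omega (d e a b c : Fin 4) : V [⋀^Fin 1]→ₗ[ℝ] ℝ :=
  ((1 / 2 : ℝ) * A.gLow b c) • A.star (wedge (A.weylFormUp d e) (A.thetaLow a))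
    + (if e = b then (1 : ℝ) else 0) • A.star (wedge (A.weylForm c d) (A.thetaLow a))
    + (if e = c then (1 : ℝ) else 0) • A.star (wedge (A.weylForm b d) (A.thetaLow a))

/-- The Bel-Robinson 3-form `𝒯_{abc} = Ω^{ed}_{abc} ∧ 𝒲_{ed}`. -/
def belRobinson (a b c : Fin 4) : V [⋀^Fin 3]→ₗ[ℝ] ℝ :=
  ∑ e, ∑ d, wedge (A.omega e d a b c) (A.weylFormLow e d)

end FrameData

/-! ### Space-times -/

/-- The `i`-th coordinate vector `∂_i` of the chart centred at `x`, at the point with coordinates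
`y`. -/
def coordVec {n : ℕ} {H : Type*} [TopologicalSpace H]
    (I : ModelWithCorners ℝ (EuclideanSpace ℝ (Fin n)) H)
    {M : Type*} [TopologicalSpace M] [ChartedSpace H M]
    (x : M) (y : EuclideanSpace ℝ (Fin n)) (i : Fin n) :
    TangentSpace I ((extChartAt I x).symm y) :=
  mfderivWithin 𝓘(ℝ, EuclideanSpace ℝ (Fin n)) I (extChartAt I x).symm (Set.range I) y
    (EuclideanSpace.single i (1 : ℝ) : EuclideanSpace ℝ (Fin n))

/-- A smooth Lorentzian metric of signature `(-,+,+,+)` on a 4-manifold; smoothness is that of the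
components in the charts. -/
structure LorentzMetric (M : Type*) [TopologicalSpace M]
    [ChartedSpace (EuclideanSpace ℝ (Fin 4)) M] where
  toFun : ∀ p : M, LinearMap.BilinForm ℝ (TangentSpace (𝓡 4) p)
  exists_orthonormal : ∀ p, ∃ e : Module.Basis (Fin 4) ℝ (TangentSpace (𝓡 4) p),
    ∀ i j, toFun p (e i) (e j) = if i = j then (if i = 0 then -1 else 1) else 0
  smooth : ∀ (x : M) (i j : Fin 4), ContDiffOn ℝ ∞
    (fun y => toFun ((extChartAt (𝓡 4) x).symm y) (coordVec (𝓡 4) x y i) (coordVec (𝓡 4) x y j))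
    (extChartAt (𝓡 4) x).target

/-- A time orientation: a continuous timelike vector field. -/
structure TimeOrientation {M : Type*} [TopologicalSpace M]
    [ChartedSpace (EuclideanSpace ℝ (Fin 4)) M] [IsManifold (𝓡 4) ∞ M]
    (g : LorentzMetric M) where
  toFun : ∀ p : M, TangentSpace (𝓡 4) p
  timelike : ∀ p, g.toFun p (toFun p) (toFun p) < 0
  continuous : Continuous fun p => (⟨p, toFun p⟩ : TangentBundle (𝓡 4) M)

/-- `v ∈ T_p M` is causal and future-directed. -/
def TimeOrientation.IsFutureCausal {M : Type*} [TopologicalSpace M]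
    [ChartedSpace (EuclideanSpace ℝ (Fin 4)) M] [IsManifold (𝓡 4) ∞ M]
    {g : LorentzMetric M} (τ : TimeOrientation g) {p : M} (v : TangentSpace (𝓡 4) p) : Prop :=
  v ≠ 0 ∧ g.toFun p v v ≤ 0 ∧ g.toFun p v (τ.toFun p) < 0

/-- A (smooth) volume form of `g`: in every frame its component `η_{1234}` is `± √(- det g_{ab})`.
It also serves as the orientation of the space-time. -/
structure VolumeForm {M : Type*} [TopologicalSpace M]
    [ChartedSpace (EuclideanSpace ℝ (Fin 4)) M] (g : LorentzMetric M) where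
  toFun : ∀ p : M, (TangentSpace (𝓡 4) p) [⋀^Fin 4]→ₗ[ℝ] ℝ
  normalized : ∀ (p : M) (v : Fin 4 → TangentSpace (𝓡 4) p),
    toFun p v ^ 2 = - (Matrix.of fun i j => g.toFun p (v i) (v j)).det
  smooth : ∀ x : M, ContDiffOn ℝ ∞
    (fun y => toFun ((extChartAt (𝓡 4) x).symm y) (coordVec (𝓡 4) x y))
    (extChartAt (𝓡 4) x).target

/-- A smooth global section of the frame bundle. -/
structure GlobalFrame (M : Type*) [TopologicalSpace M]
    [ChartedSpace (EuclideanSpace ℝ (Fin 4)) M] [IsManifold (𝓡 4) ∞ M] where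
  toBasis : ∀ p : M, Module.Basis (Fin 4) ℝ (TangentSpace (𝓡 4) p)
  smooth : ∀ a, ContMDiff (𝓡 4) (𝓡 4).tangent ∞
    fun p => (⟨p, toBasis p a⟩ : TangentBundle (𝓡 4) M)

namespace LorentzMetric

variable {M : Type*} [TopologicalSpace M] [ChartedSpace (EuclideanSpace ℝ (Fin 4)) M]
  (g : LorentzMetric M)

/-- The matrix of metric components in the chart centred at `x`. -/
def coeff (x : M) (y : EuclideanSpace ℝ (Fin 4)) : Matrix (Fin 4) (Fin 4) ℝ :=
  Matrix.of fun i j =>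
    g.toFun ((extChartAt (𝓡 4) x).symm y) (coordVec (𝓡 4) x y i) (coordVec (𝓡 4) x y j)

/-- The partial derivative `∂_i f`. -/
def pd (i : Fin 4) (f : EuclideanSpace ℝ (Fin 4) → ℝ) (y : EuclideanSpace ℝ (Fin 4)) : ℝ :=
  fderiv ℝ f y (EuclideanSpace.single i (1 : ℝ))

/-- The Christoffel symbols `Γ^k_{ij}` of the Levi-Civita connection in the chart centred at
`x`. -/
def christoffel (x : M) (k i j : Fin 4) (y : EuclideanSpace ℝ (Fin 4)) : ℝ :=
  (1 / 2) * ∑ l, (g.coeff x y)⁻¹ k l *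
    (pd i (fun z => g.coeff x z j l) y + pd j (fun z => g.coeff x z i l) y
      - pd l (fun z => g.coeff x z i j) y)

/-- The components `R_{ijk}^l` of the Riemann tensor in the chart centred at `x`, with
`R(∂_i, ∂_j) ∂_k = R_{ijk}^l ∂_l` and `R(X, Y) = ∇_X ∇_Y - ∇_Y ∇_X - ∇_[X,Y]`. -/
def riemannCoeff (x : M) (i j k l : Fin 4) (y : EuclideanSpace ℝ (Fin 4)) : ℝ :=
  pd i (g.christoffel x l j k) y - pd j (g.christoffel x l i k) y
    + ∑ m, (g.christoffel x l i m y * g.christoffel x m j k y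
      - g.christoffel x l j m y * g.christoffel x m i k y)

/-- The components of `X ∈ T_p M` in the coordinate basis of the chart centred at `p`; that basis is
the standard basis under Mathlib's identification of `T_p M` with `ℝ⁴`. -/
def tangentCoord {p : M} (X : TangentSpace (𝓡 4) p) : EuclideanSpace ℝ (Fin 4) := X

/-- The curvature operator `R(X, Y) Z` at `p`, computed in the chart centred at `p`. -/
def riemann (p : M) (X Y Z : TangentSpace (𝓡 4) p) : TangentSpace (𝓡 4) p :=
  (∑ l, (∑ i, ∑ j, ∑ k, g.riemannCoeff p i j k l (extChartAt (𝓡 4) p p) *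
    tangentCoord X i * tangentCoord Y j *
    tangentCoord Z k) • EuclideanSpace.single l (1 : ℝ) :
    EuclideanSpace ℝ (Fin 4))

/-- The frame, metric, volume form and frame components `R_{cda}^b = θ^b(R(u_c, u_d) u_a)` of the
curvature at `p`. -/
def frameData [IsManifold (𝓡 4) ∞ M] (η : VolumeForm g) (u : GlobalFrame M) (p : M) :
    FrameData (TangentSpace (𝓡 4) p) where
  e := u.toBasis p
  g := g.toFun p
  η := η.toFun p
  riem c d a b :=
    (u.toBasis p).coord b (g.riemann p (u.toBasis p c) (u.toBasis p d) (u.toBasis p a))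

/-- The Bel-Robinson 3-form `𝒯_{abc}` on `M`, pulled back by the global frame `u`. -/
def belRobinsonForm [IsManifold (𝓡 4) ∞ M] (η : VolumeForm g) (u : GlobalFrame M)
    (a b c : Fin 4) (p : M) : (TangentSpace (𝓡 4) p) [⋀^Fin 3]→ₗ[ℝ] ℝ :=
  (g.frameData η u p).belRobinson a b c

end LorentzMetric

/-! ### Hypersurfaces and integration of 3-forms -/

/-- The pull-back of a 3-form on `M` by a map `f : S → M`. -/
def pullbackForm {H : Type*} [TopologicalSpace H]
    (I : ModelWithCorners ℝ (EuclideanSpace ℝ (Fin 3)) H)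
    {S : Type*} [TopologicalSpace S] [ChartedSpace H S]
    {M : Type*} [TopologicalSpace M] [ChartedSpace (EuclideanSpace ℝ (Fin 4)) M]
    (f : S → M) (β : ∀ p : M, (TangentSpace (𝓡 4) p) [⋀^Fin 3]→ₗ[ℝ] ℝ) (q : S) :
    (TangentSpace I q) [⋀^Fin 3]→ₗ[ℝ] ℝ :=
  (β (f q)).compLinearMap (mfderiv I (𝓡 4) f q).toLinearMap

/-- The immersed hypersurface `f : S → M` is spacelike at `q`: the metric is positive definite on
its tangent space. -/
def IsSpacelikeAt {H : Type*} [TopologicalSpace H]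
    (I : ModelWithCorners ℝ (EuclideanSpace ℝ (Fin 3)) H)
    {S : Type*} [TopologicalSpace S] [ChartedSpace H S]
    {M : Type*} [TopologicalSpace M] [ChartedSpace (EuclideanSpace ℝ (Fin 4)) M]
    (g : LorentzMetric M) (f : S → M) (q : S) : Prop :=
  ∀ v : TangentSpace I q, v ≠ 0 →
    0 < g.toFun (f q) (mfderiv I (𝓡 4) f q v) (mfderiv I (𝓡 4) f q v)

/-- The immersed hypersurface `f : S → M` is null at `q`: the metric is degenerate on its tangent
space. -/
def IsNullAt {H : Type*} [TopologicalSpace H]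
    (I : ModelWithCorners ℝ (EuclideanSpace ℝ (Fin 3)) H)
    {S : Type*} [TopologicalSpace S] [ChartedSpace H S]
    {M : Type*} [TopologicalSpace M] [ChartedSpace (EuclideanSpace ℝ (Fin 4)) M]
    (g : LorentzMetric M) (f : S → M) (q : S) : Prop :=
  ∃ v : TangentSpace I q, v ≠ 0 ∧ ∀ w : TangentSpace I q,
    g.toFun (f q) (mfderiv I (𝓡 4) f q v) (mfderiv I (𝓡 4) f q w) = 0

/-- An orientation of a 3-manifold, given by a continuous nowhere vanishing 3-form. -/
structure OrientationForm {H : Type*} [TopologicalSpace H]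
    (I : ModelWithCorners ℝ (EuclideanSpace ℝ (Fin 3)) H)
    (S : Type*) [TopologicalSpace S] [ChartedSpace H S] where
  toFun : ∀ q : S, (TangentSpace I q) [⋀^Fin 3]→ₗ[ℝ] ℝ
  ne_zero : ∀ q, toFun q ≠ 0
  continuousOn : ∀ x : S, ContinuousOn
    (fun y => toFun ((extChartAt I x).symm y) (coordVec I x y)) (extChartAt I x).target

/-- The orientation of the hypersurface `f : S → M` determined by its future-directed normal: for
every future-directed causal vector `n` transverse to the hypersurface, a basis `(v₁, v₂, v₃)` of
its tangent space is positive iff `η(v₁, v₂, v₃, n) > 0`. (At a spacelike point `n` may be taken to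
be the future unit normal; at a null point any transverse future-directed causal `n` is allowed.) -/
def OrientationForm.IsFutureNormal {H : Type*} [TopologicalSpace H]
    {I : ModelWithCorners ℝ (EuclideanSpace ℝ (Fin 3)) H}
    {S : Type*} [TopologicalSpace S] [ChartedSpace H S]
    {M : Type*} [TopologicalSpace M] [ChartedSpace (EuclideanSpace ℝ (Fin 4)) M]
    [IsManifold (𝓡 4) ∞ M] {g : LorentzMetric M} (o : OrientationForm I S)
    (τ : TimeOrientation g) (η : VolumeForm g) (f : S → M) : Prop :=
  ∀ (q : S) (n : TangentSpace (𝓡 4) (f q)), τ.IsFutureCausal n →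
    n ∉ Set.range (mfderiv I (𝓡 4) f q) →
    ∀ v : Fin 3 → TangentSpace I q, LinearIndependent ℝ v →
      (0 < o.toFun q v ↔ 0 < η.toFun (f q)
        ![mfderiv I (𝓡 4) f q (v 0), mfderiv I (𝓡 4) f q (v 1), mfderiv I (𝓡 4) f q (v 2), n])

section Integral

variable {H : Type*} [TopologicalSpace H]
  {I : ModelWithCorners ℝ (EuclideanSpace ℝ (Fin 3)) H}
  {S : Type*} [TopologicalSpace S] [ChartedSpace H S]

/-- The density of the 3-form `α`, with respect to the orientation `o`, in the chart centred
at `x`: `α(∂_1, ∂_2, ∂_3)` if the chart is positively oriented and its opposite otherwise. -/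
def density (o : OrientationForm I S) (α : ∀ q : S, (TangentSpace I q) [⋀^Fin 3]→ₗ[ℝ] ℝ)
    (x : S) (y : EuclideanSpace ℝ (Fin 3)) : ℝ :=
  Real.sign (o.toFun ((extChartAt I x).symm y) (coordVec I x y)) *
    α ((extChartAt I x).symm y) (coordVec I x y)

variable (I S) in
/-- A smooth partition of unity subordinate to the charts. -/
def chartPartition [IsManifold I ∞ S] [T2Space S] [SigmaCompactSpace S] :
    SmoothPartitionOfUnity S I S Set.univ :=
  Classical.choose (SmoothPartitionOfUnity.exists_isSubordinate_chartAt_source I S)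

/-- The integral over `S` of the positive part of the 3-form `α` (with respect to `o`): the sum
over the charts of the Lebesgue integrals of its local densities, weighted by the partition of
unity. -/
def posIntegral [IsManifold I ∞ S] [T2Space S] [SigmaCompactSpace S] (o : OrientationForm I S)
    (α : ∀ q : S, (TangentSpace I q) [⋀^Fin 3]→ₗ[ℝ] ℝ) : ENNReal :=
  ∑' x : S, ∫⁻ y in (extChartAt I x).target,
    ENNReal.ofReal (chartPartition I S x ((extChartAt I x).symm y) * density o α x y)

/-- The integral `∫_S α` over `S` oriented by `o`, as an extended real number: the integral of the
positive part minus that of the negative part. (If both are infinite, so that the integral is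
undefined, the value is `⊥`.) -/
def formIntegral [IsManifold I ∞ S] [T2Space S] [SigmaCompactSpace S] (o : OrientationForm I S)
    (α : ∀ q : S, (TangentSpace I q) [⋀^Fin 3]→ₗ[ℝ] ℝ) : EReal :=
  (posIntegral o α : EReal) - (posIntegral o (fun q => - α q) : EReal)

end Integral

end

/-! The theorem follows from a pointwise inequality: the 3-form is nonnegative on every positively
oriented basis `w` of a spacelike or null hyperplane. The negative part of every local density then
vanishes, so the integral is a well-defined element of `[0, ∞]`.

In an orthonormal basis the wedge and star operations collapse to the Bel-Robinson tensor `belRob`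
evaluated on `u_a, u_b, u_c` and a fourth vector `N`, the metric dual of `-η(w₁, w₂, w₃, ·)`
(`belRobinson_apply`). This `N` is normal to the hyperplane, hence causal
(`bilin_normalVec_self_nonpos`), and positivity of the basis says exactly that it is
future-directed. What remains is the dominant energy property: `belRob` is nonnegative on four
future causal vectors.

That property is proved with spinors. The symmetries of the Weyl tensor, tracelessness included,
make it the real part of a combination of products of self-dual 2-forms with a complex coefficient
matrix `Q` (`exists_weylComp_eq`). On future null vectors `o ⊗ ō` the products of two self-dual
factors cancel and the mixed products factor, which leaves `4|Ψ|²` (`belRob_nullVec`). A future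
causal vector is a sum of two null ones and `belRob` is additive in each slot, so the sign extends
to all causal vectors (`belRob_nonneg`).

Curvature enters only through its algebraic symmetries. The one that costs work is antisymmetry in
the last index pair, which rests on metric compatibility and equality of mixed partials
(`riemannCoeff_low_antisymm`). The orientation is given by `η(·, ·, ·, τ)` restricted to the
hypersurface: it never vanishes because timelike vectors are transverse, and any transverse future
causal vector induces the same sign (`alternating_pos_iff`). -/

noncomputable section

/-! ### The Bel-Robinson tensor in an orthonormal frame -/

/-- The signature `(-,+,+,+)`. -/
def minkSign : Fin 4 → ℝ := ![-1, 1, 1, 1]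

/-- The Minkowski product on `ℝ⁴`. -/
def minkowski (x y : Fin 4 → ℝ) : ℝ := ∑ i, minkSign i * (x i * y i)

/-- The polarized stress tensor of a pair of 2-forms. -/
def stress (x n : Fin 4 → ℝ) (X X' : Fin 4 → Fin 4 → ℝ) : ℝ :=
  ∑ f, minkSign f * ((∑ i, x i * X' i f) * (∑ j, n j * X f j))
    + 1 / 2 * minkowski x n * ∑ k, ∑ l, minkSign k * minkSign l * (X k l * X' k l)

/-- The Bel-Robinson tensor of the Weyl candidate `W` with components in an orthonormal frame. -/
def belRob (W : Fin 4 → Fin 4 → Fin 4 → Fin 4 → ℝ) (x y z n : Fin 4 → ℝ) : ℝ :=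
  ∑ k, minkSign k *
      (stress x n (fun i j => ∑ m, z m * W i j m k) (fun i j => ∑ m, y m * W i j k m)
        + stress x n (fun i j => ∑ m, y m * W i j m k) (fun i j => ∑ m, z m * W i j k m))
    + 1 / 2 * minkowski y z * ∑ k, ∑ l, minkSign k * minkSign l *
      stress x n (fun i j => W i j k l) (fun i j => W i j k l)

/-- A basis of the self-dual 2-forms of Minkowski space. -/
def selfDual : Fin 3 → Fin 4 → Fin 4 → ℂ :=
  ![![![0, 1, 0, 0], ![-1, 0, 0, 0], ![0, 0, 0, Complex.I], ![0, 0, -Complex.I, 0]],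
    ![![0, 0, 1, 0], ![0, 0, 0, -Complex.I], ![-1, 0, 0, 0], ![0, Complex.I, 0, 0]],
    ![![0, 0, 0, 1], ![0, 0, Complex.I, 0], ![0, -Complex.I, 0, 0], ![-1, 0, 0, 0]]]

/-- The future null vector `o ⊗ ō` of the spinor `o = (a, b)`. -/
def nullVec (a b : ℂ) : Fin 4 → ℝ :=
  ![a.re ^ 2 + a.im ^ 2 + b.re ^ 2 + b.im ^ 2, 2 * (a.re * b.re + a.im * b.im),
    2 * (a.re * b.im - a.im * b.re), a.re ^ 2 + a.im ^ 2 - b.re ^ 2 - b.im ^ 2]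

/-- The components of the symmetric product of two spinors. -/
def spinorProd (a b c d : ℂ) : Fin 3 → ℂ :=
  ![a * c - b * d, Complex.I * (a * c + b * d), -(a * d + b * c)]

lemma spinorProd_comm (a b c d : ℂ) : spinorProd a b c d = spinorProd c d a b := by
  ext i; fin_cases i <;> simp [spinorProd] <;> ring

-- A self-dual form is `φ_{AB} ε_{A'B'}` and a conjugate one is `ε_{AB} ψ̄_{A'B'}`. Contracting one
-- index of each, with `o ⊗ ō` and `p ⊗ p̄` in the free slots, gives `φ(o, p)` times the conjugate
-- of `ψ(o, p)`. This factorization is what turns the mixed terms into squares.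
set_option maxHeartbeats 800000 in
lemma sum_selfDual_mul_conj_eq_spinorProd (a b c d : ℂ) (I K : Fin 3) :
    ∑ f, (minkSign f : ℂ) * ((∑ i, (nullVec a b i : ℂ) * selfDual I i f) *
      (starRingEnd ℂ) (∑ j, (nullVec c d j : ℂ) * selfDual K f j)) =
      -2 * (spinorProd a b c d I * (starRingEnd ℂ) (spinorProd a b c d K)) := by
  obtain ⟨a1, a2⟩ := a
  obtain ⟨b1, b2⟩ := b
  obtain ⟨c1, c2⟩ := c
  obtain ⟨d1, d2⟩ := d
  fin_cases I <;> fin_cases K <;> apply Complex.ext <;>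
    simp [-Complex.ofReal_add, -Complex.ofReal_sub, -Complex.ofReal_mul, -Complex.ofReal_pow,
      Fin.sum_univ_four, minkSign, nullVec, selfDual, spinorProd] <;> ring

/-- Self-dual and anti-self-dual forms are orthogonal, so the trace terms contribute nothing to the
mixed part. -/
lemma sum_sum_selfDual_mul_conj (I K : Fin 3) :
    ∑ k, ∑ l, (minkSign k : ℂ) * minkSign l *
      (selfDual I k l * (starRingEnd ℂ) (selfDual K k l)) = 0 := by
  fin_cases I <;> fin_cases K <;>
    simp [Fin.sum_univ_four, minkSign, selfDual]

/-- Quaternion relations: for `J ≠ L` the product of the two forms is antisymmetric and dies on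
symmetrizing in `y, z`; for `J = L` it is a multiple of the metric, which the trace term cancels. -/
lemma sum_selfDual_mul_add_symm (y z : Fin 4 → ℝ) (J L : Fin 3) :
    ∑ k, (minkSign k : ℂ) * ((∑ m, (y m : ℂ) * selfDual J k m) * (∑ m, (z m : ℂ) * selfDual L m k)
      + (∑ m, (z m : ℂ) * selfDual J k m) * (∑ m, (y m : ℂ) * selfDual L m k))
      + 1 / 2 * (minkowski y z : ℂ) * ∑ k, ∑ l, (minkSign k : ℂ) * minkSign l *
        (selfDual J k l * selfDual L k l) = 0 := by
  fin_cases J <;> fin_cases L <;> apply Complex.ext <;>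
    simp [Fin.sum_univ_four, minkSign, selfDual, minkowski] <;> ring

/-- Splits a product of real parts into a holomorphic and a mixed half; the two halves are treated
separately from here on. -/
lemma re_mul_re (z w : ℂ) :
    z.re * w.re = 1 / 2 * (z * w).re + 1 / 2 * (z * (starRingEnd ℂ) w).re := by
  simp; ring

lemma sum_weight_mul_sum {ι : Type*} [Fintype ι] (w : ι → ℂ) (q q' : Fin 3 → ℂ)
    (u v : Fin 3 → ι → ℂ) :
    ∑ i, w i * ((∑ I, q I * u I i) * ∑ K, q' K * v K i) =
      ∑ I, ∑ K, q I * q' K * ∑ i, w i * (u I i * v K i) := by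
  simp only [Finset.sum_mul_sum]
  simp only [Finset.mul_sum]
  rw [Finset.sum_comm]
  refine Finset.sum_congr rfl fun I _ => ?_
  rw [Finset.sum_comm]
  exact Finset.sum_congr rfl fun _ _ => Finset.sum_congr rfl fun _ _ => by ring

lemma sum_sum_weight_mul_sum (w : Fin 4 → Fin 4 → ℂ) (q q' : Fin 3 → ℂ)
    (u v : Fin 3 → Fin 4 → Fin 4 → ℂ) :
    ∑ k, ∑ l, w k l * ((∑ I, q I * u I k l) * ∑ K, q' K * v K k l) =
      ∑ I, ∑ K, q I * q' K * ∑ k, ∑ l, w k l * (u I k l * v K k l) := by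
  have := sum_weight_mul_sum (fun i : Fin 4 × Fin 4 => w i.1 i.2) q q'
    (fun I i => u I i.1 i.2) (fun I i => v I i.1 i.2)
  simpa only [Fintype.sum_prod_type] using this

lemma conj_sum_mul {ι : Type*} [Fintype ι] (q u : ι → ℂ) :
    (starRingEnd ℂ) (∑ I, q I * u I) = ∑ I, (starRingEnd ℂ) (q I) * (starRingEnd ℂ) (u I) := by
  simp

lemma sum_mul_re_sum {ι : Type*} [Fintype ι] (x : ι → ℝ) (q : Fin 3 → ℂ) (u : Fin 3 → ι → ℂ) :
    ∑ i, x i * (∑ I, q I * u I i).re = (∑ I, q I * ∑ i, (x i : ℂ) * u I i).re := by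
  have : (∑ I, q I * ∑ i, (x i : ℂ) * u I i) = ∑ i, (x i : ℂ) * (∑ I, q I * u I i) := by
    simp only [Finset.mul_sum]; rw [Finset.sum_comm]
    exact Finset.sum_congr rfl fun _ _ => Finset.sum_congr rfl fun _ _ => by ring
  rw [this, Complex.re_sum]; simp

/-- The matrix of the holomorphic part of the polarized stress tensor. -/
def stressMatrix (x n : Fin 4 → ℝ) (I K : Fin 3) : ℂ :=
  1 / 2 * ((∑ f, (minkSign f : ℂ) * ((∑ i, (x i : ℂ) * selfDual I i f) *
      (∑ j, (n j : ℂ) * selfDual K f j))) + 1 / 2 * (minkowski x n : ℂ) *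
      ∑ k, ∑ l, (minkSign k : ℂ) * minkSign l * (selfDual I k l * selfDual K k l))

/-- The mixed half factors through the spinor product. The trace coefficient in `stress` is twice
that of the electromagnetic stress tensor, so the holomorphic half does not vanish at this stage; it
is stored in `stressMatrix` and cancels only after the contraction in `belRob_nullVec`. -/
lemma stress_re (a b c d : ℂ) (q q' : Fin 3 → ℂ) :
    stress (nullVec a b) (nullVec c d) (fun i j => (∑ I, q I * selfDual I i j).re)
      (fun i j => (∑ I, q' I * selfDual I i j).re) =
    (∑ I, ∑ K, q' I * q K * stressMatrix (nullVec a b) (nullVec c d) I K).re -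
      ((∑ I, q' I * spinorProd a b c d I) *
      (starRingEnd ℂ) (∑ I, q I * spinorProd a b c d I)).re := by
  set x := nullVec a b with hx
  set n := nullVec c d with hn
  have key : ∑ f, (minkSign f : ℂ) * ((∑ I, q' I * ∑ i, (x i : ℂ) * selfDual I i f) *
      (starRingEnd ℂ) (∑ I, q I * ∑ j, (n j : ℂ) * selfDual I f j)) =
      -2 * ((∑ I, q' I * spinorProd a b c d I) *
      (starRingEnd ℂ) (∑ I, q I * spinorProd a b c d I)) := by
    simp only [conj_sum_mul q]
    rw [sum_weight_mul_sum]
    simp only [hx, hn, sum_selfDual_mul_conj_eq_spinorProd]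
    simp only [Fin.sum_univ_three]
    ring
  have key2 : ∑ k, ∑ l, (minkSign k : ℂ) * minkSign l * ((∑ I, q' I * selfDual I k l) *
      (starRingEnd ℂ) (∑ I, q I * selfDual I k l)) = 0 := by
    simp only [conj_sum_mul q]
    rw [sum_sum_weight_mul_sum]
    simp [sum_sum_selfDual_mul_conj]
  have key3 : ∑ I, ∑ K, q' I * q K * stressMatrix x n I K =
      1 / 2 * (∑ f, (minkSign f : ℂ) * ((∑ I, q' I * ∑ i, (x i : ℂ) * selfDual I i f) *
      (∑ I, q I * ∑ j, (n j : ℂ) * selfDual I f j))) + 1 / 4 * (minkowski x n : ℂ) *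
      (∑ k, ∑ l, (minkSign k : ℂ) * minkSign l * ((∑ I, q' I * selfDual I k l) *
      (∑ I, q I * selfDual I k l))) := by
    rw [sum_weight_mul_sum, sum_sum_weight_mul_sum]
    simp only [stressMatrix, Fin.sum_univ_three]
    ring
  have e1 : ∀ f, (∑ i, x i * (∑ I, q' I * selfDual I i f).re) * (∑ j, n j *
      (∑ I, q I * selfDual I f j).re) =
      1 / 2 * ((∑ I, q' I * ∑ i, (x i : ℂ) * selfDual I i f) *
        (∑ I, q I * ∑ j, (n j : ℂ) * selfDual I f j)).re +
      1 / 2 * ((∑ I, q' I * ∑ i, (x i : ℂ) * selfDual I i f) *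
        (starRingEnd ℂ) (∑ I, q I * ∑ j, (n j : ℂ) * selfDual I f j)).re := by
    intro f
    rw [sum_mul_re_sum x q' (fun I i => selfDual I i f), sum_mul_re_sum n q, re_mul_re]
  have e2 : ∀ k l, (∑ I, q I * selfDual I k l).re * (∑ I, q' I * selfDual I k l).re =
      1 / 2 * ((∑ I, q' I * selfDual I k l) * (∑ I, q I * selfDual I k l)).re +
      1 / 2 * ((∑ I, q' I * selfDual I k l) *
        (starRingEnd ℂ) (∑ I, q I * selfDual I k l)).re := by
    intro k l
    rw [mul_comm, re_mul_re]
  have key' := congrArg Complex.re key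
  have key2' := congrArg Complex.re key2
  have key3' := congrArg Complex.re key3
  rw [key3']
  simp only [stress, e1, e2]
  have hre : ∀ (r : ℝ) (z : ℂ), ((r : ℂ) * z).re = r * z.re := fun r z => by simp
  have h12 : ∀ z : ℂ, (1 / 2 * z).re = 1 / 2 * z.re := fun z => by
    rw [show (1 / 2 : ℂ) = ((1 / 2 : ℝ) : ℂ) by norm_num, hre]
  have h14 : ∀ z : ℂ, (1 / 4 * (minkowski x n : ℂ) * z).re = 1 / 4 * minkowski x n * z.re :=
    fun z => by
      rw [show (1 / 4 : ℂ) * (minkowski x n : ℂ) = ((1 / 4 * minkowski x n : ℝ) : ℂ) by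
        push_cast; norm_num, hre]
  have h2 : ∀ z : ℂ, (-2 * z).re = -2 * z.re := fun z => by simp
  rw [h2] at key'
  simp only [← Complex.ofReal_mul, Complex.re_sum, hre, Complex.zero_re, Complex.add_re, h12, h14]
    at key' key2' ⊢
  simp only [mul_add, Finset.sum_add_distrib, mul_left_comm _ (1 / 2 : ℝ), ← Finset.mul_sum]
    at key' key2' ⊢
  linear_combination 1 / 2 * key' + 1 / 4 * minkowski x n * key2'

/-- The real tensor with the Weyl symmetries built from the complex matrix `Q`. -/
def weylOfMatrix (Q : Fin 3 → Fin 3 → ℂ) (i j k l : Fin 4) : ℝ :=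
  (∑ I, (∑ J, Q I J * selfDual J k l) * selfDual I i j).re

lemma sum_selfDual_mul_conj_eq_spinorProd' (a b c d : ℂ) (I K : Fin 3) :
    ∑ f, (minkSign f : ℂ) * ((∑ j, (nullVec c d j : ℂ) * selfDual I f j) *
      (starRingEnd ℂ) (∑ i, (nullVec a b i : ℂ) * selfDual K i f)) =
      -2 * (spinorProd a b c d I * (starRingEnd ℂ) (spinorProd a b c d K)) := by
  have := congrArg (starRingEnd ℂ) (sum_selfDual_mul_conj_eq_spinorProd a b c d K I)
  simp only [map_sum, map_mul, Complex.conj_conj, Complex.conj_ofReal, map_neg, map_ofNat] at this ⊢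
  rw [mul_comm (spinorProd a b c d I), ← this]
  exact Finset.sum_congr rfl fun _ _ => by ring

lemma sum_mul_weylOfMatrix_right (Q : Fin 3 → Fin 3 → ℂ) (z : Fin 4 → ℝ) (i j k : Fin 4) :
    ∑ m, z m * weylOfMatrix Q i j k m =
      (∑ I, (∑ J, Q I J * ∑ m, (z m : ℂ) * selfDual J k m) * selfDual I i j).re := by
  simp only [weylOfMatrix]
  have := sum_mul_re_sum z (fun I => selfDual I i j) (fun I m => ∑ J, Q I J * selfDual J k m)
  simp only [mul_comm (selfDual _ _ _)] at this
  rw [this]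
  congr 1
  refine Finset.sum_congr rfl fun I _ => ?_
  congr 1
  simp only [Finset.mul_sum]
  rw [Finset.sum_comm]
  exact Finset.sum_congr rfl fun _ _ => Finset.sum_congr rfl fun _ _ => by ring

lemma sum_mul_weylOfMatrix_left (Q : Fin 3 → Fin 3 → ℂ) (z : Fin 4 → ℝ) (i j k : Fin 4) :
    ∑ m, z m * weylOfMatrix Q i j m k =
      (∑ I, (∑ J, Q I J * ∑ m, (z m : ℂ) * selfDual J m k) * selfDual I i j).re := by
  simp only [weylOfMatrix]
  have := sum_mul_re_sum z (fun I => selfDual I i j) (fun I m => ∑ J, Q I J * selfDual J m k)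
  simp only [mul_comm (selfDual _ _ _)] at this
  rw [this]
  congr 1
  refine Finset.sum_congr rfl fun I _ => ?_
  congr 1
  simp only [Finset.mul_sum]
  rw [Finset.sum_comm]
  exact Finset.sum_congr rfl fun _ _ => Finset.sum_congr rfl fun _ _ => by ring

lemma sum_sum_mul_mul_bilin (Q m : Fin 3 → Fin 3 → ℂ) (u v : Fin 3 → ℂ) :
    ∑ I, ∑ K, (∑ J, Q I J * u J) * (∑ J, Q K J * v J) * m I K =
      ∑ J, ∑ L, (∑ I, ∑ K, Q I J * Q K L * m I K) * (u J * v L) := by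
  simp only [Fin.sum_univ_three]; ring

lemma sum_mul_sum_comm (Q : Fin 3 → Fin 3 → ℂ) (u p : Fin 3 → ℂ) :
    ∑ I, (∑ J, Q I J * u J) * p I = ∑ J, (∑ I, Q I J * p I) * u J := by
  simp only [Fin.sum_univ_three]; ring

/-- The Bel-Robinson tensor on null vectors is the square of the modulus of the Weyl spinor. -/
lemma belRob_nullVec (Q : Fin 3 → Fin 3 → ℂ) (a₁ b₁ a₂ b₂ a₃ b₃ a₄ b₄ : ℂ) :
    belRob (weylOfMatrix Q) (nullVec a₁ b₁) (nullVec a₂ b₂) (nullVec a₃ b₃) (nullVec a₄ b₄) =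
      4 * Complex.normSq (∑ J, (∑ I, Q I J * spinorProd a₁ b₁ a₄ b₄ I) *
        spinorProd a₂ b₂ a₃ b₃ J) := by
  set x := nullVec a₁ b₁ with hx
  set y := nullVec a₂ b₂ with hy
  set z := nullVec a₃ b₃ with hz
  set n := nullVec a₄ b₄ with hn
  set r : Fin 3 → ℂ := fun J => ∑ I, Q I J * spinorProd a₁ b₁ a₄ b₄ I with hr
  set M : Fin 3 → Fin 3 → ℂ := fun J L => ∑ I, ∑ K, Q I J * Q K L * stressMatrix x n I K with hM
  set s := spinorProd a₂ b₂ a₃ b₃ with hs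
  have hst : ∀ u v : Fin 3 → ℂ, stress x n
      (fun i j => (∑ I, (∑ J, Q I J * u J) * selfDual I i j).re)
      (fun i j => (∑ I, (∑ J, Q I J * v J) * selfDual I i j).re) =
      (∑ J, ∑ L, M J L * (v J * u L)).re -
        ((∑ J, r J * v J) * (starRingEnd ℂ) (∑ J, r J * u J)).re := by
    intro u v
    rw [hx, hn, stress_re, sum_sum_mul_mul_bilin, sum_mul_sum_comm Q v, sum_mul_sum_comm Q u]
  -- The holomorphic half cancels through the second index pair alone, whatever the coefficients
  -- `M`.
  have hol : ∑ k, (minkSign k : ℂ) *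
      (∑ J, ∑ L, M J L * ((∑ m, (y m : ℂ) * selfDual J k m) * (∑ m, (z m : ℂ) * selfDual L m k)) +
       ∑ J, ∑ L, M J L * ((∑ m, (z m : ℂ) * selfDual J k m) * (∑ m, (y m : ℂ) * selfDual L m k)))
      + 1 / 2 * (minkowski y z : ℂ) * ∑ k, ∑ l, (minkSign k : ℂ) * minkSign l *
        (∑ J, ∑ L, M J L * (selfDual J k l * selfDual L k l)) = 0 := by
    have h := fun J L => sum_selfDual_mul_add_symm y z J L
    have : ∀ J L, M J L * (∑ k, (minkSign k : ℂ) *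
        ((∑ m, (y m : ℂ) * selfDual J k m) * (∑ m, (z m : ℂ) * selfDual L m k)
      + (∑ m, (z m : ℂ) * selfDual J k m) * (∑ m, (y m : ℂ) * selfDual L m k))
      + 1 / 2 * (minkowski y z : ℂ) * ∑ k, ∑ l, (minkSign k : ℂ) * minkSign l *
        (selfDual J k l * selfDual L k l)) = 0 := fun J L => by rw [h, mul_zero]
    have h2 : ∑ J, ∑ L, M J L * (∑ k, (minkSign k : ℂ) *
        ((∑ m, (y m : ℂ) * selfDual J k m) * (∑ m, (z m : ℂ) * selfDual L m k)
      + (∑ m, (z m : ℂ) * selfDual J k m) * (∑ m, (y m : ℂ) * selfDual L m k))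
      + 1 / 2 * (minkowski y z : ℂ) * ∑ k, ∑ l, (minkSign k : ℂ) * minkSign l *
        (selfDual J k l * selfDual L k l)) = 0 := by simp only [this, Finset.sum_const_zero]
    rw [← h2]
    generalize (minkowski y z : ℂ) = g
    have h3 : ∀ k l, (minkSign k : ℂ) * minkSign l *
        (∑ J, ∑ L, M J L * (selfDual J k l * selfDual L k l)) =
        ∑ J, ∑ L, M J L * ((minkSign k : ℂ) * minkSign l * (selfDual J k l * selfDual L k l)) := by
      intro k l
      simp only [Finset.mul_sum]
      exact Finset.sum_congr rfl fun _ _ => Finset.sum_congr rfl fun _ _ => by ring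
    simp only [h3]
    simp only [Fin.sum_univ_three]
    simp only [Finset.sum_add_distrib, ← Finset.mul_sum]
    simp only [mul_add, Finset.sum_add_distrib, mul_left_comm (minkSign _ : ℂ) (M _ _),
      ← Finset.mul_sum]
    ring
  -- The mixed half factors a second time, now through the second index pair. The two orderings of
  -- `y, z` contribute equally, which produces the constant 4.
  have ses : ∀ (a b c d : ℂ), ∑ k, (minkSign k : ℂ) *
      ((∑ J, r J * ∑ m, (nullVec c d m : ℂ) * selfDual J k m) *
      (starRingEnd ℂ) (∑ J, r J * ∑ m, (nullVec a b m : ℂ) * selfDual J m k)) =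
      -2 * Complex.normSq (∑ J, r J * spinorProd a b c d J) := by
    intro a b c d
    simp only [conj_sum_mul r]
    rw [sum_weight_mul_sum]
    simp only [sum_selfDual_mul_conj_eq_spinorProd', Complex.normSq_eq_conj_mul_self]
    simp only [Fin.sum_univ_three, map_add, map_mul]
    ring
  have ses0 : ∑ k, ∑ l, (minkSign k : ℂ) * minkSign l * ((∑ J, r J * selfDual J k l) *
      (starRingEnd ℂ) (∑ J, r J * selfDual J k l)) = 0 := by
    simp only [conj_sum_mul r]
    rw [sum_sum_weight_mul_sum]
    simp [sum_sum_selfDual_mul_conj]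
  have s1 := ses a₃ b₃ a₂ b₂
  have s2 := ses a₂ b₂ a₃ b₃
  rw [spinorProd_comm a₃] at s1
  simp only [← hy, ← hz, ← hs] at s1 s2
  have hre : ∀ (r : ℝ) (z : ℂ), ((r : ℂ) * z).re = r * z.re := fun r z => by simp
  have h12 : ∀ w : ℂ, (1 / 2 * (minkowski y z : ℂ) * w).re = 1 / 2 * minkowski y z * w.re :=
    fun w => by
      rw [show (1 / 2 : ℂ) * (minkowski y z : ℂ) = ((1 / 2 * minkowski y z : ℝ) : ℂ) by
        push_cast; norm_num, hre]
  have h2 : ∀ z : ℝ, (-2 * (z : ℂ)).re = -2 * z := fun z => by simp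
  have hol' := congrArg Complex.re hol
  have s1' := congrArg Complex.re s1
  have s2' := congrArg Complex.re s2
  have s0' := congrArg Complex.re ses0
  rw [h2] at s1' s2'
  simp only [belRob, sum_mul_weylOfMatrix_left, sum_mul_weylOfMatrix_right]
  simp only [weylOfMatrix, hst]
  simp only [← Complex.ofReal_mul] at hol' s1' s2' s0'
  rw [Complex.add_re, h12] at hol'
  simp only [Complex.re_sum _ (fun k => ((minkSign k : ℝ) : ℂ) * _), 
    Complex.re_sum _ (fun k => ((minkSign _ * minkSign k : ℝ) : ℂ) * _), hre,
    Complex.re_sum _ (fun k => ∑ l, ((minkSign k * minkSign l : ℝ) : ℂ) * _), Complex.add_re,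
    Complex.zero_re] at hol' s1' s2' s0'
  simp only [mul_sub, mul_add, Finset.sum_sub_distrib, Finset.sum_add_distrib] at hol' s1' s2' s0' ⊢
  linear_combination hol' - s1' - s2' - 1 / 2 * minkowski y z * s0'

/-! ### Additivity in each slot and passage from null to causal vectors. -/

lemma minkowski_add_left (x x' y : Fin 4 → ℝ) :
    minkowski (x + x') y = minkowski x y + minkowski x' y := by
  simp only [minkowski, Fin.sum_univ_four, Pi.add_apply]; ring

lemma minkowski_comm (x y : Fin 4 → ℝ) : minkowski x y = minkowski y x := by
  simp only [minkowski, Fin.sum_univ_four]; ring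

lemma minkowski_add_right (x y y' : Fin 4 → ℝ) :
    minkowski x (y + y') = minkowski x y + minkowski x y' := by
  simp only [minkowski_comm x, minkowski_add_left]

lemma stress_add_left (x x' n : Fin 4 → ℝ) (X X' : Fin 4 → Fin 4 → ℝ) :
    stress (x + x') n X X' = stress x n X X' + stress x' n X X' := by
  simp only [stress, minkowski_add_left, Pi.add_apply, add_mul, mul_add, Finset.sum_add_distrib]
  ring

lemma stress_add_right (x n n' : Fin 4 → ℝ) (X X' : Fin 4 → Fin 4 → ℝ) :
    stress x (n + n') X X' = stress x n X X' + stress x n' X X' := by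
  simp only [stress, minkowski_add_right, Pi.add_apply, add_mul, mul_add, Finset.sum_add_distrib]
  ring

lemma stress_add_form_left (x n : Fin 4 → ℝ) (X Y X' : Fin 4 → Fin 4 → ℝ) :
    stress x n (fun i j => X i j + Y i j) X' = stress x n X X' + stress x n Y X' := by
  simp only [stress, add_mul, mul_add, Finset.sum_add_distrib]
  ring

lemma stress_add_form_right (x n : Fin 4 → ℝ) (X X' Y : Fin 4 → Fin 4 → ℝ) :
    stress x n X (fun i j => X' i j + Y i j) = stress x n X X' + stress x n X Y := by
  simp only [stress, add_mul, mul_add, Finset.sum_add_distrib]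
  ring

section
variable (W : Fin 4 → Fin 4 → Fin 4 → Fin 4 → ℝ) (x x' y y' z z' n n' : Fin 4 → ℝ)

lemma belRob_add_fst : belRob W (x + x') y z n = belRob W x y z n + belRob W x' y z n := by
  simp only [belRob, stress_add_left, mul_add, Finset.sum_add_distrib]; ring

lemma belRob_add_fourth : belRob W x y z (n + n') = belRob W x y z n + belRob W x y z n' := by
  simp only [belRob, stress_add_right, mul_add, Finset.sum_add_distrib]; ring

lemma belRob_add_snd : belRob W x (y + y') z n = belRob W x y z n + belRob W x y' z n := by
  simp only [belRob, Pi.add_apply, add_mul, minkowski_add_left,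
    stress_add_form_left, stress_add_form_right, mul_add, Finset.sum_add_distrib]; ring

lemma belRob_swap : belRob W x y z n = belRob W x z y n := by
  simp only [belRob, minkowski_comm y z, add_comm]

lemma belRob_add_trd : belRob W x y (z + z') n = belRob W x y z n + belRob W x y z' n := by
  rw [belRob_swap, belRob_add_snd, belRob_swap, belRob_swap _ _ z']

end

/-- A future causal vector is a positive semidefinite Hermitian 2×2 matrix with diagonal `(x₀ ±
x₃)/2`, and null vectors are the matrices of rank at most one. The two summands come from its
Cholesky factorization. -/
lemma exists_eq_nullVec_add_nullVec {x : Fin 4 → ℝ} (h0 : 0 ≤ x 0) (hx : minkowski x x ≤ 0) :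
    ∃ a b c d, x = nullVec a b + nullVec c d := by
  simp only [minkowski, Fin.sum_univ_four, minkSign] at hx
  simp at hx
  -- When the pivot `x₀ + x₃` vanishes, semidefiniteness kills the off-diagonal entries and a single
  -- null vector suffices.
  rcases (show 0 ≤ x 0 + x 3 by nlinarith [sq_nonneg (x 1), sq_nonneg (x 2)]).eq_or_lt with h | h
  · have h3 : x 3 = - x 0 := by linarith
    have h1 : x 1 = 0 := by
      rw [h3] at hx; nlinarith [sq_nonneg (x 1), sq_nonneg (x 2)]
    have h2 : x 2 = 0 := by
      rw [h3] at hx; nlinarith [sq_nonneg (x 1), sq_nonneg (x 2)]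
    refine ⟨0, 0, 0, (√(x 0) : ℝ), ?_⟩
    ext i
    fin_cases i <;> simp [nullVec, h1, h2, h3, Real.sq_sqrt h0]
  · set p := √((x 0 + x 3) / 2) with hp
    have hp2 : p ^ 2 = (x 0 + x 3) / 2 := Real.sq_sqrt (by linarith)
    have hp0 : 0 < p := Real.sqrt_pos.2 (by linarith)
    have hd : 0 ≤ (x 0 - x 3) / 2 - ((x 1 / (2 * p)) ^ 2 + (x 2 / (2 * p)) ^ 2) := by
      rw [div_pow, div_pow, mul_pow, hp2, ← add_div, sub_nonneg, div_le_iff₀ (by linarith)]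
      nlinarith
    refine ⟨(p : ℝ), ⟨x 1 / (2 * p), x 2 / (2 * p)⟩, 0, (√((x 0 - x 3) / 2 -
      ((x 1 / (2 * p)) ^ 2 + (x 2 / (2 * p)) ^ 2)) : ℝ), ?_⟩
    ext i
    fin_cases i <;> simp [nullVec, Real.sq_sqrt hd, hp2]
    · ring
    · field_simp
    · field_simp
    · ring

/-- The dominant energy property of the Bel-Robinson tensor. -/
theorem belRob_nonneg (Q : Fin 3 → Fin 3 → ℂ) {x y z n : Fin 4 → ℝ}
    (hx0 : 0 ≤ x 0) (hx : minkowski x x ≤ 0) (hy0 : 0 ≤ y 0) (hy : minkowski y y ≤ 0)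
    (hz0 : 0 ≤ z 0) (hz : minkowski z z ≤ 0) (hn0 : 0 ≤ n 0) (hn : minkowski n n ≤ 0) :
    0 ≤ belRob (weylOfMatrix Q) x y z n := by
  obtain ⟨_, _, _, _, rfl⟩ := exists_eq_nullVec_add_nullVec hx0 hx
  obtain ⟨_, _, _, _, rfl⟩ := exists_eq_nullVec_add_nullVec hy0 hy
  obtain ⟨_, _, _, _, rfl⟩ := exists_eq_nullVec_add_nullVec hz0 hz
  obtain ⟨_, _, _, _, rfl⟩ := exists_eq_nullVec_add_nullVec hn0 hn
  have h : ∀ a₁ b₁ a₂ b₂ a₃ b₃ a₄ b₄ : ℂ, 0 ≤ belRob (weylOfMatrix Q) (nullVec a₁ b₁)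
      (nullVec a₂ b₂) (nullVec a₃ b₃) (nullVec a₄ b₄) := fun _ _ _ _ _ _ _ _ => by
    rw [belRob_nullVec]; exact mul_nonneg (by norm_num) (Complex.normSq_nonneg _)
  simp only [belRob_add_fst, belRob_add_snd, belRob_add_trd, belRob_add_fourth]
  exact add_nonneg (add_nonneg (add_nonneg (add_nonneg (h ..) (h ..)) (add_nonneg (h ..) (h ..)))
    (add_nonneg (add_nonneg (h ..) (h ..)) (add_nonneg (h ..) (h ..))))
    (add_nonneg (add_nonneg (add_nonneg (h ..) (h ..)) (add_nonneg (h ..) (h ..)))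
    (add_nonneg (add_nonneg (h ..) (h ..)) (add_nonneg (h ..) (h ..))))

/-! ### The Weyl tensor of an algebraic curvature tensor in an orthonormal frame -/

/-- The components of the Minkowski metric. -/
def minkMetric (i j : Fin 4) : ℝ := if i = j then minkSign i else 0

/-- The contraction `R_{cda}^d`. -/
def ricciComp (R : Fin 4 → Fin 4 → Fin 4 → Fin 4 → ℝ) (c a : Fin 4) : ℝ :=
  ∑ d, minkSign d * R c d a d

/-- The Schouten tensor of `R`. -/
def schoutenComp (R : Fin 4 → Fin 4 → Fin 4 → Fin 4 → ℝ) (a b : Fin 4) : ℝ :=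
  1 / 2 * (ricciComp R a b - 1 / 6 * minkMetric a b * ∑ c, minkSign c * ricciComp R c c)

/-- The Weyl tensor of `R`. -/
def weylComp (R : Fin 4 → Fin 4 → Fin 4 → Fin 4 → ℝ) (i j k l : Fin 4) : ℝ :=
  R i j k l + (minkMetric l i * schoutenComp R j k - minkMetric l j * schoutenComp R i k)
    - (minkMetric k i * schoutenComp R j l - minkMetric k j * schoutenComp R i l)

/-- The symmetries of a Riemann tensor with all indices lowered. -/
structure IsCurvatureTensor (R : Fin 4 → Fin 4 → Fin 4 → Fin 4 → ℝ) : Prop where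
  antisymm_left : ∀ i j k l, R i j k l = - R j i k l
  antisymm_right : ∀ i j k l, R i j k l = - R i j l k
  bianchi : ∀ i j k l, R i j k l + R j k i l + R k i j l = 0

/-- The classical octahedron argument: combine the four cyclic identities obtained by rotating the
indices. -/
lemma IsCurvatureTensor.pair_symm {R : Fin 4 → Fin 4 → Fin 4 → Fin 4 → ℝ}
    (h : IsCurvatureTensor R) (i j k l : Fin 4) : R i j k l = R k l i j := by
  have b1 := h.bianchi i j k l
  have b2 := h.bianchi j k l i
  have b3 := h.bianchi k l i j
  have b4 := h.bianchi l i j k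
  have a1 := h.antisymm_right j k i l
  have a2 := h.antisymm_right k l i j
  have a3 := h.antisymm_right l i j k
  have a4 := h.antisymm_right i j k l
  have a5 := h.antisymm_left k i j l
  have a6 := h.antisymm_left l j k i
  have a7 := h.antisymm_left i k l j
  have a8 := h.antisymm_left j l i k
  have a9 := h.antisymm_right i k j l
  have a10 := h.antisymm_right j l k i
  linarith

lemma antisymm_ext {A B : Fin 4 → Fin 4 → ℝ} (hA : ∀ i j, A i j = - A j i)
    (hB : ∀ i j, B i j = - B j i) (h1 : A 0 1 = B 0 1) (h2 : A 0 2 = B 0 2) (h3 : A 0 3 = B 0 3)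
    (h4 : A 2 3 = B 2 3) (h5 : A 1 3 = B 1 3) (h6 : A 1 2 = B 1 2) (i j : Fin 4) :
    A i j = B i j := by
  have hA0 : ∀ i, A i i = 0 := fun i => by linarith [hA i i]
  have hB0 : ∀ i, B i i = 0 := fun i => by linarith [hB i i]
  fin_cases i <;> fin_cases j <;> simp only [Fin.mk_zero, Fin.mk_one, Fin.reduceFinMk, hA0, hB0,
    hA 1 0, hA 2 0, hA 3 0, hA 3 2, hA 3 1, hA 2 1, hB 1 0, hB 2 0, hB 3 0, hB 3 2, hB 3 1, hB 2 1,
    h1, h2, h3, h4, h5, h6]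

lemma selfDual_antisymm (I : Fin 3) (i j : Fin 4) : selfDual I i j = - selfDual I j i := by
  fin_cases I <;> fin_cases i <;> fin_cases j <;> simp [selfDual]

-- For a trace-free curvature tensor the left and right duals agree, so the components `W_{0I0J}`
-- (electric) and `W_{*I 0J}` (magnetic) determine all others; `*I` runs through 23, 31, 12. Since
-- `selfDual I` takes the value 1 on `0I` and `i` on `*I`, the real part of `Q` must be the electric
-- part and its imaginary part minus the magnetic one. The proof compares the 36 independent
-- components.
set_option maxHeartbeats 4000000 in
theorem IsCurvatureTensor.exists_weylComp_eq {R : Fin 4 → Fin 4 → Fin 4 → Fin 4 → ℝ}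
    (h : IsCurvatureTensor R) : ∃ Q, weylComp R = weylOfMatrix Q := by
  refine ⟨fun I J => weylComp R 0 I.succ 0 J.succ - Complex.I *
    weylComp R ((![2, 3, 1] : Fin 3 → Fin 4) I) ((![3, 1, 2] : Fin 3 → Fin 4) I) 0 J.succ, ?_⟩
  have hd1 : ∀ i k l, R i i k l = 0 := fun i k l => by linarith [h.antisymm_left i i k l]
  have hd2 : ∀ i k l, R k l i i = 0 := fun i k l => by linarith [h.antisymm_right k l i i]
  have l10 := h.antisymm_left 1 0
  have l20 := h.antisymm_left 2 0
  have l30 := h.antisymm_left 3 0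
  have l21 := h.antisymm_left 2 1
  have l31 := h.antisymm_left 3 1
  have l32 := h.antisymm_left 3 2
  have r10 := fun i j => h.antisymm_right i j 1 0
  have r20 := fun i j => h.antisymm_right i j 2 0
  have r30 := fun i j => h.antisymm_right i j 3 0
  have r21 := fun i j => h.antisymm_right i j 2 1
  have r31 := fun i j => h.antisymm_right i j 3 1
  have r32 := fun i j => h.antisymm_right i j 3 2
  have p1 := h.pair_symm 0 2 0 1
  have p2 := h.pair_symm 0 3 0 1
  have p3 := h.pair_symm 0 3 0 2
  have p4 := fun j => h.pair_symm 1 2 0 j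
  have p5 := fun j => h.pair_symm 1 3 0 j
  have p6 := fun j => h.pair_symm 2 3 0 j
  have p7 := h.pair_symm 1 3 1 2
  have p8 := h.pair_symm 2 3 1 2
  have p9 := h.pair_symm 2 3 1 3
  -- The only cyclic identity not already implied by the antisymmetries and pair symmetry.
  have b : R 0 3 1 2 = R 0 2 1 3 - R 0 1 2 3 := by
    have := h.bianchi 1 2 3 0
    rw [h.pair_symm 1 2, h.pair_symm 2 3, h.pair_symm 3 1, l30, l10, l20, r31] at this
    linarith
  funext i j k l
  revert i j
  intro i j
  refine antisymm_ext (A := fun k l => weylComp R i j k l) ?_ ?_ ?_ ?_ ?_ ?_ ?_ ?_ k l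
  · intro k l
    simp only [weylComp, h.antisymm_right i j k l]; ring
  · intro k l
    simp only [weylOfMatrix, fun J => selfDual_antisymm J k l]
    simp [Fin.sum_univ_three]; ring
  all_goals
    refine antisymm_ext (A := fun i j => weylComp R i j _ _)
      (B := fun i j => weylOfMatrix _ i j _ _)
      ?_ ?_ ?_ ?_ ?_ ?_ ?_ ?_ i j
    · intro i j
      simp only [weylComp, h.antisymm_left i j]; ring
    · intro i j
      simp only [weylOfMatrix, fun J => selfDual_antisymm J i j]
      simp [Fin.sum_univ_three]
      try ring
    all_goals
      simp [weylOfMatrix, Fin.sum_univ_three, selfDual]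
      try simp [weylComp, schoutenComp, ricciComp, minkMetric, minkSign, Fin.sum_univ_four, hd1, hd2,
        l10, l20, l30, l21, l31, l32, r10, r20, r30, r21, r31, r32, p1, p2, p3, p4, p5, p6, p7, p8,
        p9, b]
      try ring

/-! ### Wedge products in low degrees -/

lemma fin_one_eta {V : Type*} (f : Fin 1 → V) : f = ![f 0] := by ext i; fin_cases i; rfl

lemma fin_two_eta {V : Type*} (f : Fin 2 → V) : f = ![f 0, f 1] := by ext i; fin_cases i <;> rfl

section wedge

variable {V : Type*} [AddCommGroup V] [Module ℝ V]

/-- Each shuffle is represented by `k! l!` permutations, all giving the same term. Summing over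
permutations makes the low-degree cases a finite enumeration. -/
lemma factorial_mul_wedge_apply {k l : ℕ} (α : V [⋀^Fin k]→ₗ[ℝ] ℝ) (β : V [⋀^Fin l]→ₗ[ℝ] ℝ)
    (v : Fin (k + l) → V) :
    (k.factorial * l.factorial : ℝ) * wedge α β v = ∑ σ : Equiv.Perm (Fin (k + l)),
      ((Equiv.Perm.sign σ : ℤ) : ℝ) * (α (fun i => v (σ (Fin.castAdd l i))) *
        β (fun i => v (σ (Fin.natAdd k i)))) := by
  have h := MultilinearMap.domCoprod_alternization_eq α β
  have h2 := congrArg (fun f => LinearMap.mul' ℝ ℝ (f (fun i => v (finSumFinEquiv i)))) h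
  simp only [Fintype.card_fin] at h2
  rw [AlternatingMap.smul_apply, map_nsmul, nsmul_eq_mul] at h2
  rw [wedge, AlternatingMap.domDomCongr_apply, LinearMap.compAlternatingMap_apply]
  push_cast at h2
  refine h2.symm.trans ?_
  rw [MultilinearMap.alternatization_apply, map_sum,
    ← Equiv.sum_comp (Equiv.permCongr (finSumFinEquiv (m := k) (n := l)))]
  refine Finset.sum_congr rfl fun σ _ => ?_
  rw [Units.smul_def, map_zsmul, zsmul_eq_mul, Equiv.Perm.sign_permCongr]
  simp [MultilinearMap.domDomCongr_apply, Equiv.permCongr_apply]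

lemma sum_perm_fin_two (f : Fin 2 → Fin 2 → ℝ) :
    ∑ σ : Equiv.Perm (Fin 2), ((Equiv.Perm.sign σ : ℤ) : ℝ) * f (σ 0) (σ 1) = f 0 1 - f 1 0 := by
  rw [show (Finset.univ : Finset (Equiv.Perm (Fin 2))) = {1, Equiv.swap 0 1} by decide,
    Finset.sum_pair (by decide)]
  simp
  ring

lemma sum_perm_fin_three (f : Fin 3 → Fin 3 → Fin 3 → ℝ) :
    ∑ σ : Equiv.Perm (Fin 3), ((Equiv.Perm.sign σ : ℤ) : ℝ) * f (σ 0) (σ 1) (σ 2) =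
      f 0 1 2 - f 1 0 2 - f 2 1 0 - f 0 2 1 + f 1 2 0 + f 2 0 1 := by
  rw [show (Finset.univ : Finset (Equiv.Perm (Fin 3))) =
    {1, Equiv.swap 0 1, Equiv.swap 0 2, Equiv.swap 1 2, finRotate 3, (finRotate 3)⁻¹} by decide,
    Finset.sum_insert (by decide), Finset.sum_insert (by decide), Finset.sum_insert (by decide),
    Finset.sum_insert (by decide), Finset.sum_insert (by decide), Finset.sum_singleton]
  rw [show (finRotate 3)⁻¹ 0 = 2 by decide, show (finRotate 3)⁻¹ 1 = 0 by decide,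
    show (finRotate 3)⁻¹ 2 = 1 by decide, show (finRotate 3) 0 = 1 by decide,
    show (finRotate 3) 1 = 2 by decide, show (finRotate 3) 2 = 0 by decide,
    show Equiv.swap (0 : Fin 3) 1 2 = 2 by decide, show Equiv.swap (0 : Fin 3) 2 1 = 1 by decide,
    show Equiv.swap (1 : Fin 3) 2 0 = 0 by decide, Equiv.Perm.sign_inv,
    show Equiv.Perm.sign (finRotate 3) = 1 by decide]
  simp
  ring

lemma AlternatingMap.map_swap_two (β : V [⋀^Fin 2]→ₗ[ℝ] ℝ) (x y : V) :
    β ![x, y] = - β ![y, x] := by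
  rw [← β.map_swap ![y, x] (show (0 : Fin 2) ≠ 1 by decide)]
  congr 1
  ext i; fin_cases i <;> rfl

lemma wedge_one_one (α β : V [⋀^Fin 1]→ₗ[ℝ] ℝ) (w : Fin 2 → V) :
    wedge α β w = α ![w 0] * β ![w 1] - α ![w 1] * β ![w 0] := by
  have h := factorial_mul_wedge_apply α β w
  have h2 := h.trans (((Finset.sum_congr rfl fun σ _ => by
    rw [fin_one_eta fun i => w (σ (Fin.castAdd 1 i)), fin_one_eta fun i => w (σ (Fin.natAdd 1 i))]
    rfl)).trans (sum_perm_fin_two fun i j => α ![w i] * β ![w j]))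
  simpa using h2

lemma wedge_one_two (α : V [⋀^Fin 1]→ₗ[ℝ] ℝ) (β : V [⋀^Fin 2]→ₗ[ℝ] ℝ) (w : Fin 3 → V) :
    wedge α β w = α ![w 0] * β ![w 1, w 2] - α ![w 1] * β ![w 0, w 2]
      + α ![w 2] * β ![w 0, w 1] := by
  have h := factorial_mul_wedge_apply α β w
  have h2 := h.trans (((Finset.sum_congr rfl fun σ _ => by
    rw [fin_one_eta fun i => w (σ (Fin.castAdd 2 i)), fin_two_eta fun i => w (σ (Fin.natAdd 1 i))]
    rfl)).trans (sum_perm_fin_three fun i j k => α ![w i] * β ![w j, w k]))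
  rw [AlternatingMap.map_swap_two β (w 2) (w 0), AlternatingMap.map_swap_two β (w 2) (w 1),
    AlternatingMap.map_swap_two β (w 1) (w 0)] at h2
  simp [Nat.factorial] at h2
  linarith

lemma wedge_two_one (β : V [⋀^Fin 2]→ₗ[ℝ] ℝ) (α : V [⋀^Fin 1]→ₗ[ℝ] ℝ) (w : Fin 3 → V) :
    wedge β α w = α ![w 0] * β ![w 1, w 2] - α ![w 1] * β ![w 0, w 2]
      + α ![w 2] * β ![w 0, w 1] := by
  have h := factorial_mul_wedge_apply β α w
  have h2 := h.trans (((Finset.sum_congr rfl fun σ _ => by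
    rw [fin_one_eta fun i => w (σ (Fin.natAdd 2 i)), fin_two_eta fun i => w (σ (Fin.castAdd 1 i))]
    rfl)).trans (sum_perm_fin_three fun i j k => β ![w i, w j] * α ![w k]))
  rw [AlternatingMap.map_swap_two β (w 2) (w 0), AlternatingMap.map_swap_two β (w 2) (w 1),
    AlternatingMap.map_swap_two β (w 1) (w 0)] at h2
  simp [Nat.factorial] at h2
  linarith

end wedge

/-! ### The Bel-Robinson 3-form in terms of the Bel-Robinson tensor -/

section eval

variable {V : Type*} [AddCommGroup V] [Module ℝ V]

/-- A 1-form as a linear functional. -/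
def evalOne : (V [⋀^Fin 1]→ₗ[ℝ] ℝ) →ₗ[ℝ] V →ₗ[ℝ] ℝ where
  toFun γ :=
    { toFun := fun x => γ ![x]
      map_add' := fun x y => by
        change γ.curryLeft (x + y) ![] = γ.curryLeft x ![] + γ.curryLeft y ![]
        simp only [map_add, AlternatingMap.add_apply]
      map_smul' := fun c x => by
        change γ.curryLeft (c • x) ![] = c • γ.curryLeft x ![]
        simp only [map_smul, AlternatingMap.smul_apply] }
  map_add' _ _ := rfl
  map_smul' _ _ := rfl

/-- A 2-form as a bilinear form. -/
def evalTwo : (V [⋀^Fin 2]→ₗ[ℝ] ℝ) →ₗ[ℝ] V →ₗ[ℝ] V →ₗ[ℝ] ℝ :=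
  evalOne.compRight ℝ ∘ₗ AlternatingMap.curryLeftLinearMap

/-- A 3-form as a trilinear form. -/
def evalThree : (V [⋀^Fin 3]→ₗ[ℝ] ℝ) →ₗ[ℝ] V →ₗ[ℝ] V →ₗ[ℝ] V →ₗ[ℝ] ℝ :=
  evalTwo.compRight ℝ ∘ₗ AlternatingMap.curryLeftLinearMap

/-- A 4-form as a quadrilinear form. -/
def evalFour : (V [⋀^Fin 4]→ₗ[ℝ] ℝ) →ₗ[ℝ] V →ₗ[ℝ] V →ₗ[ℝ] V →ₗ[ℝ] V →ₗ[ℝ] ℝ :=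
  evalThree.compRight ℝ ∘ₗ AlternatingMap.curryLeftLinearMap

lemma evalTwo_apply (γ : V [⋀^Fin 2]→ₗ[ℝ] ℝ) (x y : V) : evalTwo γ x y = γ ![x, y] := rfl

lemma evalThree_apply (γ : V [⋀^Fin 3]→ₗ[ℝ] ℝ) (x y z : V) :
    evalThree γ x y z = γ ![x, y, z] := rfl

lemma evalFour_apply (γ : V [⋀^Fin 4]→ₗ[ℝ] ℝ) (x y z w : V) :
    evalFour γ x y z w = γ ![x, y, z, w] := rfl

lemma sum_repr_mul {ι : Type*} [Fintype ι] (b : Module.Basis ι ℝ V) (φ : V →ₗ[ℝ] ℝ) (x : V) :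
    ∑ i, b.repr x i * φ (b i) = φ x := by
  conv_rhs => rw [← b.sum_repr x, map_sum]
  simp

lemma sum_sum_repr_mul {ι : Type*} [Fintype ι] (b : Module.Basis ι ℝ V) (B : V →ₗ[ℝ] V →ₗ[ℝ] ℝ)
    (x y : V) : ∑ i, ∑ j, b.repr x i * b.repr y j * B (b i) (b j) = B x y := by
  simp only [mul_assoc, ← Finset.mul_sum, sum_repr_mul b (B _)]
  exact sum_repr_mul b (B.flip y) x

end eval

/-! ### Moving metric contractions from the given frame to an orthonormal basis. -/

lemma sum_minkMetric_mul (i : Fin 4) (f : Fin 4 → ℝ) :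
    ∑ j, minkMetric i j * f j = minkSign i * f i := by
  simp [minkMetric]

lemma minkSign_mul_self (i : Fin 4) : minkSign i * minkSign i = 1 := by
  fin_cases i <;> simp [minkSign]

namespace FrameData

variable {V : Type*} [AddCommGroup V] [Module ℝ V] (A : FrameData V)
  (E : Module.Basis (Fin 4) ℝ V)

lemma g_eq_minkowski (hE : ∀ i j, A.g (E i) (E j) = minkMetric i j) (x y : V) :
    A.g x y = minkowski (E.repr x) (E.repr y) := by
  rw [← sum_sum_repr_mul E A.g x y, minkowski]
  refine Finset.sum_congr rfl fun i _ => ?_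
  simp only [hE, mul_assoc, ← Finset.mul_sum, mul_comm (E.repr y _)]
  rw [sum_minkMetric_mul]; ring

/-- With `P` the change of basis and `D` the diagonal signature, `g = P D Pᵀ`; inverting gives `Pᵀ
g⁻¹ P = D⁻¹ = D`. -/
lemma sum_gUp_mul_repr (hE : ∀ i j, A.g (E i) (E j) = minkMetric i j) (i j : Fin 4) :
    ∑ a, ∑ b, A.gUp a b * (E.repr (A.e a) i * E.repr (A.e b) j) = minkMetric i j := by
  set P : Matrix (Fin 4) (Fin 4) ℝ := Matrix.of fun a i => E.repr (A.e a) i with hP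
  set D : Matrix (Fin 4) (Fin 4) ℝ := Matrix.diagonal minkSign with hD
  have hPu : IsUnit P.det := by
    have : P = (E.toMatrix A.e).transpose := by ext; rfl
    rw [this, Matrix.det_transpose, ← Module.Basis.det_apply]
    exact E.isUnit_det A.e
  have hDD : D * D = 1 := by
    rw [hD, Matrix.diagonal_mul_diagonal, ← Matrix.diagonal_one]
    congr 1; ext i; exact minkSign_mul_self i
  have hG : A.gLow = P * D * P.transpose := by
    ext a b
    rw [gLow, Matrix.of_apply, g_eq_minkowski A E hE, minkowski, Matrix.mul_apply]
    refine Finset.sum_congr rfl fun i _ => ?_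
    simp [hD, Matrix.mul_diagonal, hP]; ring
  have hU : P.transpose * A.gUp * P = D := by
    have hPt : IsUnit P.transpose.det := by rwa [Matrix.det_transpose]
    rw [gUp, hG, Matrix.mul_inv_rev, Matrix.mul_inv_rev, Matrix.inv_eq_left_inv hDD,
      ← Matrix.mul_assoc, Matrix.mul_nonsing_inv _ hPt, Matrix.one_mul, Matrix.mul_assoc,
      Matrix.nonsing_inv_mul _ hPu, Matrix.mul_one]
  have h := congrFun (congrFun hU i) j
  rw [Matrix.mul_apply] at h
  rw [show minkMetric i j = D i j by simp [hD, minkMetric, Matrix.diagonal_apply], ← h,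
    Finset.sum_comm]
  refine Finset.sum_congr rfl fun b _ => ?_
  rw [Matrix.mul_apply, Finset.sum_mul]
  refine Finset.sum_congr rfl fun a _ => ?_
  simp [hP]; ring

/-- A metric contraction can be computed in any frame. -/
lemma sum_gUp_mul_bilin (hE : ∀ i j, A.g (E i) (E j) = minkMetric i j)
    (B : V →ₗ[ℝ] V →ₗ[ℝ] ℝ) :
    ∑ a, ∑ b, A.gUp a b * B (A.e a) (A.e b) = ∑ i, minkSign i * B (E i) (E i) := by
  have h : ∀ a b, A.gUp a b * B (A.e a) (A.e b) = ∑ i, ∑ j,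
      A.gUp a b * (E.repr (A.e a) i * E.repr (A.e b) j) * B (E i) (E j) := by
    intro a b
    rw [← sum_sum_repr_mul E B]
    simp only [Finset.mul_sum, mul_assoc]
  simp only [h]
  have : ∑ a, ∑ b, ∑ i, ∑ j,
      A.gUp a b * (E.repr (A.e a) i * E.repr (A.e b) j) * B (E i) (E j) =
      ∑ i, ∑ j, (∑ a, ∑ b, A.gUp a b * (E.repr (A.e a) i * E.repr (A.e b) j)) * B (E i) (E j) := by
    simp only [Finset.sum_mul]
    rw [Finset.sum_congr rfl fun a _ => Finset.sum_comm, Finset.sum_comm]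
    refine Finset.sum_congr rfl fun i _ => ?_
    rw [Finset.sum_congr rfl fun a _ => Finset.sum_comm, Finset.sum_comm]
  rw [this]
  simp only [sum_gUp_mul_repr A E hE, sum_minkMetric_mul]

lemma isUnit_det_gLow (hE : ∀ i j, A.g (E i) (E j) = minkMetric i j) : IsUnit A.gLow.det := by
  by_contra h
  -- The inverse of a singular matrix is zero by convention, which would make the contraction just
  -- computed vanish.
  have h0 : A.gUp = 0 := by
    rw [gUp, Matrix.nonsing_inv_apply_not_isUnit _ h]
  have := sum_gUp_mul_repr A E hE 1 1
  simp [h0, minkMetric, minkSign] at this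

lemma sum_gLow_mul_gUp (hE : ∀ i j, A.g (E i) (E j) = minkMetric i j) (a c : Fin 4) :
    ∑ b, A.gLow a b * A.gUp b c = if a = c then 1 else 0 := by
  rw [← Matrix.mul_apply, gUp, Matrix.mul_nonsing_inv _ (isUnit_det_gLow A E hE), Matrix.one_apply]

lemma theta_apply (a : Fin 4) (x : V) : A.theta a ![x] = A.e.repr x a := rfl

end FrameData

/-! #### Contraction with the volume form -/

/-- By antisymmetry each of the four increasing triples occurs six times, which absorbs the factor
1/6; the minus signs mark the triples containing the time index. -/
lemma sum_volume_contract {D : Fin 4 → Fin 4 → Fin 4 → ℝ} (h1 : ∀ p q r, D p q r = - D q p r)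
    (h2 : ∀ p q r, D p q r = - D p r q) {X : Fin 4 → Fin 4 → ℝ} (hX : ∀ i j, X i j = - X j i)
    (t : Fin 4 → ℝ) :
    1 / 6 * ∑ p, ∑ q, ∑ r, minkSign p * minkSign q * minkSign r *
      ((t p * X q r - t q * X p r + t r * X p q) * D p q r) =
    D 1 2 3 * (t 1 * X 2 3 - t 2 * X 1 3 + t 3 * X 1 2)
      - D 0 2 3 * (t 0 * X 2 3 - t 2 * X 0 3 + t 3 * X 0 2)
      - D 0 1 3 * (t 0 * X 1 3 - t 1 * X 0 3 + t 3 * X 0 1)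
      - D 0 1 2 * (t 0 * X 1 2 - t 1 * X 0 2 + t 2 * X 0 1) := by
  have hX0 : ∀ i, X i i = 0 := fun i => by linarith [hX i i]
  have hd1 : ∀ p r, D p p r = 0 := fun p r => by linarith [h1 p p r]
  have hd2 : ∀ p r, D p r r = 0 := fun p r => by linarith [h2 p r r]
  have hd3 : ∀ p r, D p r p = 0 := fun p r => by rw [h1, hd2, neg_zero]
  simp only [Fin.sum_univ_four, hd1, hd2, hd3, h1 1 0, h1 2 0, h1 3 0, h1 2 1, h1 3 1,
    fun p => h2 p 1 0, fun p => h2 p 2 0, fun p => h2 p 3 0, fun p => h2 p 2 1, fun p => h2 p 3 1,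
    fun p => h2 p 3 2, hX 1 0, hX 2 0, hX 3 0, hX 2 1, hX 3 1, hX 3 2]
  simp [minkSign]
  ring

lemma alternating_sum_apply {V ι κ : Type*} [AddCommGroup V] [Module ℝ V] (s : Finset κ)
    (f : κ → V [⋀^ι]→ₗ[ℝ] ℝ) (v : ι → V) : (∑ i ∈ s, f i) v = ∑ i ∈ s, f i v := by
  classical
  induction s using Finset.induction_on with
  | empty => simp
  | insert a s ha ih => rw [Finset.sum_insert ha, Finset.sum_insert ha, AlternatingMap.add_apply, ih]

/-- The determinant of four vectors of `ℝ⁴`. -/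
def detFour (x y z w : Fin 4 → ℝ) : ℝ :=
  (x 0 * y 1 - x 1 * y 0) * (z 2 * w 3 - z 3 * w 2)
    - (x 0 * y 2 - x 2 * y 0) * (z 1 * w 3 - z 3 * w 1)
    + (x 0 * y 3 - x 3 * y 0) * (z 1 * w 2 - z 2 * w 1)
    + (x 1 * y 2 - x 2 * y 1) * (z 0 * w 3 - z 3 * w 0)
    - (x 1 * y 3 - x 3 * y 1) * (z 0 * w 2 - z 2 * w 0)
    + (x 2 * y 3 - x 3 * y 2) * (z 0 * w 1 - z 1 * w 0)

lemma det_eq_detFour (M : Matrix (Fin 4) (Fin 4) ℝ) :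
    M.det = detFour (M 0) (M 1) (M 2) (M 3) := by
  rw [Matrix.det_succ_row_zero]
  simp only [Fin.sum_univ_four, Matrix.det_fin_three, Matrix.submatrix_apply, detFour]
  simp [Fin.succAbove, Fin.lt_def]
  ring

lemma alternating_apply_eq_detFour {V : Type*} [AddCommGroup V] [Module ℝ V]
    (E : Module.Basis (Fin 4) ℝ V) (η : V [⋀^Fin 4]→ₗ[ℝ] ℝ) (x y z w : V) :
    η ![x, y, z, w] = η E * detFour (E.repr x) (E.repr y) (E.repr z) (E.repr w) := by
  conv_lhs => rw [η.eq_smul_basis_det E]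
  rw [AlternatingMap.smul_apply, smul_eq_mul, Module.Basis.det_apply, ← Matrix.det_transpose,
    det_eq_detFour]
  rfl

/-- The vector dual to the 3-vector `w₁ ∧ w₂ ∧ w₃`; `s` is the orientation. -/
def dualVec (s : ℝ) (w₁ w₂ w₃ : Fin 4 → ℝ) (d : Fin 4) : ℝ :=
  - (minkSign d * (s * detFour w₁ w₂ w₃ (Pi.single d 1)))

/-- The sign is chosen so that a vector on the positive side of the hyperplane has negative product
with the normal, as two vectors in the same causal cone do. -/
lemma minkowski_dualVec (s : ℝ) (w₁ w₂ w₃ v : Fin 4 → ℝ) :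
    minkowski (dualVec s w₁ w₂ w₃) v = - (s * detFour w₁ w₂ w₃ v) := by
  simp [minkowski, dualVec, Fin.sum_univ_four, detFour, minkSign, Pi.single_apply]
  ring

/-- The components of `*(X ∧ x)`. -/
def hodgeComp (s : ℝ) (x : Fin 4 → ℝ) (X : Fin 4 → Fin 4 → ℝ) : Fin 4 → ℝ :=
  ![- s * (x 1 * X 2 3 - x 2 * X 1 3 + x 3 * X 1 2),
    - s * (- x 0 * X 2 3 - x 2 * X 0 3 + x 3 * X 0 2),
    s * (- x 0 * X 1 3 - x 1 * X 0 3 + x 3 * X 0 1),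
    - s * (- x 0 * X 1 2 - x 1 * X 0 2 + x 2 * X 0 1)]

/-- Expansion of a 3-form in the 3×3 minors of `(u, v, w)`, each minor written as a determinant with
one basis vector inserted. -/
lemma wedge_comp (o : Fin 4 → ℝ) {X : Fin 4 → Fin 4 → ℝ} (hX : ∀ i j, X i j = - X j i)
    (u v w : Fin 4 → ℝ) :
    (∑ i, o i * u i) * (∑ i, ∑ j, v i * w j * X i j)
      - (∑ i, o i * v i) * (∑ i, ∑ j, u i * w j * X i j)
      + (∑ i, o i * w i) * (∑ i, ∑ j, u i * v j * X i j) =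
    - detFour u v w (Pi.single 0 1) * (o 1 * X 2 3 - o 2 * X 1 3 + o 3 * X 1 2)
      + detFour u v w (Pi.single 1 1) * (o 0 * X 2 3 - o 2 * X 0 3 + o 3 * X 0 2)
      - detFour u v w (Pi.single 2 1) * (o 0 * X 1 3 - o 1 * X 0 3 + o 3 * X 0 1)
      + detFour u v w (Pi.single 3 1) * (o 0 * X 1 2 - o 1 * X 0 2 + o 2 * X 0 1) := by
  have hX0 : ∀ i, X i i = 0 := fun i => by linarith [hX i i]
  simp only [Fin.sum_univ_four, hX0, hX 1 0, hX 2 0, hX 3 0, hX 2 1, hX 3 1, hX 3 2]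
  simp [detFour]
  ring

/-- Since `*(X ∧ x)` is, up to sign, the contraction of `x` with `*X`, the left side pairs `*X` with
`*X'` over one index. The product of two volume tensors then trades the duals for `X, X'` plus a
trace term; this is the source of the form of `stress`. -/
lemma hodge_wedge_eq_stress (s : ℝ) (x : Fin 4 → ℝ) {X X' : Fin 4 → Fin 4 → ℝ}
    (hX : ∀ i j, X i j = - X j i) (hX' : ∀ i j, X' i j = - X' j i) (u v w : Fin 4 → ℝ) :
    (∑ i, hodgeComp s x X i * u i) * (∑ i, ∑ j, v i * w j * X' i j)
      - (∑ i, hodgeComp s x X i * v i) * (∑ i, ∑ j, u i * w j * X' i j)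
      + (∑ i, hodgeComp s x X i * w i) * (∑ i, ∑ j, u i * v j * X' i j) =
    stress x (dualVec s u v w) X X' := by
  rw [wedge_comp _ hX', stress, minkowski_comm, minkowski_dualVec]
  have hd : detFour u v w x = ∑ d, x d * detFour u v w (Pi.single d 1) := by
    simp [Fin.sum_univ_four, detFour, Pi.single_apply]; ring
  rw [hd]
  unfold dualVec
  generalize (fun d => detFour u v w (Pi.single d 1)) = D
  have hX0 : ∀ i, X i i = 0 := fun i => by linarith [hX i i]
  have hX0' : ∀ i, X' i i = 0 := fun i => by linarith [hX' i i]
  simp only [Fin.sum_univ_four, hX0, hX 1 0, hX 2 0, hX 3 0, hX 2 1, hX 3 1, hX 3 2, 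
    hX0', hX' 1 0, hX' 2 0, hX' 3 0, hX' 2 1, hX' 3 1, hX' 3 2]
  simp [hodgeComp, minkSign]
  ring

namespace FrameData

variable {V : Type*} [AddCommGroup V] [Module ℝ V] (A : FrameData V)
  (E : Module.Basis (Fin 4) ℝ V)

lemma sum_fin_three_fun (f : (Fin 3 → Fin 4) → ℝ) :
    ∑ a, f a = ∑ p, ∑ q, ∑ r, f ![p, q, r] := by
  rw [← Fintype.sum_prod_type', ← Fintype.sum_prod_type']
  refine Fintype.sum_equiv
    { toFun := fun a => ((a 0, a 1), a 2)
      invFun := fun p => ![p.1.1, p.1.2, p.2]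
      left_inv := fun a => by ext i; fin_cases i <;> rfl
      right_inv := fun p => rfl } _ _ fun a => ?_
  congr 1
  ext i; fin_cases i <;> rfl

/-- The Hodge dual contains three independent metric contractions. They are moved to the orthonormal
basis one index pair at a time by `sum_gUp_mul_bilin`. -/
lemma star_apply (hE : ∀ i j, A.g (E i) (E j) = minkMetric i j) (β : V [⋀^Fin 3]→ₗ[ℝ] ℝ) (w : V) :
    A.star β ![w] = 1 / 6 * ∑ p, ∑ q, ∑ r, minkSign p * minkSign q * minkSign r *
      (β ![E p, E q, E r] * A.η ![E p, E q, E r, w]) := by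
  have h1 : A.star β ![w] = 1 / 6 * ∑ a, ∑ b, ∑ c, ∑ i, ∑ j, ∑ k,
      A.gUp a i * A.gUp b j * A.gUp c k * (evalThree β (A.e i) (A.e j) (A.e k) *
        evalFour A.η (A.e a) (A.e b) (A.e c) w) := by
    rw [star, AlternatingMap.smul_apply, smul_eq_mul, alternating_sum_apply, sum_fin_three_fun]
    congr 1
    refine Finset.sum_congr rfl fun a _ => Finset.sum_congr rfl fun b _ =>
      Finset.sum_congr rfl fun c _ => ?_
    rw [AlternatingMap.smul_apply, smul_eq_mul, sum_fin_three_fun, Finset.sum_mul]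
    refine Finset.sum_congr rfl fun i _ => ?_
    rw [Finset.sum_mul]
    refine Finset.sum_congr rfl fun j _ => ?_
    rw [Finset.sum_mul]
    refine Finset.sum_congr rfl fun k _ => ?_
    simp only [Fin.prod_univ_three]
    rw [show (fun m => A.e (![i, j, k] m)) = ![A.e i, A.e j, A.e k] by
      ext m; fin_cases m <;> rfl]
    rw [mul_assoc]
    rfl
  rw [h1]
  congr 1
  have c3 : ∀ x y x' y' : V, ∑ c, ∑ k, A.gUp c k * (evalThree β x y (A.e k) *
      evalFour A.η x' y' (A.e c) w) = ∑ r, minkSign r * (evalThree β x y (E r) *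
      evalFour A.η x' y' (E r) w) := fun x y x' y' =>
    A.sum_gUp_mul_bilin E hE (LinearMap.mk₂ ℝ (fun s t => evalThree β x y t *
      evalFour A.η x' y' s w) (by intros; simp; ring) (by intros; simp; ring)
      (by intros; simp; ring) (by intros; simp; ring))
  have c2 : ∀ (r : Fin 4) (x x' : V), ∑ b, ∑ j, A.gUp b j * (evalThree β x (A.e j) (E r) *
      evalFour A.η x' (A.e b) (E r) w) = ∑ q, minkSign q * (evalThree β x (E q) (E r) *
      evalFour A.η x' (E q) (E r) w) := fun r x x' =>
    A.sum_gUp_mul_bilin E hE (LinearMap.mk₂ ℝ (fun s t => evalThree β x t (E r) *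
      evalFour A.η x' s (E r) w) (by intros; simp; ring) (by intros; simp; ring)
      (by intros; simp; ring) (by intros; simp; ring))
  have c1 : ∀ (q r : Fin 4), ∑ a, ∑ i, A.gUp a i * (evalThree β (A.e i) (E q) (E r) *
      evalFour A.η (A.e a) (E q) (E r) w) = ∑ p, minkSign p * (evalThree β (E p) (E q) (E r) *
      evalFour A.η (E p) (E q) (E r) w) := fun q r =>
    A.sum_gUp_mul_bilin E hE (LinearMap.mk₂ ℝ (fun s t => evalThree β t (E q) (E r) *
      evalFour A.η s (E q) (E r) w) (by intros; simp; ring) (by intros; simp; ring)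
      (by intros; simp; ring) (by intros; simp; ring))
  calc _ = ∑ a, ∑ i, A.gUp a i * ∑ b, ∑ j, A.gUp b j * ∑ c, ∑ k, A.gUp c k *
        (evalThree β (A.e i) (A.e j) (A.e k) * evalFour A.η (A.e a) (A.e b) (A.e c) w) := by
        refine Finset.sum_congr rfl fun a _ => ?_
        rw [Finset.sum_congr rfl fun b _ => Finset.sum_comm, Finset.sum_comm]
        refine Finset.sum_congr rfl fun i _ => ?_
        simp only [Finset.mul_sum]
        refine Finset.sum_congr rfl fun b _ => ?_
        rw [Finset.sum_comm]
        exact Finset.sum_congr rfl fun j _ => Finset.sum_congr rfl fun c _ =>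
          Finset.sum_congr rfl fun k _ => by ring
    _ = ∑ a, ∑ i, A.gUp a i * ∑ r, minkSign r * ∑ b, ∑ j, A.gUp b j * 
        (evalThree β (A.e i) (A.e j) (E r) * evalFour A.η (A.e a) (A.e b) (E r) w) := by
        simp only [c3]
        refine Finset.sum_congr rfl fun a _ => Finset.sum_congr rfl fun i _ => ?_
        congr 1
        simp only [Finset.mul_sum]
        rw [Finset.sum_congr rfl fun b _ => Finset.sum_comm, Finset.sum_comm]
        exact Finset.sum_congr rfl fun j _ => Finset.sum_congr rfl fun c _ =>
          Finset.sum_congr rfl fun k _ => by ring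
    _ = ∑ r, minkSign r * ∑ q, minkSign q * ∑ a, ∑ i, A.gUp a i *
        (evalThree β (A.e i) (E q) (E r) * evalFour A.η (A.e a) (E q) (E r) w) := by
        simp only [c2]
        simp only [Finset.mul_sum]
        rw [Finset.sum_congr rfl fun b _ => Finset.sum_comm, Finset.sum_comm]
        refine Finset.sum_congr rfl fun r _ => ?_
        rw [Finset.sum_congr rfl fun b _ => Finset.sum_comm, Finset.sum_comm]
        exact Finset.sum_congr rfl fun j _ => Finset.sum_congr rfl fun c _ =>
          Finset.sum_congr rfl fun k _ => by ring
    _ = _ := by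
        simp only [c1]
        simp only [Finset.mul_sum]
        rw [Finset.sum_congr rfl fun b _ => Finset.sum_comm, Finset.sum_comm,
          Finset.sum_congr rfl fun b _ => Finset.sum_comm]
        exact Finset.sum_congr rfl fun j _ => Finset.sum_congr rfl fun c _ =>
          Finset.sum_congr rfl fun k _ => by simp only [evalThree_apply, evalFour_apply]; ring

lemma thetaLow_apply (a : Fin 4) (x : V) : A.thetaLow a ![x] = A.g (A.e a) x := by
  rw [thetaLow, alternating_sum_apply, ← sum_repr_mul A.e (A.g (A.e a)) x]
  refine Finset.sum_congr rfl fun b _ => ?_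
  rw [AlternatingMap.smul_apply, theta_apply, gLow, Matrix.of_apply, smul_eq_mul, mul_comm]

lemma star_wedge_thetaLow_apply (hE : ∀ i j, A.g (E i) (E j) = minkMetric i j)
    (X : V [⋀^Fin 2]→ₗ[ℝ] ℝ) (a : Fin 4) (w : V) :
    A.star (wedge X (A.thetaLow a)) ![w] =
      ∑ i, hodgeComp (A.η E) (E.repr (A.e a)) (fun i j => X ![E i, E j]) i * E.repr w i := by
  rw [star_apply A E hE]
  have h := sum_volume_contract (D := fun p q r => A.η ![E p, E q, E r, w]) ?_ ?_
    (X := fun i j => X ![E i, E j]) (fun i j => AlternatingMap.map_swap_two X _ _)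
    (fun i => minkSign i * E.repr (A.e a) i)
  · have ht : ∀ i, A.thetaLow a ![E i] = minkSign i * E.repr (A.e a) i := by
      intro i
      rw [thetaLow_apply, g_eq_minkowski A E hE, minkowski, Finset.sum_eq_single i]
      · simp
      · intro b _ hb; simp [hb]
      · simp
    have e1 : ∀ p q r, wedge X (A.thetaLow a) ![E p, E q, E r] =
        (minkSign p * E.repr (A.e a) p) * X ![E q, E r]
        - (minkSign q * E.repr (A.e a) q) * X ![E p, E r]
        + (minkSign r * E.repr (A.e a) r) * X ![E p, E q] := by
      intro p q r
      rw [← ht, ← ht, ← ht, wedge_two_one]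
      rfl
    simp only [e1]
    refine h.trans ?_
    simp only [alternating_apply_eq_detFour E A.η, Module.Basis.repr_self, Fin.sum_univ_four]
    simp [hodgeComp, detFour, minkSign]
    ring
  · intro p q r
    simp only [alternating_apply_eq_detFour E A.η, detFour]; ring
  · intro p q r
    simp only [alternating_apply_eq_detFour E A.η, detFour]; ring

/-- The wedge product of `*(X ∧ θ_a)` and `X'` is a polarized stress tensor. -/
lemma wedge_star_apply (hE : ∀ i j, A.g (E i) (E j) = minkMetric i j) 
    (X X' : V [⋀^Fin 2]→ₗ[ℝ] ℝ) (a : Fin 4) (w : Fin 3 → V) :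
    wedge (A.star (wedge X (A.thetaLow a))) X' w =
      stress (E.repr (A.e a))
        (dualVec (A.η E) (E.repr (w 0)) (E.repr (w 1)) (E.repr (w 2)))
        (fun i j => X ![E i, E j]) (fun i j => X' ![E i, E j]) := by
  rw [← hodge_wedge_eq_stress _ _ (fun i j => AlternatingMap.map_swap_two X _ _)
    (fun i j => AlternatingMap.map_swap_two X' _ _), wedge_one_two]
  simp only [star_wedge_thetaLow_apply A E hE]
  simp only [← evalTwo_apply, sum_sum_repr_mul E (evalTwo X')]

end FrameData

/-! ### The Weyl 2-forms as a frame-independent bilinear map, and the resulting formula for the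
3-form. -/

lemma stress_smul_form_left (x n : Fin 4 → ℝ) (c : ℝ) (X X' : Fin 4 → Fin 4 → ℝ) :
    stress x n (c • X) X' = c * stress x n X X' := by
  simp only [stress, Fin.sum_univ_four, Pi.smul_apply, smul_eq_mul]
  ring

lemma stress_smul_form_right (x n : Fin 4 → ℝ) (c : ℝ) (X X' : Fin 4 → Fin 4 → ℝ) :
    stress x n X (c • X') = c * stress x n X X' := by
  simp only [stress, Fin.sum_univ_four, Pi.smul_apply, smul_eq_mul]
  ring

/-- `stress x n` as a bilinear form on 2-forms. -/
def stressBilin (x n : Fin 4 → ℝ) :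
    (Fin 4 → Fin 4 → ℝ) →ₗ[ℝ] (Fin 4 → Fin 4 → ℝ) →ₗ[ℝ] ℝ :=
  LinearMap.mk₂ ℝ (stress x n) (fun X Y X' => stress_add_form_left x n X Y X')
    (stress_smul_form_left x n) (fun X X' Y => stress_add_form_right x n X X' Y)
    (fun c X X' => stress_smul_form_right x n c X X')

lemma stressBilin_apply (x n : Fin 4 → ℝ) (X X' : Fin 4 → Fin 4 → ℝ) :
    stressBilin x n X X' = stress x n X X' := rfl

lemma wedge_add_left {V : Type*} [AddCommGroup V] [Module ℝ V] (α α' : V [⋀^Fin 1]→ₗ[ℝ] ℝ)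
    (β : V [⋀^Fin 2]→ₗ[ℝ] ℝ) (w : Fin 3 → V) :
    wedge (α + α') β w = wedge α β w + wedge α' β w := by
  simp only [wedge_one_two, AlternatingMap.add_apply]; ring

lemma wedge_smul_left {V : Type*} [AddCommGroup V] [Module ℝ V] (r : ℝ) (α : V [⋀^Fin 1]→ₗ[ℝ] ℝ)
    (β : V [⋀^Fin 2]→ₗ[ℝ] ℝ) (w : Fin 3 → V) :
    wedge (r • α) β w = r * wedge α β w := by
  simp only [wedge_one_two, AlternatingMap.smul_apply, smul_eq_mul]; ring

namespace FrameData

variable {V : Type*} [AddCommGroup V] [Module ℝ V] (A : FrameData V)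
  (E : Module.Basis (Fin 4) ℝ V) (Rm : V →ₗ[ℝ] V →ₗ[ℝ] V →ₗ[ℝ] V →ₗ[ℝ] ℝ)

/-- The Ricci tensor of a quadrilinear form. -/
def ricciBilin : V →ₗ[ℝ] V →ₗ[ℝ] ℝ :=
  LinearMap.mk₂ ℝ (fun x z => ∑ j, minkSign j * Rm x (E j) z (E j))
    (by intros; simp [mul_add, Finset.sum_add_distrib])
    (by intros; simp [Finset.mul_sum, mul_left_comm])
    (by intros; simp [mul_add, Finset.sum_add_distrib])
    (by intros; simp [Finset.mul_sum, mul_left_comm])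

lemma ricciBilin_apply (x z : V) :
    ricciBilin E Rm x z = ∑ j, minkSign j * Rm x (E j) z (E j) := rfl

/-- The Schouten tensor of a quadrilinear form. -/
def schoutenBilin : V →ₗ[ℝ] V →ₗ[ℝ] ℝ :=
  (1 / 2 : ℝ) • (ricciBilin E Rm -
    (1 / 6 * ∑ i, minkSign i * ricciBilin E Rm (E i) (E i) : ℝ) • A.g)

lemma schoutenBilin_apply (x y : V) : schoutenBilin A E Rm x y = 1 / 2 * (ricciBilin E Rm x y -
    1 / 6 * A.g x y * ∑ i, minkSign i * ricciBilin E Rm (E i) (E i)) := by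
  simp [schoutenBilin]; ring

/-- The Weyl tensor of a quadrilinear form, as a bilinear form with values in 2-forms. -/
def weylBilin : V →ₗ[ℝ] V →ₗ[ℝ] (Fin 4 → Fin 4 → ℝ) :=
  LinearMap.mk₂ ℝ (fun z t i j => Rm (E i) (E j) z t
      + (A.g (E i) t * schoutenBilin A E Rm (E j) z - A.g (E j) t * schoutenBilin A E Rm (E i) z)
      - (A.g z (E i) * schoutenBilin A E Rm (E j) t - A.g z (E j) * schoutenBilin A E Rm (E i) t))
    (by intros; ext; simp; ring) (by intros; ext; simp; ring)
    (by intros; ext; simp; ring) (by intros; ext; simp; ring)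

lemma weylBilin_apply (z t : V) (i j : Fin 4) : weylBilin A E Rm z t i j = Rm (E i) (E j) z t
      + (A.g (E i) t * schoutenBilin A E Rm (E j) z - A.g (E j) t * schoutenBilin A E Rm (E i) z)
      - (A.g z (E i) * schoutenBilin A E Rm (E j) t - A.g z (E j) * schoutenBilin A E Rm (E i) t) :=
  rfl

lemma weylBilin_basis (hE : ∀ i j, A.g (E i) (E j) = minkMetric i j) (i j k l : Fin 4) :
    weylBilin A E Rm (E k) (E l) i j =
      weylComp (fun i j k l => Rm (E i) (E j) (E k) (E l)) i j k l := by
  have hs : ∀ i j, minkMetric i j = minkMetric j i := fun i j => by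
    unfold minkMetric
    by_cases h : i = j
    · simp [h]
    · simp [h, Ne.symm h]
  have h : ∀ i j, schoutenBilin A E Rm (E i) (E j) =
      schoutenComp (fun i j k l => Rm (E i) (E j) (E k) (E l)) i j := by
    intro i j
    rw [schoutenBilin_apply, hE]; rfl
  simp only [weylBilin_apply, weylComp, hE, h]
  rw [hs l i, hs l j]

lemma g_symm (hE : ∀ i j, A.g (E i) (E j) = minkMetric i j) (x y : V) : A.g x y = A.g y x := by
  rw [g_eq_minkowski A E hE, g_eq_minkowski A E hE, minkowski_comm]

/-- The hypothesis `hR` identifies `Rm` with the lowered curvature. Inserting `g g⁻¹ = 1` turns the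
trace over an upper and a lower index into a metric contraction, which can be evaluated in `E`. -/
lemma ricci_eq (hE : ∀ i j, A.g (E i) (E j) = minkMetric i j)
    (hR : ∀ c d a t, ∑ b, A.riem c d a b * A.gLow b t = Rm (A.e c) (A.e d) (A.e a) (A.e t))
    (c a : Fin 4) : A.ricci c a = ricciBilin E Rm (A.e c) (A.e a) := by
  have h := A.sum_gUp_mul_bilin E hE ((Rm (A.e c)).flip (A.e a))
  rw [ricciBilin_apply]
  refine Eq.trans ?_ h
  rw [ricci]
  simp only [LinearMap.flip_apply, ← hR]
  have : ∀ d, A.riem c d a d = ∑ b, A.riem c d a b * if b = d then 1 else 0 := by simp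
  simp only [this, ← A.sum_gLow_mul_gUp E hE, Finset.mul_sum]
  refine Finset.sum_congr rfl fun d _ => ?_
  rw [Finset.sum_comm]
  refine Finset.sum_congr rfl fun b _ => Finset.sum_congr rfl fun t _ => ?_
  have hs : A.gUp b d = A.gUp d b := by
    have : A.gLow.transpose = A.gLow := by
      ext i j; exact A.g_symm E hE _ _
    have h2 := Matrix.transpose_nonsing_inv A.gLow
    rw [this] at h2
    exact congrFun (congrFun h2 d) b
  rw [hs]; ring

lemma schouten_eq (hE : ∀ i j, A.g (E i) (E j) = minkMetric i j)
    (hR : ∀ c d a t, ∑ b, A.riem c d a b * A.gLow b t = Rm (A.e c) (A.e d) (A.e a) (A.e t))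
    (a b : Fin 4) : A.schouten a b = schoutenBilin A E Rm (A.e a) (A.e b) := by
  rw [schouten, schoutenBilin_apply, ← sum_gUp_mul_bilin A E hE, scalar]
  simp only [ricci_eq A E Rm hE hR]
  rfl

lemma schoutenForm_apply (hE : ∀ i j, A.g (E i) (E j) = minkMetric i j)
    (hR : ∀ c d a t, ∑ b, A.riem c d a b * A.gLow b t = Rm (A.e c) (A.e d) (A.e a) (A.e t))
    (a : Fin 4) (x : V) :
    A.schoutenForm a ![x] = schoutenBilin A E Rm x (A.e a) := by
  rw [schoutenForm, alternating_sum_apply]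
  refine Eq.trans ?_ (sum_repr_mul A.e ((schoutenBilin A E Rm).flip (A.e a)) x)
  refine Finset.sum_congr rfl fun b _ => ?_
  rw [AlternatingMap.smul_apply, theta_apply, schouten_eq A E Rm hE hR, smul_eq_mul, mul_comm]
  rfl

lemma sum_gLow_mul_schoutenFormUp (hE : ∀ i j, A.g (E i) (E j) = minkMetric i j)
    (hR : ∀ c d a t, ∑ b, A.riem c d a b * A.gLow b t = Rm (A.e c) (A.e d) (A.e a) (A.e t))
    (t : Fin 4) (x : V) :
    ∑ b, A.gLow b t * A.schoutenFormUp b ![x] = schoutenBilin A E Rm x (A.e t) := by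
  simp only [schoutenFormUp, alternating_sum_apply, AlternatingMap.smul_apply, smul_eq_mul,
    Finset.mul_sum]
  rw [Finset.sum_comm]
  have h : ∀ a, ∑ b, A.gLow b t * (A.gUp b a * A.schoutenForm a ![x]) =
      (if t = a then 1 else 0) * A.schoutenForm a ![x] := by
    intro a
    rw [← A.sum_gLow_mul_gUp E hE, Finset.sum_mul]
    refine Finset.sum_congr rfl fun b _ => ?_
    rw [show A.gLow b t = A.gLow t b from A.g_symm E hE _ _]; ring
  simp only [h]
  simp [schoutenForm_apply A E Rm hE hR]

/-- The factor 1/2 in the curvature form compensates for the wedge `θ^c ∧ θ^d` antisymmetrizing a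
tensor that is already antisymmetric. -/
lemma sum_gLow_mul_curvForm
    (hR : ∀ c d a t, ∑ b, A.riem c d a b * A.gLow b t = Rm (A.e c) (A.e d) (A.e a) (A.e t))
    (hanti : ∀ x y z t, Rm x y z t = - Rm y x z t)
    (a t : Fin 4) (x y : V) :
    ∑ b, A.gLow b t * A.curvForm a b ![x, y] = Rm x y (A.e a) (A.e t) := by
  set B : V →ₗ[ℝ] V →ₗ[ℝ] ℝ := LinearMap.mk₂ ℝ (fun x y => Rm x y (A.e a) (A.e t))
    (by intros; simp) (by intros; simp) (by intros; simp) (by intros; simp) with hB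
  have hBa : ∀ x y, B x y = Rm x y (A.e a) (A.e t) := fun _ _ => rfl
  rw [← hBa, show B x y = 1 / 2 * (B x y - B y x) by
    rw [hBa y x, hanti, ← hBa]; ring, ← sum_sum_repr_mul A.e B x y, ← sum_sum_repr_mul A.e B y x]
  simp only [curvForm, AlternatingMap.smul_apply, alternating_sum_apply, smul_eq_mul,
    wedge_one_one, Matrix.cons_val_zero, Matrix.cons_val_one, theta_apply, hBa, ← hR]
  simp only [Finset.mul_sum, ← Finset.sum_sub_distrib]
  rw [Finset.sum_comm]
  refine Finset.sum_congr rfl fun c _ => ?_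
  rw [Finset.sum_comm]
  refine Finset.sum_congr rfl fun d _ => Finset.sum_congr rfl fun b _ => ?_
  ring

lemma weylFormLow_apply (hE : ∀ i j, A.g (E i) (E j) = minkMetric i j)
    (hR : ∀ c d a t, ∑ b, A.riem c d a b * A.gLow b t = Rm (A.e c) (A.e d) (A.e a) (A.e t))
    (hanti : ∀ x y z t, Rm x y z t = - Rm y x z t)
    (a t : Fin 4) (i j : Fin 4) :
    A.weylFormLow a t ![E i, E j] = weylBilin A E Rm (A.e a) (A.e t) i j := by
  have h1 := A.sum_gLow_mul_curvForm Rm hR hanti a t (E i) (E j)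
  have hth : ∀ x, ∑ b, A.gLow b t * A.theta b ![x] = A.g x (A.e t) := by
    intro x
    refine Eq.trans ?_ (sum_repr_mul A.e (LinearMap.flip A.g (A.e t)) x)
    refine Finset.sum_congr rfl fun b _ => ?_
    rw [theta_apply, mul_comm]; rfl
  have h2 := A.sum_gLow_mul_schoutenFormUp E Rm hE hR t
  rw [weylBilin_apply, ← h1, ← h2, ← h2, ← hth, ← hth]
  simp only [weylFormLow, alternating_sum_apply, AlternatingMap.smul_apply, smul_eq_mul, weylForm,
    AlternatingMap.sub_apply, AlternatingMap.add_apply, wedge_one_one, Matrix.cons_val_zero,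
    Matrix.cons_val_one, thetaLow_apply, schoutenForm_apply A E Rm hE hR]
  simp only [Fin.sum_univ_four]
  ring

lemma weylForm_apply (hE : ∀ i j, A.g (E i) (E j) = minkMetric i j)
    (hR : ∀ c d a t, ∑ b, A.riem c d a b * A.gLow b t = Rm (A.e c) (A.e d) (A.e a) (A.e t))
    (hanti : ∀ x y z t, Rm x y z t = - Rm y x z t)
    (a c : Fin 4) (i j : Fin 4) :
    A.weylForm a c ![E i, E j] = (∑ f, A.gUp f c • weylBilin A E Rm (A.e a) (A.e f)) i j := by
  simp only [Finset.sum_apply, Pi.smul_apply, smul_eq_mul,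
    ← A.weylFormLow_apply E Rm hE hR hanti, weylFormLow, alternating_sum_apply,
    AlternatingMap.smul_apply, Finset.mul_sum]
  rw [Finset.sum_comm]
  have h : ∀ b, ∑ f, A.gUp f c * (A.gLow b f * A.weylForm a b ![E i, E j]) =
      (if b = c then 1 else 0) * A.weylForm a b ![E i, E j] := by
    intro b
    rw [← A.sum_gLow_mul_gUp E hE, Finset.sum_mul]
    exact Finset.sum_congr rfl fun f _ => by ring
  simp [h]

lemma weylFormUp_apply (hE : ∀ i j, A.g (E i) (E j) = minkMetric i j)
    (hR : ∀ c d a t, ∑ b, A.riem c d a b * A.gLow b t = Rm (A.e c) (A.e d) (A.e a) (A.e t))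
    (hanti : ∀ x y z t, Rm x y z t = - Rm y x z t)
    (e d : Fin 4) (i j : Fin 4) :
    A.weylFormUp e d ![E i, E j] =
      (∑ c, A.gUp e c • ∑ f, A.gUp f d • weylBilin A E Rm (A.e c) (A.e f)) i j := by
  rw [weylFormUp, alternating_sum_apply, Finset.sum_apply, Finset.sum_apply]
  refine Finset.sum_congr rfl fun c _ => ?_
  rw [AlternatingMap.smul_apply, A.weylForm_apply E Rm hE hR hanti]
  rfl

/-- The Bel-Robinson 3-form is the Bel-Robinson tensor contracted with the dual vector. -/
theorem belRobinson_apply (hE : ∀ i j, A.g (E i) (E j) = minkMetric i j)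
    (hR : ∀ c d a t, ∑ b, A.riem c d a b * A.gLow b t = Rm (A.e c) (A.e d) (A.e a) (A.e t))
    (hanti : ∀ x y z t, Rm x y z t = - Rm y x z t)
    (a b c : Fin 4) (w : Fin 3 → V) :
    A.belRobinson a b c w =
      belRob (weylComp fun i j k l => Rm (E i) (E j) (E k) (E l)) (E.repr (A.e a))
        (E.repr (A.e b)) (E.repr (A.e c))
        (dualVec (A.η E) (E.repr (w 0)) (E.repr (w 1)) (E.repr (w 2))) := by
  set x : Fin 4 → ℝ := ⇑(E.repr (A.e a)) with hx
  set n := dualVec (A.η E) (E.repr (w 0)) (E.repr (w 1)) (E.repr (w 2)) with hn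
  set W := weylBilin A E Rm with hW
  have hlow : ∀ e d, (fun i j => A.weylFormLow e d ![E i, E j]) = W (A.e e) (A.e d) :=
    fun e d => funext fun i => funext fun j => A.weylFormLow_apply E Rm hE hR hanti e d i j
  have hmix : ∀ c e, (fun i j => A.weylForm c e ![E i, E j]) =
      ∑ f, A.gUp f e • W (A.e c) (A.e f) :=
    fun e d => funext fun i => funext fun j => A.weylForm_apply E Rm hE hR hanti e d i j
  have hup : ∀ e d, (fun i j => A.weylFormUp e d ![E i, E j]) =
      ∑ c, A.gUp e c • ∑ f, A.gUp f d • W (A.e c) (A.e f) :=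
    fun e d => funext fun i => funext fun j => A.weylFormUp_apply E Rm hE hR hanti e d i j
  have hst : ∀ (X X' : V [⋀^Fin 2]→ₗ[ℝ] ℝ), wedge (A.star (wedge X (A.thetaLow a))) X' w =
      stressBilin x n (fun i j => X ![E i, E j]) (fun i j => X' ![E i, E j]) :=
    fun X X' => A.wedge_star_apply E hE X X' a w
  -- The two Kronecker-delta terms of `omega` have one contracted index left, the trace term below
  -- has two; both are traces of bilinear maps and hence independent of the frame.
  have hmid : ∀ b c, ∑ e, stressBilin x n (∑ f, A.gUp f e • W (A.e c) (A.e f))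
      (W (A.e e) (A.e b)) =
      ∑ k, minkSign k * stressBilin x n (W (A.e c) (E k)) (W (E k) (A.e b)) := by
    intro b c
    refine Eq.trans ?_ (A.sum_gUp_mul_bilin E hE
      ((stressBilin x n).compl₁₂ (W (A.e c)) (W.flip (A.e b))))
    rw [Finset.sum_comm]
    refine Finset.sum_congr rfl fun e _ => ?_
    simp
  have hfst : ∑ e, ∑ d, stressBilin x n
      (∑ c, A.gUp e c • ∑ f, A.gUp f d • W (A.e c) (A.e f)) (W (A.e e) (A.e d)) =
      ∑ k, ∑ l, minkSign k * minkSign l * stressBilin x n (W (E k) (E l)) (W (E k) (E l)) := by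
    have i1 : ∀ y z, ∑ f, ∑ d, A.gUp f d * stressBilin x n (W y (A.e f)) (W z (A.e d)) =
        ∑ l, minkSign l * stressBilin x n (W y (E l)) (W z (E l)) := fun y z =>
      A.sum_gUp_mul_bilin E hE ((stressBilin x n).compl₁₂ (W y) (W z))
    have i2 : ∀ l, ∑ e, ∑ c, A.gUp e c * stressBilin x n (W (A.e c) (E l)) (W (A.e e) (E l)) =
        ∑ k, minkSign k * stressBilin x n (W (E k) (E l)) (W (E k) (E l)) := fun l =>
      A.sum_gUp_mul_bilin E hE ((stressBilin x n).compl₁₂ (W.flip (E l)) (W.flip (E l))).flip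
    calc _ = ∑ e, ∑ c, A.gUp e c * ∑ f, ∑ d, A.gUp f d *
          stressBilin x n (W (A.e c) (A.e f)) (W (A.e e) (A.e d)) := by
          refine Finset.sum_congr rfl fun e _ => ?_
          simp only [map_sum, map_smul, LinearMap.sum_apply, LinearMap.smul_apply, smul_eq_mul]
          rw [Finset.sum_comm]
          refine Finset.sum_congr rfl fun c _ => ?_
          rw [← Finset.mul_sum, Finset.sum_comm]
      _ = ∑ l, minkSign l * ∑ e, ∑ c, A.gUp e c *
          stressBilin x n (W (A.e c) (E l)) (W (A.e e) (E l)) := by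
          simp only [i1]
          simp only [Finset.mul_sum]
          rw [Finset.sum_congr rfl fun b _ => Finset.sum_comm, Finset.sum_comm]
          exact Finset.sum_congr rfl fun l _ => Finset.sum_congr rfl fun e _ =>
            Finset.sum_congr rfl fun c _ => by ring
      _ = _ := by
          simp only [i2, Finset.mul_sum]
          rw [Finset.sum_comm]
          exact Finset.sum_congr rfl fun l _ => Finset.sum_congr rfl fun e _ => by ring
  have hcomp : ∀ (k l : Fin 4), W (E k) (E l) = fun i j =>
      weylComp (fun i j k l => Rm (E i) (E j) (E k) (E l)) i j k l :=
    fun k l => funext fun i => funext fun j => A.weylBilin_basis E Rm hE i j k l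
  have hl : ∀ (z : V) k, W z (E k) = fun i j => ∑ m, E.repr z m *
      weylComp (fun i j k l => Rm (E i) (E j) (E k) (E l)) i j m k := by
    intro z k
    funext i j
    refine (sum_repr_mul E (LinearMap.proj j ∘ₗ LinearMap.proj i ∘ₗ W.flip (E k)) z).symm.trans ?_
    exact Finset.sum_congr rfl fun m _ =>
      congrArg (_ * ·) (congrFun (congrFun (hcomp _ _) i) j)
  have hr : ∀ (z : V) k, W (E k) z = fun i j => ∑ m, E.repr z m *
      weylComp (fun i j k l => Rm (E i) (E j) (E k) (E l)) i j k m := by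
    intro z k
    funext i j
    refine (sum_repr_mul E (LinearMap.proj j ∘ₗ LinearMap.proj i ∘ₗ W (E k)) z).symm.trans ?_
    exact Finset.sum_congr rfl fun m _ =>
      congrArg (_ * ·) (congrFun (congrFun (hcomp _ _) i) j)
  have hsum : A.belRobinson a b c w = 1 / 2 * A.gLow b c * ∑ e, ∑ d, stressBilin x n
      (∑ c, A.gUp e c • ∑ f, A.gUp f d • W (A.e c) (A.e f)) (W (A.e e) (A.e d))
      + ∑ e, stressBilin x n (∑ f, A.gUp f e • W (A.e c) (A.e f)) (W (A.e e) (A.e b))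
      + ∑ e, stressBilin x n (∑ f, A.gUp f e • W (A.e b) (A.e f)) (W (A.e e) (A.e c)) := by
    rw [belRobinson, alternating_sum_apply]
    simp only [alternating_sum_apply, omega, wedge_add_left, wedge_smul_left, hst, hlow, hmix, hup,
      Finset.sum_add_distrib]
    simp [Finset.mul_sum]
  rw [hsum, hmid, hmid, hfst, show A.gLow b c = minkowski (E.repr (A.e b)) (E.repr (A.e c)) from
    A.g_eq_minkowski E hE _ _]
  simp only [hcomp]
  simp only [hl, hr, stressBilin_apply, belRob, mul_add, Finset.sum_add_distrib]
  ring

end FrameData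

/-! ### Causal vectors -/

lemma minkowski_eq (x y : Fin 4 → ℝ) :
    minkowski x y = - (x 0 * y 0) + (x 1 * y 1 + x 2 * y 2 + x 3 * y 3) := by
  simp [minkowski, Fin.sum_univ_four, minkSign]; ring

/-- Lagrange's identity: the deficit is the sum of the three squared 2×2 minors. -/
lemma sq_inner_le (x y : Fin 4 → ℝ) : (x 1 * y 1 + x 2 * y 2 + x 3 * y 3) ^ 2 ≤
    (x 1 ^ 2 + x 2 ^ 2 + x 3 ^ 2) * (y 1 ^ 2 + y 2 ^ 2 + y 3 ^ 2) := by
  nlinarith [sq_nonneg (x 1 * y 2 - x 2 * y 1), sq_nonneg (x 1 * y 3 - x 3 * y 1),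
    sq_nonneg (x 2 * y 3 - x 3 * y 2)]

lemma abs_inner_le {x y : Fin 4 → ℝ} (hx : minkowski x x ≤ 0) (hy : minkowski y y ≤ 0) :
    |x 1 * y 1 + x 2 * y 2 + x 3 * y 3| ≤ |x 0 * y 0| := by
  rw [minkowski_eq] at hx hy
  refine sq_le_sq.1 ((sq_inner_le x y).trans ?_)
  rw [mul_pow]
  exact mul_le_mul (by nlinarith) (by nlinarith) (by positivity) (by positivity)

/-- Orthogonality would make the spatial parts violate Cauchy-Schwarz, since the timelike vector has
a strictly shorter spatial part than its time component. -/
lemma minkowski_ne_zero {x t : Fin 4 → ℝ} (hx : minkowski x x ≤ 0) (hx0 : x ≠ 0)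
    (ht : minkowski t t < 0) : minkowski x t ≠ 0 := by
  intro h
  rw [minkowski_eq] at hx ht h
  have h0 : x 0 ≠ 0 := by
    intro h0
    apply hx0
    rw [h0] at hx
    ext i
    fin_cases i
    · exact h0
    all_goals
      simp only [Fin.mk_one, Fin.reduceFinMk, Pi.zero_apply]
      nlinarith [sq_nonneg (x 1), sq_nonneg (x 2), sq_nonneg (x 3)]
  have hcs := sq_inner_le x t
  rw [show x 1 * t 1 + x 2 * t 2 + x 3 * t 3 = x 0 * t 0 by linarith, mul_pow] at hcs
  have h1 : 0 < x 0 ^ 2 := by positivity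
  have h2 : x 1 ^ 2 + x 2 ^ 2 + x 3 ^ 2 ≤ x 0 ^ 2 := by nlinarith
  have h3 : t 1 ^ 2 + t 2 ^ 2 + t 3 ^ 2 < t 0 ^ 2 := by nlinarith
  have h4 : (x 1 ^ 2 + x 2 ^ 2 + x 3 ^ 2) * (t 1 ^ 2 + t 2 ^ 2 + t 3 ^ 2) ≤
    x 0 ^ 2 * (t 1 ^ 2 + t 2 ^ 2 + t 3 ^ 2) := mul_le_mul_of_nonneg_right h2 (by positivity)
  nlinarith [mul_lt_mul_of_pos_left h3 h1]

lemma mul_pos_of_minkowski_neg {x t : Fin 4 → ℝ} (hx : minkowski x x ≤ 0)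
    (ht : minkowski t t < 0) (h : minkowski x t < 0) : 0 < x 0 * t 0 := by
  have := abs_inner_le hx ht.le
  rw [minkowski_eq] at h
  by_contra hn
  rw [abs_of_nonpos (not_lt.1 hn)] at this
  linarith [(abs_le.1 this).1]

lemma minkowski_nonpos {x y t : Fin 4 → ℝ} (hx : minkowski x x ≤ 0) (hy : minkowski y y ≤ 0)
    (ht : minkowski t t < 0) (hxt : minkowski x t < 0) (hyt : minkowski y t < 0) :
    minkowski x y ≤ 0 := by
  have h1 := mul_pos_of_minkowski_neg hx ht hxt
  have h2 := mul_pos_of_minkowski_neg hy ht hyt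
  have h3 : 0 ≤ x 0 * y 0 := by
    have : 0 < (x 0 * t 0) * (y 0 * t 0) := mul_pos h1 h2
    have h4 : 0 < t 0 ^ 2 := by
      have : t 0 ≠ 0 := fun h => by simp [h] at h1
      positivity
    by_contra hn
    nlinarith
  have := abs_inner_le hx hy
  rw [abs_of_nonneg h3] at this
  rw [minkowski_eq]
  linarith [(abs_le.1 this).2]

/-- The degree is even. This covers the case where the orthonormal basis has a past-directed time
vector, so that future vectors have negative time components. -/
lemma belRob_neg (W : Fin 4 → Fin 4 → Fin 4 → Fin 4 → ℝ) (x y z n : Fin 4 → ℝ) :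
    belRob W (-x) (-y) (-z) (-n) = belRob W x y z n := by
  have h1 := fun x y z n => (AddMonoidHom.mk' (fun x => belRob W x y z n)
    (fun x x' => belRob_add_fst W x x' y z n)).map_neg x
  have h2 := fun x y z n => (AddMonoidHom.mk' (fun y => belRob W x y z n)
    (fun y y' => belRob_add_snd W x y y' z n)).map_neg y
  have h3 := fun x y z n => (AddMonoidHom.mk' (fun z => belRob W x y z n)
    (fun z z' => belRob_add_trd W x y z z' n)).map_neg z
  have h4 := fun x y z n => (AddMonoidHom.mk' (fun n => belRob W x y z n)
    (fun n n' => belRob_add_fourth W x y z n n')).map_neg n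
  simp only [AddMonoidHom.mk'_apply] at h1 h2 h3 h4
  rw [h1, h2, h3, h4]
  ring

/-- The dominant energy property, for vectors in the causal cone of a timelike vector. -/
theorem belRob_nonneg_of_future (Q : Fin 3 → Fin 3 → ℂ) {x y z n t : Fin 4 → ℝ}
    (ht : minkowski t t < 0)
    (hx : minkowski x x ≤ 0) (hxt : minkowski x t < 0)
    (hy : minkowski y y ≤ 0) (hyt : minkowski y t < 0)
    (hz : minkowski z z ≤ 0) (hzt : minkowski z t < 0)
    (hn : minkowski n n ≤ 0) (hnt : minkowski n t < 0) :
    0 ≤ belRob (weylOfMatrix Q) x y z n := by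
  have h1 := mul_pos_of_minkowski_neg hx ht hxt
  have h2 := mul_pos_of_minkowski_neg hy ht hyt
  have h3 := mul_pos_of_minkowski_neg hz ht hzt
  have h4 := mul_pos_of_minkowski_neg hn ht hnt
  rcases lt_or_ge 0 (t 0) with h | h
  · exact belRob_nonneg Q (pos_of_mul_pos_left h1 h.le).le hx (pos_of_mul_pos_left h2 h.le).le hy
      (pos_of_mul_pos_left h3 h.le).le hz (pos_of_mul_pos_left h4 h.le).le hn
  · have hneg : ∀ x : Fin 4 → ℝ, minkowski (-x) (-x) = minkowski x x := fun x => by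
      simp [minkowski]
    have h0 : ∀ x : Fin 4 → ℝ, 0 < x 0 * t 0 → 0 ≤ (-x) 0 := fun x hx => by
      rw [Pi.neg_apply]
      by_contra hc
      nlinarith
    rw [← belRob_neg]
    exact belRob_nonneg Q (h0 x h1) (by rwa [hneg]) (h0 y h2) (by rwa [hneg]) (h0 z h3)
      (by rwa [hneg]) (h0 n h4) (by rwa [hneg])

/-! ### Spacelike and null hyperplanes -/

section Hyperplane

variable {V T : Type*} [AddCommGroup V] [Module ℝ V] [AddCommGroup T] [Module ℝ T]

/-- A nonzero top-degree form vanishes on no basis. -/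
lemma mem_range_of_alternating_eq_zero (E : Module.Basis (Fin 4) ℝ V)
    {η : V [⋀^Fin 4]→ₗ[ℝ] ℝ} (hη : η ≠ 0) {w : Fin 3 → V} (hw : LinearIndependent ℝ w) {x : V}
    (hx : η ![w 0, w 1, w 2, x] = 0) : x ∈ Submodule.span ℝ (Set.range w) := by
  by_contra h
  have hli : LinearIndependent ℝ (Fin.snoc w x : Fin 4 → V) := linearIndependent_finSnoc.2 ⟨hw, h⟩
  have : FiniteDimensional ℝ V := Module.Finite.of_basis E
  have hc : Fintype.card (Fin 4) = Module.finrank ℝ V := (Module.finrank_eq_card_basis E).symm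
  have h2 := (AlternatingMap.map_basis_ne_zero_iff
    (basisOfLinearIndependentOfCardEqFinrank hli hc) η).2 hη
  rw [coe_basisOfLinearIndependentOfCardEqFinrank] at h2
  apply h2
  rw [← hx]
  congr 1
  ext i
  fin_cases i <;> rfl

/-- The normal vector of a hyperplane with basis `w`. -/
def normalVec (E : Module.Basis (Fin 4) ℝ V) (η : V [⋀^Fin 4]→ₗ[ℝ] ℝ) (w : Fin 3 → V) : V :=
  E.equivFun.symm (dualVec (η E) (E.repr (w 0)) (E.repr (w 1)) (E.repr (w 2)))

lemma repr_normalVec (E : Module.Basis (Fin 4) ℝ V) (η : V [⋀^Fin 4]→ₗ[ℝ] ℝ) (w : Fin 3 → V) :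
    ⇑(E.repr (normalVec E η w)) =
      dualVec (η E) (E.repr (w 0)) (E.repr (w 1)) (E.repr (w 2)) := by
  rw [normalVec, ← Module.Basis.equivFun_apply, LinearEquiv.apply_symm_apply]

variable {g : LinearMap.BilinForm ℝ V} {E : Module.Basis (Fin 4) ℝ V}

lemma bilin_eq_minkowski (hE : ∀ i j, g (E i) (E j) = minkMetric i j) (x y : V) :
    g x y = minkowski (E.repr x) (E.repr y) :=
  FrameData.g_eq_minkowski ⟨E, g, 0, fun _ _ _ _ => 0⟩ E hE x y

lemma bilin_normalVec (hE : ∀ i j, g (E i) (E j) = minkMetric i j) (η : V [⋀^Fin 4]→ₗ[ℝ] ℝ)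
    (w : Fin 3 → V) (x : V) : g (normalVec E η w) x = - η ![w 0, w 1, w 2, x] := by
  rw [bilin_eq_minkowski hE, repr_normalVec, minkowski_dualVec, alternating_apply_eq_detFour E]

lemma span_range_comp_eq_range (L : T →ₗ[ℝ] V) {v : Fin 3 → T}
    (hv : Submodule.span ℝ (Set.range v) = ⊤) :
    Submodule.span ℝ (Set.range fun i => L (v i)) = LinearMap.range L := by
  rw [Set.range_comp' L v, Submodule.span_image, hv, Submodule.map_top]

lemma alternating_range_eq_zero (η : V [⋀^Fin 4]→ₗ[ℝ] ℝ) {w : Fin 3 → V} {x : V}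
    (hx : x ∈ Submodule.span ℝ (Set.range w)) : η ![w 0, w 1, w 2, x] = 0 := by
  induction hx using Submodule.span_induction with
  | mem x hx =>
    obtain ⟨i, rfl⟩ := hx
    fin_cases i
    · exact η.map_eq_zero_of_eq _ (show ![w 0, w 1, w 2, w 0] 0 = ![w 0, w 1, w 2, w 0] 3 from rfl)
        (by decide)
    · exact η.map_eq_zero_of_eq _ (show ![w 0, w 1, w 2, w 1] 1 = ![w 0, w 1, w 2, w 1] 3 from rfl)
        (by decide)
    · exact η.map_eq_zero_of_eq _ (show ![w 0, w 1, w 2, w 2] 2 = ![w 0, w 1, w 2, w 2] 3 from rfl)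
        (by decide)
  | zero => rw [← evalFour_apply, map_zero]
  | add x y _ _ hx hy => rw [← evalFour_apply, map_add, evalFour_apply, evalFour_apply, hx, hy,
      add_zero]
  | smul c x _ hx => rw [← evalFour_apply, map_smul, evalFour_apply, hx, smul_zero]

/-- The normal vector of a spacelike or null hyperplane is causal. -/
lemma bilin_normalVec_self_nonpos (hE : ∀ i j, g (E i) (E j) = minkMetric i j)
    {η : V [⋀^Fin 4]→ₗ[ℝ] ℝ} (hη : η ≠ 0) {L : T →ₗ[ℝ] V} (hL : Function.Injective L)
    {v : Fin 3 → T} (hv : LinearIndependent ℝ v) (hs : Submodule.span ℝ (Set.range v) = ⊤)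
    (htype : (∀ v : T, v ≠ 0 → 0 < g (L v) (L v)) ∨ ∃ v : T, v ≠ 0 ∧ ∀ w, g (L v) (L w) = 0) :
    g (normalVec E η fun i => L (v i)) (normalVec E η fun i => L (v i)) ≤ 0 := by
  set N := normalVec E η fun i => L (v i) with hN
  by_contra! hpos
  have hsymm : ∀ x y, g x y = g y x := fun x y => by
    rw [bilin_eq_minkowski hE, bilin_eq_minkowski hE, minkowski_comm]
  have hw : LinearIndependent ℝ fun i => L (v i) := hv.map' L (LinearMap.ker_eq_bot.2 hL)
  have horth : ∀ t, g N (L t) = 0 := by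
    intro t
    rw [hN, bilin_normalVec hE, alternating_range_eq_zero η (w := fun i => L (v i)) , neg_zero]
    rw [span_range_comp_eq_range L hs]
    exact LinearMap.mem_range_self L t
  -- If `N` were spacelike, the space would split orthogonally as the line of `N` plus the
  -- hyperplane.
  have hdec : ∀ x, ∃ t, x = (g N x / g N N) • N + L t := by
    intro x
    have h0 : g N (x - (g N x / g N N) • N) = 0 := by
      rw [map_sub, map_smul, smul_eq_mul, div_mul_cancel₀ _ hpos.ne', sub_self]
    rw [hN, bilin_normalVec hE, neg_eq_zero, ← hN] at h0
    have h1 := mem_range_of_alternating_eq_zero E hη hw h0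
    rw [span_range_comp_eq_range L hs] at h1
    obtain ⟨t, ht⟩ := h1
    exact ⟨t, by rw [ht]; abel⟩
  -- In the spacelike case the splitting makes `g` nonnegative everywhere, contradicting the
  -- timelike `E 0`; in the null case the degenerate direction is orthogonal to the whole space,
  -- contradicting nondegeneracy.
  rcases htype with h | ⟨m, hm0, hm⟩
  · obtain ⟨t, ht⟩ := hdec (E 0)
    have h1 : g (E 0) (E 0) = -1 := by rw [hE]; simp [minkMetric, minkSign]
    generalize g N (E 0) / g N N = c at ht
    rw [ht] at h1
    simp only [map_add, map_smul, LinearMap.add_apply, LinearMap.smul_apply, smul_eq_mul,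
      hsymm (L t) N, horth] at h1
    have h2 : 0 ≤ g (L t) (L t) := by
      by_cases ht0 : t = 0
      · simp [ht0]
      · exact (h t ht0).le
    nlinarith [mul_nonneg (mul_self_nonneg c) hpos.le]
  · have h1 : ∀ x, g (L m) x = 0 := by
      intro x
      obtain ⟨t, ht⟩ := hdec x
      rw [ht, map_add, map_smul, hsymm (L m) N, horth, hm]; simp
    apply hm0
    apply hL
    rw [map_zero]
    apply E.repr.injective
    ext i
    have h2 := h1 (E i)
    rw [bilin_eq_minkowski hE, minkowski, Finset.sum_eq_single i] at h2
    · have : minkSign i ≠ 0 := fun h => by simpa [h] using minkSign_mul_self i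
      simpa [this] using h2
    · intro b _ hb; simp [hb]
    · simp

variable {τ : V}

lemma normalVec_ne_zero (hE : ∀ i j, g (E i) (E j) = minkMetric i j)
    {η : V [⋀^Fin 4]→ₗ[ℝ] ℝ} (hη : η ≠ 0) {w : Fin 3 → V} (hw : LinearIndependent ℝ w) :
    normalVec E η w ≠ 0 := by
  intro h
  have h1 : ∀ x, x ∈ Submodule.span ℝ (Set.range w) := by
    intro x
    apply mem_range_of_alternating_eq_zero E hη hw
    have := bilin_normalVec hE η w x
    rw [h, map_zero, LinearMap.zero_apply] at this
    linarith
  have h2 := finrank_span_eq_card hw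
  rw [(Submodule.eq_top_iff' (p := Submodule.span ℝ (Set.range w))).2 h1, finrank_top,
    Module.finrank_eq_card_basis E] at h2
  simp at h2

/-- The orientations of a spacelike or null hyperplane defined by `τ` and by a transverse
future-directed causal vector agree. -/
lemma alternating_pos_iff (hE : ∀ i j, g (E i) (E j) = minkMetric i j)
    {η : V [⋀^Fin 4]→ₗ[ℝ] ℝ} (hη : η ≠ 0) {L : T →ₗ[ℝ] V} (hL : Function.Injective L)
    {v : Fin 3 → T} (hv : LinearIndependent ℝ v) (hs : Submodule.span ℝ (Set.range v) = ⊤)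
    (htype : (∀ v : T, v ≠ 0 → 0 < g (L v) (L v)) ∨ ∃ v : T, v ≠ 0 ∧ ∀ w, g (L v) (L w) = 0)
    (hτ : g τ τ < 0) {n : V} (hn : g n n ≤ 0) (hnτ : g n τ < 0) (hnL : n ∉ LinearMap.range L) :
    0 < η ![L (v 0), L (v 1), L (v 2), τ] ↔ 0 < η ![L (v 0), L (v 1), L (v 2), n] := by
  set N := normalVec E η fun i => L (v i) with hN
  have hw : LinearIndependent ℝ fun i => L (v i) := hv.map' L (LinearMap.ker_eq_bot.2 hL)
  have hNN : g N N ≤ 0 := bilin_normalVec_self_nonpos hE hη hL hv hs htype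
  have h1 := bilin_normalVec hE η (fun i => L (v i)) τ
  have h2 := bilin_normalVec hE η (fun i => L (v i)) n
  have h3 : g N n ≠ 0 := by
    rw [hN, h2, neg_ne_zero]
    intro h
    apply hnL
    rw [← span_range_comp_eq_range L hs]
    exact mem_range_of_alternating_eq_zero E hη hw h
  have hN0 : N ≠ 0 := normalVec_ne_zero hE hη hw
  rw [← hN] at h1 h2
  have hconv := bilin_eq_minkowski (g := g) hE
  have h4 : g N τ ≠ 0 := by
    rw [hconv]
    refine minkowski_ne_zero (by rwa [← hconv]) (fun h => hN0 ?_) (by rwa [← hconv])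
    exact E.repr.injective (by ext i; rw [h]; simp)
  -- `N` is causal, so it lies in the cone of `τ` or in the opposite one. Its products with `τ` and
  -- with `n` therefore have the same sign; the opposite cone is reached by replacing `N` with `-N`.
  have h5 : g N τ < 0 → g N n < 0 := fun h => lt_of_le_of_ne (by
    rw [hconv] at hNN hn hτ hnτ h ⊢
    exact minkowski_nonpos hNN hn hτ h hnτ) h3
  have h6 : 0 < g N τ → 0 < g N n := fun h => lt_of_le_of_ne (by
    have h7 : g (-N) n ≤ 0 := by
      have hNN' : g (-N) (-N) ≤ 0 := by simpa using hNN
      have h' : g (-N) τ < 0 := by simpa using h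
      rw [hconv] at hNN' hn hτ hnτ h' ⊢
      exact minkowski_nonpos hNN' hn hτ h' hnτ
    simpa using h7) h3.symm
  have e1 : 0 < η ![L (v 0), L (v 1), L (v 2), τ] ↔ g N τ < 0 := by rw [h1]; simp
  have e2 : 0 < η ![L (v 0), L (v 1), L (v 2), n] ↔ g N n < 0 := by rw [h2]; simp
  rw [e1, e2]
  refine ⟨h5, fun h => ?_⟩
  rcases lt_or_gt_of_ne h4 with h' | h'
  · exact h'
  · exact absurd (h6 h') (not_lt.2 h.le)

/-- The Bel-Robinson 3-form is nonnegative on positively oriented bases of spacelike or null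
hyperplanes. -/
theorem belRobinson_nonneg {A : FrameData V} (hE : ∀ i j, A.g (E i) (E j) = minkMetric i j)
    {Rm : V →ₗ[ℝ] V →ₗ[ℝ] V →ₗ[ℝ] V →ₗ[ℝ] ℝ}
    (hR : ∀ c d a t, ∑ b, A.riem c d a b * A.gLow b t = Rm (A.e c) (A.e d) (A.e a) (A.e t))
    (hanti : ∀ x y z t, Rm x y z t = - Rm y x z t) (hanti' : ∀ x y z t, Rm x y z t = - Rm x y t z)
    (hbianchi : ∀ x y z t, Rm x y z t + Rm y z x t + Rm z x y t = 0)
    {L : T →ₗ[ℝ] V} (hL : Function.Injective L)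
    {v : Fin 3 → T} (hv : LinearIndependent ℝ v) (hs : Submodule.span ℝ (Set.range v) = ⊤)
    (htype : (∀ v : T, v ≠ 0 → 0 < A.g (L v) (L v)) ∨ ∃ v : T, v ≠ 0 ∧ ∀ w, A.g (L v) (L w) = 0)
    (hτ : A.g τ τ < 0) {a b c : Fin 4}
    (ha : A.g (A.e a) (A.e a) ≤ 0) (haτ : A.g (A.e a) τ < 0)
    (hb : A.g (A.e b) (A.e b) ≤ 0) (hbτ : A.g (A.e b) τ < 0)
    (hc : A.g (A.e c) (A.e c) ≤ 0) (hcτ : A.g (A.e c) τ < 0)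
    (hpos : 0 < A.η ![L (v 0), L (v 1), L (v 2), τ]) :
    0 ≤ A.belRobinson a b c fun i => L (v i) := by
  have hη : A.η ≠ 0 := fun h => by simp [h] at hpos
  have hcurv : IsCurvatureTensor fun i j k l => Rm (E i) (E j) (E k) (E l) :=
    ⟨fun _ _ _ _ => hanti _ _ _ _, fun _ _ _ _ => hanti' _ _ _ _, fun _ _ _ _ => hbianchi _ _ _ _⟩
  obtain ⟨Q, hQ⟩ := hcurv.exists_weylComp_eq
  have hconv := bilin_eq_minkowski (g := A.g) hE
  have hN := bilin_normalVec_self_nonpos hE hη hL hv hs htype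
  have hNτ : A.g (normalVec E A.η fun i => L (v i)) τ < 0 := by
    rw [bilin_normalVec hE]; simpa using hpos
  rw [A.belRobinson_apply E Rm hE hR hanti, hQ, ← repr_normalVec E A.η fun i => L (v i)]
  rw [hconv] at hτ ha haτ hb hbτ hc hcτ hN hNτ
  exact belRob_nonneg_of_future Q hτ ha haτ hb hbτ hc hcτ hN hNτ

end Hyperplane

/-! ### Symmetries of the Riemann tensor -/

section MatrixCalculus

variable {F : Type*} [NormedAddCommGroup F] [NormedSpace ℝ F]
  {G : F → Matrix (Fin 4) (Fin 4) ℝ} {y : F}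

lemma differentiableAt_det (h : ∀ i j, DifferentiableAt ℝ (fun z => G z i j) y) :
    DifferentiableAt ℝ (fun z => (G z).det) y := by
  simp only [det_eq_detFour, detFour]
  fun_prop

/-- Cramer's rule writes each entry of the inverse as a quotient of polynomials in the entries of
`G`. -/
lemma differentiableAt_matrix_inv (h : ∀ i j, DifferentiableAt ℝ (fun z => G z i j) y)
    (hdet : IsUnit (G y).det) (i j : Fin 4) : DifferentiableAt ℝ (fun z => (G z)⁻¹ i j) y := by
  have e : ∀ z, (G z)⁻¹ i j = ((G z).det)⁻¹ * ((G z).updateRow j (Pi.single i 1)).det := by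
    intro z
    rw [Matrix.inv_def, Ring.inverse_eq_inv', Matrix.smul_apply, smul_eq_mul,
      Matrix.adjugate_apply]
  simp only [e]
  refine ((differentiableAt_det h).inv hdet.ne_zero).mul (differentiableAt_det fun k l => ?_)
  by_cases hk : k = j
  · subst hk
    simp
  · simp only [Matrix.updateRow_ne hk]
    exact h k l

end MatrixCalculus

/-! ### Christoffel symbols and the curvature symmetries in coordinates. -/

namespace LorentzMetric

variable {M : Type*} [TopologicalSpace M] [ChartedSpace (EuclideanSpace ℝ (Fin 4)) M]
  (g : LorentzMetric M)

lemma exists_basis (p : M) : ∃ e : Module.Basis (Fin 4) ℝ (TangentSpace (𝓡 4) p),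
    ∀ i j, g.toFun p (e i) (e j) = minkMetric i j := by
  obtain ⟨e, he⟩ := g.exists_orthonormal p
  refine ⟨e, fun i j => ?_⟩
  rw [he, minkMetric, show minkSign i = if i = 0 then -1 else 1 by fin_cases i <;> rfl]

lemma symm (p : M) (v w : TangentSpace (𝓡 4) p) : g.toFun p v w = g.toFun p w v := by
  obtain ⟨e, he⟩ := g.exists_basis p
  rw [bilin_eq_minkowski he, bilin_eq_minkowski he, minkowski_comm]

lemma coeff_symm (x : M) (y : EuclideanSpace ℝ (Fin 4)) (i j : Fin 4) :
    g.coeff x y i j = g.coeff x y j i := g.symm _ _ _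

lemma christoffel_symm (x : M) (k i j : Fin 4) (y : EuclideanSpace ℝ (Fin 4)) :
    g.christoffel x k i j y = g.christoffel x k j i y := by
  simp only [christoffel]
  congr 1
  refine Finset.sum_congr rfl fun l _ => ?_
  rw [show (fun z => g.coeff x z i j) = fun z => g.coeff x z j i from
    funext fun z => g.coeff_symm x z i j]
  ring

lemma riemannCoeff_antisymm (x : M) (i j k l : Fin 4) (y : EuclideanSpace ℝ (Fin 4)) :
    g.riemannCoeff x i j k l y = - g.riemannCoeff x j i k l y := by
  simp only [riemannCoeff, Finset.sum_sub_distrib]; ring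

/-- Once the lower indices of the Christoffel symbols are symmetrized (no torsion), all terms cancel
in pairs. -/
lemma riemannCoeff_bianchi (x : M) (i j k l : Fin 4) (y : EuclideanSpace ℝ (Fin 4)) :
    g.riemannCoeff x i j k l y + g.riemannCoeff x j k i l y + g.riemannCoeff x k i j l y = 0 := by
  have h : ∀ l a b, g.christoffel x l a b = g.christoffel x l b a :=
    fun l a b => funext fun z => g.christoffel_symm x l a b z
  simp only [riemannCoeff, Finset.sum_sub_distrib]
  simp only [fun l => h l k j, fun l => h l i k, fun l => h l j i]
  ring

lemma contDiffAt_coeff (x : M) {y : EuclideanSpace ℝ (Fin 4)}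
    (hy : y ∈ (extChartAt (𝓡 4) x).target) (i j : Fin 4) :
    ContDiffAt ℝ ∞ (fun z => g.coeff x z i j) y :=
  (g.smooth x i j).contDiffAt ((isOpen_extChartAt_target x).mem_nhds hy)

lemma differentiableAt_coeff (x : M) {y : EuclideanSpace ℝ (Fin 4)}
    (hy : y ∈ (extChartAt (𝓡 4) x).target) (i j : Fin 4) :
    DifferentiableAt ℝ (fun z => g.coeff x z i j) y :=
  (g.contDiffAt_coeff x hy i j).differentiableAt (by simp)

lemma differentiableAt_pd {f : EuclideanSpace ℝ (Fin 4) → ℝ} {y : EuclideanSpace ℝ (Fin 4)}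
    (hf : ContDiffAt ℝ ∞ f y) (i : Fin 4) : DifferentiableAt ℝ (pd i f) y := by
  have h : ContDiffAt ℝ 1 (fderiv ℝ f) y := hf.fderiv_right (m := 1) (by norm_cast)
  exact (h.differentiableAt (by simp)).clm_apply (differentiableAt_const _)

lemma pd_comm {f : EuclideanSpace ℝ (Fin 4) → ℝ} {y : EuclideanSpace ℝ (Fin 4)}
    (hf : ContDiffAt ℝ ∞ f y) (i j : Fin 4) : pd i (pd j f) y = pd j (pd i f) y := by
  have h : ContDiffAt ℝ 1 (fderiv ℝ f) y := hf.fderiv_right (m := 1) (by norm_cast)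
  have hd := h.differentiableAt (by simp)
  have e : ∀ i j, pd i (pd j f) y = fderiv ℝ (fderiv ℝ f) y (EuclideanSpace.single i 1)
      (EuclideanSpace.single j 1) := by
    intro i j
    have : pd j f = fun z => fderiv ℝ f z (EuclideanSpace.single j 1) := rfl
    rw [pd, this, fderiv_clm_apply hd (differentiableAt_const _)]
    simp
  rw [e, e]
  exact (hf.isSymmSndFDerivAt (by
    rw [minSmoothness_of_isRCLikeNormedField]
    exact WithTop.coe_le_coe.2 (le_top : (2 : ℕ∞) ≤ ⊤))).eq _ _

/-- The Christoffel symbols of the first kind. -/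
def christoffelLow (x : M) (l i j : Fin 4) (y : EuclideanSpace ℝ (Fin 4)) : ℝ :=
  (1 / 2) * (pd i (fun z => g.coeff x z j l) y + pd j (fun z => g.coeff x z i l) y
      - pd l (fun z => g.coeff x z i j) y)

lemma christoffel_eq (x : M) (k i j : Fin 4) (y : EuclideanSpace ℝ (Fin 4)) :
    g.christoffel x k i j y = ∑ l, (g.coeff x y)⁻¹ k l * g.christoffelLow x l i j y := by
  simp only [christoffel, christoffelLow, Finset.mul_sum]
  exact Finset.sum_congr rfl fun _ _ => by ring

lemma differentiableAt_christoffelLow (x : M) {y : EuclideanSpace ℝ (Fin 4)}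
    (hy : y ∈ (extChartAt (𝓡 4) x).target) (m i j : Fin 4) :
    DifferentiableAt ℝ (g.christoffelLow x m i j) y := by
  have h := fun a b c => differentiableAt_pd (g.contDiffAt_coeff x hy a b) c
  exact (((h j m i).add (h i m j)).sub (h i j m)).const_mul (1 / 2)

variable [IsManifold (𝓡 4) ∞ M]

/-- The coordinate vectors of a chart form a basis. -/
lemma exists_basis_coordVec (x : M) {y : EuclideanSpace ℝ (Fin 4)}
    (hy : y ∈ (extChartAt (𝓡 4) x).target) :
    ∃ b : Module.Basis (Fin 4) ℝ (TangentSpace (𝓡 4) ((extChartAt (𝓡 4) x).symm y)),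
      ∀ i, b i = coordVec (𝓡 4) x y i := by
  have : IsManifold (𝓡 4) 1 M := IsManifold.of_le (n := ∞) (by simp)
  obtain ⟨L, hL⟩ := isInvertible_mfderivWithin_extChartAt_symm (I := 𝓡 4) hy
  refine ⟨(EuclideanSpace.basisFun (Fin 4) ℝ).toBasis.map L.toLinearEquiv, fun i => ?_⟩
  rw [coordVec, ← hL]
  refine (Module.Basis.map_apply _ _ _).trans ?_
  rw [OrthonormalBasis.coe_toBasis, EuclideanSpace.basisFun_apply]
  rfl

lemma isUnit_det_coeff (x : M) {y : EuclideanSpace ℝ (Fin 4)}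
    (hy : y ∈ (extChartAt (𝓡 4) x).target) : IsUnit (g.coeff x y).det := by
  obtain ⟨e, he⟩ := g.exists_basis ((extChartAt (𝓡 4) x).symm y)
  obtain ⟨b, hb⟩ := exists_basis_coordVec x hy
  have h := FrameData.isUnit_det_gLow ⟨b, g.toFun _, 0, fun _ _ _ _ => 0⟩ e he
  have hc : g.coeff x y = FrameData.gLow ⟨b, g.toFun _, 0, fun _ _ _ _ => 0⟩ := by
    ext i j
    simp only [coeff, FrameData.gLow, hb]
  rwa [hc]

lemma sum_coeff_mul_christoffel (x : M) {y : EuclideanSpace ℝ (Fin 4)}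
    (hy : y ∈ (extChartAt (𝓡 4) x).target) (m i j : Fin 4) :
    ∑ k, g.coeff x y m k * g.christoffel x k i j y = g.christoffelLow x m i j y := by
  have h := Matrix.mul_nonsing_inv _ (g.isUnit_det_coeff x hy)
  simp only [christoffel_eq, Finset.mul_sum]
  rw [Finset.sum_comm]
  have h2 : ∀ l, ∑ k, g.coeff x y m k * ((g.coeff x y)⁻¹ k l * g.christoffelLow x l i j y) =
      (1 : Matrix (Fin 4) (Fin 4) ℝ) m l * g.christoffelLow x l i j y := by
    intro l
    rw [← h, Matrix.mul_apply, Finset.sum_mul]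
    exact Finset.sum_congr rfl fun _ _ => by ring
  simp only [h2, Matrix.one_apply]
  simp

lemma differentiableAt_christoffel (x : M) {y : EuclideanSpace ℝ (Fin 4)}
    (hy : y ∈ (extChartAt (𝓡 4) x).target) (m i j : Fin 4) :
    DifferentiableAt ℝ (g.christoffel x m i j) y := by
  rw [show g.christoffel x m i j = fun y => _ from funext (g.christoffel_eq x m i j)]
  exact DifferentiableAt.fun_sum fun l _ =>
    (differentiableAt_matrix_inv (g.differentiableAt_coeff x hy) (g.isUnit_det_coeff x hy) m l).mul
      (g.differentiableAt_christoffelLow x hy l i j)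

lemma sum_coeff_mul_pd_christoffel (x : M) {y : EuclideanSpace ℝ (Fin 4)}
    (hy : y ∈ (extChartAt (𝓡 4) x).target) (i m j k : Fin 4) :
    ∑ l, g.coeff x y m l * pd i (g.christoffel x l j k) y =
      pd i (g.christoffelLow x m j k) y -
        ∑ l, pd i (fun z => g.coeff x z m l) y * g.christoffel x l j k y := by
  have hd : ∀ l ∈ Finset.univ, DifferentiableAt ℝ
      (fun z => g.coeff x z m l * g.christoffel x l j k z) y := fun l _ =>
    (g.differentiableAt_coeff x hy m l).mul (g.differentiableAt_christoffel x hy l j k)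
  -- Lowering the index is valid only over the chart target, so the identity is differentiated as
  -- one of germs.
  have h1 : (fun z => ∑ l, g.coeff x z m l * g.christoffel x l j k z) =ᶠ[nhds y]
      g.christoffelLow x m j k := by
    filter_upwards [(isOpen_extChartAt_target x).mem_nhds hy] with z hz
    exact g.sum_coeff_mul_christoffel x hz m j k
  rw [show pd i (g.christoffelLow x m j k) y = fderiv ℝ (g.christoffelLow x m j k) y
    (EuclideanSpace.single i 1) from rfl, ← h1.fderiv_eq, fderiv_fun_sum hd,
    sum_apply, ← Finset.sum_sub_distrib]
  refine Finset.sum_congr rfl fun l _ => ?_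
  rw [fderiv_fun_mul (g.differentiableAt_coeff x hy m l)
    (g.differentiableAt_christoffel x hy l j k)]
  simp [pd]
  ring

/-- The lowered Riemann tensor is antisymmetric in its last two indices. -/
lemma riemannCoeff_low_antisymm (x : M) {y : EuclideanSpace ℝ (Fin 4)}
    (hy : y ∈ (extChartAt (𝓡 4) x).target) (i j k m : Fin 4) :
    ∑ l, g.coeff x y m l * g.riemannCoeff x i j k l y =
      - ∑ l, g.coeff x y k l * g.riemannCoeff x i j m l y := by
  -- Metric compatibility. It turns the derivatives of the metric in the lowered curvature into
  -- products of Christoffel symbols.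
  have hpd : ∀ i m l, pd i (fun z => g.coeff x z m l) y =
      g.christoffelLow x m i l y + g.christoffelLow x l i m y := by
    intro i m l
    have hs : ∀ a b, (fun z => g.coeff x z a b) = fun z => g.coeff x z b a :=
      fun a b => funext fun z => g.coeff_symm x z a b
    simp only [christoffelLow]
    rw [hs l m, hs i m, hs i l, hs l i]
    ring
  have hlow : ∀ i j k m, ∑ l, g.coeff x y m l * g.riemannCoeff x i j k l y =
      pd i (g.christoffelLow x m j k) y - pd j (g.christoffelLow x m i k) y
      - ∑ l, g.christoffelLow x l i m y * g.christoffel x l j k y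
      + ∑ l, g.christoffelLow x l j m y * g.christoffel x l i k y := by
    intro i j k m
    have e1 := g.sum_coeff_mul_pd_christoffel x hy i m j k
    have e2 := g.sum_coeff_mul_pd_christoffel x hy j m i k
    have e3 : ∀ i j, ∑ l, g.coeff x y m l *
        ∑ n, g.christoffel x l i n y * g.christoffel x n j k y =
        ∑ n, g.christoffelLow x m i n y * g.christoffel x n j k y := by
      intro i j
      simp only [Finset.mul_sum, ← g.sum_coeff_mul_christoffel x hy m, Finset.sum_mul]
      rw [Finset.sum_comm]
      exact Finset.sum_congr rfl fun _ _ => Finset.sum_congr rfl fun _ _ => by ring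
    simp only [riemannCoeff, Finset.sum_sub_distrib, mul_add, mul_sub, Finset.sum_add_distrib,
      e1, e2, e3, hpd, add_mul]
    ring
  have hprod : ∀ i m j k, ∑ l, g.christoffelLow x l i m y * g.christoffel x l j k y =
      ∑ l, g.christoffelLow x l j k y * g.christoffel x l i m y := by
    intro i m j k
    simp only [← g.sum_coeff_mul_christoffel x hy, Finset.sum_mul]
    rw [Finset.sum_comm]
    refine Finset.sum_congr rfl fun a _ => Finset.sum_congr rfl fun b _ => ?_
    rw [g.coeff_symm x y b a]; ring
  -- Symmetrizing in `k, m` leaves second derivatives of the metric, which cancel against the same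
  -- terms with `i, j` exchanged.
  have hD : ∀ i j, pd i (g.christoffelLow x m j k) y + pd i (g.christoffelLow x k j m) y =
      pd i (pd j fun z => g.coeff x z k m) y := by
    intro i j
    have hsum : (pd j fun z => g.coeff x z k m) =
        fun z => g.christoffelLow x m j k z + g.christoffelLow x k j m z := by
      have hs : ∀ a b, (fun z => g.coeff x z a b) = fun z => g.coeff x z b a :=
        fun a b => funext fun z => g.coeff_symm x z a b
      funext z
      simp only [christoffelLow]
      rw [hs j m, hs m k, hs j k]
      ring
    rw [hsum]
    simp only [pd]
    rw [fderiv_fun_add (g.differentiableAt_christoffelLow x hy m j k)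
      (g.differentiableAt_christoffelLow x hy k j m)]
    rfl
  rw [hlow, hlow]
  have c := pd_comm (g.contDiffAt_coeff x hy k m) i j
  rw [← hD, ← hD] at c
  have p1 := hprod i m j k
  have p2 := hprod j m i k
  linear_combination c + p2 - p1

end LorentzMetric

/-! ### The Riemann tensor at a point -/

/-- The 4-linear form with components `K i j k m` in the basis `b`. -/
def formOfComponents {V : Type*} [AddCommGroup V] [Module ℝ V] (b : Module.Basis (Fin 4) ℝ V)
    (K : Fin 4 → Fin 4 → Fin 4 → Fin 4 → ℝ) : V →ₗ[ℝ] V →ₗ[ℝ] V →ₗ[ℝ] V →ₗ[ℝ] ℝ :=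
  ∑ i, ∑ j, ∑ k, ∑ m, (b.coord i).smulRight ((b.coord j).smulRight
    ((b.coord k).smulRight (K i j k m • b.coord m)))

lemma formOfComponents_apply {V : Type*} [AddCommGroup V] [Module ℝ V]
    (b : Module.Basis (Fin 4) ℝ V) (K : Fin 4 → Fin 4 → Fin 4 → Fin 4 → ℝ) (x y z t : V) :
    formOfComponents b K x y z t =
      ∑ i, ∑ j, ∑ k, ∑ m, K i j k m * (b.repr x i * b.repr y j * b.repr z k * b.repr t m) := by
  simp only [formOfComponents, LinearMap.sum_apply, LinearMap.smulRight_apply,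
    LinearMap.smul_apply, smul_eq_mul, Module.Basis.coord_apply]
  refine Finset.sum_congr rfl fun i _ => Finset.sum_congr rfl fun j _ =>
    Finset.sum_congr rfl fun k _ => Finset.sum_congr rfl fun m _ => ?_
  ring

lemma formOfComponents_rotate {V : Type*} [AddCommGroup V] [Module ℝ V]
    (b : Module.Basis (Fin 4) ℝ V) (K : Fin 4 → Fin 4 → Fin 4 → Fin 4 → ℝ) (x y z t : V) :
    formOfComponents b K y z x t = formOfComponents b (fun i j k m => K j k i m) x y z t := by
  simp only [formOfComponents_apply]
  conv_rhs => rw [Finset.sum_comm]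
  refine Finset.sum_congr rfl fun j _ => ?_
  conv_rhs => rw [Finset.sum_comm]
  refine Finset.sum_congr rfl fun k _ => Finset.sum_congr rfl fun i _ =>
    Finset.sum_congr rfl fun m _ => ?_
  ring

lemma formOfComponents_cyclic {V : Type*} [AddCommGroup V] [Module ℝ V]
    (b : Module.Basis (Fin 4) ℝ V) {K : Fin 4 → Fin 4 → Fin 4 → Fin 4 → ℝ}
    (h : ∀ i j k m, K i j k m + K j k i m + K k i j m = 0) (x y z t : V) :
    formOfComponents b K x y z t + formOfComponents b K y z x t +
      formOfComponents b K z x y t = 0 := by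
  rw [formOfComponents_rotate b K x y z t, formOfComponents_rotate b K y z x t,
    formOfComponents_rotate b _ x y z t]
  simp only [formOfComponents_apply, ← Finset.sum_add_distrib, ← add_mul, h]
  simp

namespace LorentzMetric

variable {M : Type*} [TopologicalSpace M] [ChartedSpace (EuclideanSpace ℝ (Fin 4)) M]
  (g : LorentzMetric M)

/-- The coordinate basis at `p` of the chart centred at `p`. -/
def stdBasis (p : M) : Module.Basis (Fin 4) ℝ (TangentSpace (𝓡 4) p) :=
  (EuclideanSpace.basisFun (Fin 4) ℝ).toBasis

lemma stdBasis_apply (p : M) (i : Fin 4) :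
    stdBasis p i = (EuclideanSpace.single i (1 : ℝ) : EuclideanSpace ℝ (Fin 4)) := by
  refine (congrFun (OrthonormalBasis.coe_toBasis (EuclideanSpace.basisFun (Fin 4) ℝ)) i).trans ?_
  exact EuclideanSpace.basisFun_apply _ _ _

lemma stdBasis_repr (p : M) (X : TangentSpace (𝓡 4) p) (i : Fin 4) :
    (stdBasis p).repr X i = tangentCoord X i :=
  (OrthonormalBasis.coe_toBasis_repr_apply (EuclideanSpace.basisFun (Fin 4) ℝ) X i).trans
    (EuclideanSpace.basisFun_repr _ _ _ _)

lemma coordVec_self [IsManifold (𝓡 4) ∞ M] (p : M) (i : Fin 4) :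
    (coordVec (𝓡 4) p (extChartAt (𝓡 4) p p) i : EuclideanSpace ℝ (Fin 4)) =
      EuclideanSpace.single i (1 : ℝ) := by
  have : IsManifold (𝓡 4) 1 M := IsManifold.of_le (n := ∞) (by simp)
  exact DFunLike.congr_fun (mfderivWithin_range_extChartAt_symm (I := 𝓡 4) (x := p))
    (EuclideanSpace.single i (1 : ℝ) : EuclideanSpace ℝ (Fin 4))

lemma coeff_self [IsManifold (𝓡 4) ∞ M] (p : M) (i j : Fin 4) :
    g.coeff p (extChartAt (𝓡 4) p p) i j = g.toFun p (stdBasis p i) (stdBasis p j) := by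
  -- Reading every fibre as the same `ℝ⁴` allows the base point to be rewritten without transporting
  -- tangent vectors.
  let B : M → EuclideanSpace ℝ (Fin 4) → EuclideanSpace ℝ (Fin 4) → ℝ := fun q v w => g.toFun q v w
  have h1 : g.coeff p (extChartAt (𝓡 4) p p) i j =
    B ((extChartAt (𝓡 4) p).symm (extChartAt (𝓡 4) p p))
      (coordVec (𝓡 4) p (extChartAt (𝓡 4) p p) i)
      (coordVec (𝓡 4) p (extChartAt (𝓡 4) p p) j) := rfl
  rw [h1, coordVec_self, coordVec_self, extChartAt_to_inv, stdBasis_apply, stdBasis_apply]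

/-- The Riemann tensor `g(R(X, Y) Z, T)` at `p`. -/
def riemannForm (p : M) : TangentSpace (𝓡 4) p →ₗ[ℝ] TangentSpace (𝓡 4) p →ₗ[ℝ]
    TangentSpace (𝓡 4) p →ₗ[ℝ] TangentSpace (𝓡 4) p →ₗ[ℝ] ℝ :=
  formOfComponents (stdBasis p) fun i j k m => ∑ l,
    g.coeff p (extChartAt (𝓡 4) p p) m l * g.riemannCoeff p i j k l (extChartAt (𝓡 4) p p)

lemma riemannForm_apply [IsManifold (𝓡 4) ∞ M] (p : M) (X Y Z T : TangentSpace (𝓡 4) p) :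
    g.riemannForm p X Y Z T = g.toFun p (g.riemann p X Y Z) T := by
  have h1 : g.riemann p X Y Z = ∑ l, (∑ i, ∑ j, ∑ k,
      g.riemannCoeff p i j k l (extChartAt (𝓡 4) p p) * (stdBasis p).repr X i *
        (stdBasis p).repr Y j * (stdBasis p).repr Z k) • stdBasis p l := by
    simp only [stdBasis_apply, stdBasis_repr]; rfl
  have h2 : ∀ l, g.toFun p (stdBasis p l) T =
      ∑ m, (stdBasis p).repr T m * g.coeff p (extChartAt (𝓡 4) p p) m l := by
    intro l
    conv_lhs => rw [← (stdBasis p).sum_repr T]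
    simp only [map_sum, map_smul, smul_eq_mul, coeff_self]
    exact Finset.sum_congr rfl fun m _ => by rw [g.symm]
  rw [riemannForm, formOfComponents_apply, h1]
  simp only [map_sum, map_smul, LinearMap.sum_apply, LinearMap.smul_apply, smul_eq_mul, h2,
    Finset.sum_mul, Finset.mul_sum]
  have hc : ∀ F : Fin 4 → Fin 4 → Fin 4 → Fin 4 → ℝ,
      ∑ a, ∑ i, ∑ j, ∑ k, F a i j k = ∑ i, ∑ j, ∑ k, ∑ a, F a i j k := by
    intro F
    rw [Finset.sum_comm]
    refine Finset.sum_congr rfl fun i _ => ?_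
    rw [Finset.sum_comm]
    exact Finset.sum_congr rfl fun j _ => Finset.sum_comm
  conv_rhs => enter [2, l]; rw [hc]
  conv_rhs => rw [hc]
  refine Finset.sum_congr rfl fun i _ => Finset.sum_congr rfl fun j _ =>
    Finset.sum_congr rfl fun k _ => ?_
  rw [Finset.sum_comm]
  refine Finset.sum_congr rfl fun l _ => Finset.sum_congr rfl fun m _ => ?_
  ring

lemma riemannForm_antisymm (p : M) (X Y Z T : TangentSpace (𝓡 4) p) :
    g.riemannForm p X Y Z T = - g.riemannForm p Y X Z T := by
  simp only [riemannForm, formOfComponents_apply]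
  rw [Finset.sum_comm]
  simp only [← Finset.sum_neg_distrib]
  refine Finset.sum_congr rfl fun i _ => Finset.sum_congr rfl fun j _ =>
    Finset.sum_congr rfl fun k _ => Finset.sum_congr rfl fun m _ => ?_
  simp only [g.riemannCoeff_antisymm p j i, mul_neg, Finset.sum_neg_distrib]
  ring

lemma riemannForm_antisymm' [IsManifold (𝓡 4) ∞ M] (p : M) (X Y Z T : TangentSpace (𝓡 4) p) :
    g.riemannForm p X Y Z T = - g.riemannForm p X Y T Z := by
  simp only [riemannForm, formOfComponents_apply, ← Finset.sum_neg_distrib]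
  refine Finset.sum_congr rfl fun i _ => Finset.sum_congr rfl fun j _ => ?_
  rw [Finset.sum_comm]
  refine Finset.sum_congr rfl fun k _ => Finset.sum_congr rfl fun m _ => ?_
  rw [g.riemannCoeff_low_antisymm p (mem_extChartAt_target p) i j m k]
  ring

lemma riemannForm_bianchi (p : M) (X Y Z T : TangentSpace (𝓡 4) p) :
    g.riemannForm p X Y Z T + g.riemannForm p Y Z X T + g.riemannForm p Z X Y T = 0 := by
  refine formOfComponents_cyclic _ (fun i j k m => ?_) X Y Z T
  simp only [← Finset.sum_add_distrib, ← mul_add]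
  refine Finset.sum_eq_zero fun l _ => ?_
  rw [g.riemannCoeff_bianchi p i j k l (extChartAt (𝓡 4) p p), mul_zero]

lemma sum_riem_mul_gLow [IsManifold (𝓡 4) ∞ M] (η : VolumeForm g) (u : GlobalFrame M) (p : M)
    (c d a t : Fin 4) :
    ∑ b, (g.frameData η u p).riem c d a b * (g.frameData η u p).gLow b t =
      g.riemannForm p (u.toBasis p c) (u.toBasis p d) (u.toBasis p a) (u.toBasis p t) := by
  rw [riemannForm_apply]
  conv_rhs => rw [← (u.toBasis p).sum_repr (g.riemann p (u.toBasis p c) (u.toBasis p d)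
    (u.toBasis p a))]
  simp only [map_sum, map_smul, LinearMap.sum_apply, LinearMap.smul_apply, smul_eq_mul]
  rfl

end LorentzMetric

/-! ### Continuity of forms along maps -/

section Continuity

variable {M : Type*} [TopologicalSpace M] [ChartedSpace (EuclideanSpace ℝ (Fin 4)) M]
  [IsManifold (𝓡 4) ∞ M]

/-- The trivialization over a chart is the derivative of the chart, which sends coordinate vectors
to standard ones. -/
lemma trivializationAt_apply_eq_repr (x : M) {y : EuclideanSpace ℝ (Fin 4)}
    (hy : y ∈ (extChartAt (𝓡 4) x).target)
    {b : Module.Basis (Fin 4) ℝ (TangentSpace (𝓡 4) ((extChartAt (𝓡 4) x).symm y))}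
    (hb : ∀ i, b i = coordVec (𝓡 4) x y i)
    (w : TangentSpace (𝓡 4) ((extChartAt (𝓡 4) x).symm y)) (j : Fin 4) :
    (trivializationAt (EuclideanSpace ℝ (Fin 4)) (TangentSpace (𝓡 4)) x
      (⟨(extChartAt (𝓡 4) x).symm y, w⟩ : TangentBundle (𝓡 4) M)).2 j = b.repr w j := by
  have : IsManifold (𝓡 4) 1 M := IsManifold.of_le (n := ∞) (by simp)
  have hs : (extChartAt (𝓡 4) x).symm y ∈ (chartAt (EuclideanSpace ℝ (Fin 4)) x).source := by
    rw [← extChartAt_source (𝓡 4)]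
    exact (extChartAt (𝓡 4) x).map_target hy
  have h1 : (trivializationAt (EuclideanSpace ℝ (Fin 4)) (TangentSpace (𝓡 4)) x
      (⟨(extChartAt (𝓡 4) x).symm y, w⟩ : TangentBundle (𝓡 4) M)).2 =
      mfderiv (𝓡 4) 𝓘(ℝ, EuclideanSpace ℝ (Fin 4)) (extChartAt (𝓡 4) x)
        ((extChartAt (𝓡 4) x).symm y) w := by
    rw [← TangentBundle.continuousLinearMapAt_trivializationAt hs]
    exact (Bundle.Trivialization.continuousLinearMapAt_apply_of_mem _ _ hs w).symm
  have h2 : ∀ i, (mfderiv (𝓡 4) 𝓘(ℝ, EuclideanSpace ℝ (Fin 4)) (extChartAt (𝓡 4) x)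
      ((extChartAt (𝓡 4) x).symm y) (b i) : EuclideanSpace ℝ (Fin 4)) =
        EuclideanSpace.single i (1 : ℝ) := by
    intro i
    rw [hb]
    exact DFunLike.congr_fun (mfderiv_extChartAt_comp_mfderivWithin_extChartAt_symm
      (I := 𝓡 4) hy) (EuclideanSpace.single i (1 : ℝ) : EuclideanSpace ℝ (Fin 4))
  rw [h1]
  let A : TangentSpace (𝓡 4) ((extChartAt (𝓡 4) x).symm y) →ₗ[ℝ] EuclideanSpace ℝ (Fin 4) :=
    (mfderiv (𝓡 4) 𝓘(ℝ, EuclideanSpace ℝ (Fin 4)) (extChartAt (𝓡 4) x)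
      ((extChartAt (𝓡 4) x).symm y)).toLinearMap
  have h3 : A w = ∑ i, b.repr w i • (EuclideanSpace.single i (1 : ℝ) :
      EuclideanSpace ℝ (Fin 4)) := by
    conv_lhs => rw [← b.sum_repr w]
    rw [map_sum]
    exact Finset.sum_congr rfl fun i _ => (map_smul _ _ _).trans (congrArg _ (h2 i))
  change (A w) j = _
  rw [h3]
  simp [Pi.single_apply]

lemma alternating_eq_det_mul (x : M) {q : M} (hq : q ∈ (extChartAt (𝓡 4) x).source)
    (η : ∀ p : M, (TangentSpace (𝓡 4) p) [⋀^Fin 4]→ₗ[ℝ] ℝ) (w : Fin 4 → TangentSpace (𝓡 4) q) :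
    η q w = (Matrix.of fun i j => (trivializationAt (EuclideanSpace ℝ (Fin 4))
      (TangentSpace (𝓡 4)) x (⟨q, w j⟩ : TangentBundle (𝓡 4) M)).2 i).det *
        η ((extChartAt (𝓡 4) x).symm (extChartAt (𝓡 4) x q))
          (coordVec (𝓡 4) x (extChartAt (𝓡 4) x q)) := by
  obtain ⟨y, hy, rfl⟩ : ∃ y ∈ (extChartAt (𝓡 4) x).target, (extChartAt (𝓡 4) x).symm y = q :=
    ⟨_, (extChartAt (𝓡 4) x).map_source hq, (extChartAt (𝓡 4) x).left_inv hq⟩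
  rw [(extChartAt (𝓡 4) x).right_inv hy]
  obtain ⟨b, hb⟩ := LorentzMetric.exists_basis_coordVec x hy
  simp only [trivializationAt_apply_eq_repr x hy hb]
  have h := congrArg (fun φ => φ w) (AlternatingMap.eq_smul_basis_det b
    (η ((extChartAt (𝓡 4) x).symm y)))
  rw [show coordVec (𝓡 4) x y = ⇑b from (funext hb).symm]
  refine h.trans ?_
  rw [AlternatingMap.smul_apply, smul_eq_mul, mul_comm, Module.Basis.det_apply]
  rfl

/-- Near `k x₀` the value is the determinant of the trivialized vectors times the chart component of
`η`, and both factors are continuous. -/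
lemma VolumeForm.continuousWithinAt {g : LorentzMetric M} (η : VolumeForm g)
    {X : Type*} [TopologicalSpace X] {s : Set X} {x₀ : X} {k : X → M}
    {v : Fin 4 → ∀ x, TangentSpace (𝓡 4) (k x)}
    (hv : ∀ i, ContinuousWithinAt (fun x => (⟨k x, v i x⟩ : TangentBundle (𝓡 4) M)) s x₀) :
    ContinuousWithinAt (fun x => η.toFun (k x) fun i => v i x) s x₀ := by
  have hv' := fun i => (FiberBundle.continuousWithinAt_totalSpace (EuclideanSpace ℝ (Fin 4)) _).1
    (hv i)
  have hk : ContinuousWithinAt k s x₀ := (hv' 0).1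
  have hsrc : ∀ᶠ x in nhdsWithin x₀ s, k x ∈ (extChartAt (𝓡 4) (k x₀)).source :=
    hk.eventually (extChartAt_source_mem_nhds (I := 𝓡 4) (k x₀))
  have hdet : ContinuousWithinAt (fun x => (Matrix.of fun i j => (trivializationAt
      (EuclideanSpace ℝ (Fin 4)) (TangentSpace (𝓡 4)) (k x₀)
      (⟨k x, v j x⟩ : TangentBundle (𝓡 4) M)).2 i).det) s x₀ := by
    have hm : ContinuousWithinAt (fun x => (Matrix.of fun i j => (trivializationAt
        (EuclideanSpace ℝ (Fin 4)) (TangentSpace (𝓡 4)) (k x₀)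
        (⟨k x, v j x⟩ : TangentBundle (𝓡 4) M)).2 i : Matrix (Fin 4) (Fin 4) ℝ)) s x₀ :=
      continuousWithinAt_pi.2 fun i => continuousWithinAt_pi.2 fun j =>
        (EuclideanSpace.proj (𝕜 := ℝ) i).continuous.continuousAt.comp_continuousWithinAt (hv' j).2
    exact (Continuous.matrix_det continuous_id).continuousAt.comp_continuousWithinAt hm
  have hcomp : ContinuousWithinAt (fun x => η.toFun
      ((extChartAt (𝓡 4) (k x₀)).symm (extChartAt (𝓡 4) (k x₀) (k x)))
        (coordVec (𝓡 4) (k x₀) (extChartAt (𝓡 4) (k x₀) (k x)))) s x₀ := by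
    have h1 := ((η.smooth (k x₀)).continuousOn.continuousAt
      ((isOpen_extChartAt_target (k x₀)).mem_nhds (mem_extChartAt_target (k x₀))))
    have h2 : ContinuousWithinAt (fun x => extChartAt (𝓡 4) (k x₀) (k x)) s x₀ :=
      (continuousAt_extChartAt (I := 𝓡 4) (k x₀)).comp_continuousWithinAt hk
    exact ContinuousAt.comp_continuousWithinAt
      (g := fun y => η.toFun ((extChartAt (𝓡 4) (k x₀)).symm y) (coordVec (𝓡 4) (k x₀) y)) h1 h2
  refine (hdet.mul hcomp).congr_of_eventuallyEq ?_ ?_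
  · filter_upwards [hsrc] with x hx
    exact alternating_eq_det_mul (k x₀) hx η.toFun _
  · exact alternating_eq_det_mul (k x₀) (mem_extChartAt_source _) η.toFun _

end Continuity

/-! ### Push-forward of coordinate vectors along the immersion. -/

section CoordVec

variable {M : Type*} [TopologicalSpace M] [ChartedSpace (EuclideanSpace ℝ (Fin 4)) M]
  [IsManifold (𝓡 4) ∞ M]
  {H : Type*} [TopologicalSpace H] {I : ModelWithCorners ℝ (EuclideanSpace ℝ (Fin 3)) H}
  {S : Type*} [TopologicalSpace S] [ChartedSpace H S] [IsManifold I ∞ S]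

/-- The pushed-forward vector is the derivative of `f` in the chart applied to a constant vector.
Derivatives within the chart target are used so that boundary points are included. -/
lemma continuousOn_mfderiv_coordVec {f : S → M} (hf : ContMDiff I (𝓡 4) ∞ f) (x : S) (i : Fin 3) :
    ContinuousOn (fun y => (⟨f ((extChartAt I x).symm y),
      mfderiv I (𝓡 4) f ((extChartAt I x).symm y) (coordVec I x y i)⟩ : TangentBundle (𝓡 4) M))
      (extChartAt I x).target := by
  have : IsManifold (𝓡 4) 1 M := IsManifold.of_le (n := ∞) (by simp)
  have : IsManifold I 1 S := IsManifold.of_le (n := ∞) (by simp)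
  have hF : ContMDiffOn 𝓘(ℝ, EuclideanSpace ℝ (Fin 3)) (𝓡 4) ∞ (f ∘ (extChartAt I x).symm)
    (extChartAt I x).target := hf.comp_contMDiffOn (contMDiffOn_extChartAt_symm x)
  have hU : UniqueMDiffOn 𝓘(ℝ, EuclideanSpace ℝ (Fin 3)) (extChartAt I x).target :=
    (uniqueDiffOn_extChartAt_target x).uniqueMDiffOn
  have hT := hF.continuousOn_tangentMapWithin (by simp) hU
  have hsec : Continuous fun y : EuclideanSpace ℝ (Fin 3) =>
      (⟨y, (EuclideanSpace.single i (1 : ℝ) : EuclideanSpace ℝ (Fin 3))⟩ :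
        TangentBundle 𝓘(ℝ, EuclideanSpace ℝ (Fin 3)) (EuclideanSpace ℝ (Fin 3))) := by
    rw [continuous_iff_continuousAt]
    intro y
    rw [FiberBundle.continuousAt_totalSpace]
    refine ⟨continuousAt_id, ?_⟩
    simp
    exact continuousAt_const
  refine (hT.comp hsec.continuousOn fun y hy => hy).congr fun y hy => ?_
  have hd : MDifferentiableWithinAt 𝓘(ℝ, EuclideanSpace ℝ (Fin 3)) I (extChartAt I x).symm
      (Set.range I) y := mdifferentiableWithinAt_extChartAt_symm hy
  have h1 : mfderivWithin 𝓘(ℝ, EuclideanSpace ℝ (Fin 3)) I (extChartAt I x).symm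
      (extChartAt I x).target y = mfderivWithin 𝓘(ℝ, EuclideanSpace ℝ (Fin 3)) I
        (extChartAt I x).symm (Set.range I) y :=
    hd.mfderivWithin_mono (hU y hy) (extChartAt_target_subset_range x)
  have h2 := mfderiv_comp_mfderivWithin (I := 𝓘(ℝ, EuclideanSpace ℝ (Fin 3))) (I' := I)
    (I'' := 𝓡 4) (s := (extChartAt I x).target) (g := f) y
    (hf.mdifferentiable (by simp) _) (hd.mono (extChartAt_target_subset_range x)) (hU y hy)
  simp only [Function.comp_apply, tangentMapWithin]
  rw [h2, h1]
  rfl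

end CoordVec

/-! ### Spacelike or null hypersurfaces -/

section Transverse

variable {V T : Type*} [AddCommGroup V] [Module ℝ V] [AddCommGroup T] [Module ℝ T]
  {g : LinearMap.BilinForm ℝ V} {E : Module.Basis (Fin 4) ℝ V} {τ : V}

/-- A timelike vector is transverse to spacelike and null hyperplanes. -/
lemma alternating_timelike_ne_zero (hE : ∀ i j, g (E i) (E j) = minkMetric i j)
    {η : V [⋀^Fin 4]→ₗ[ℝ] ℝ} (hη : η ≠ 0) {L : T →ₗ[ℝ] V} (hL : Function.Injective L)
    {v : Fin 3 → T} (hv : LinearIndependent ℝ v) (hs : Submodule.span ℝ (Set.range v) = ⊤)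
    (htype : (∀ v : T, v ≠ 0 → 0 < g (L v) (L v)) ∨ ∃ v : T, v ≠ 0 ∧ ∀ w, g (L v) (L w) = 0)
    (hτ : g τ τ < 0) : η ![L (v 0), L (v 1), L (v 2), τ] ≠ 0 := by
  have hNN := bilin_normalVec_self_nonpos hE hη hL hv hs htype
  have hN0 : normalVec E η (fun i => L (v i)) ≠ 0 :=
    normalVec_ne_zero hE hη (hv.map' L (LinearMap.ker_eq_bot.2 hL))
  have h1 := bilin_normalVec hE η (fun i => L (v i)) τ
  have hconv := bilin_eq_minkowski (g := g) hE
  intro h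
  rw [h, neg_zero, hconv] at h1
  refine minkowski_ne_zero (by rwa [← hconv]) (fun h => hN0 ?_) (by rwa [← hconv]) h1
  exact E.repr.injective (DFunLike.coe_injective (h.trans (by simp)))

lemma alternating_cons_eq_neg (E : Module.Basis (Fin 4) ℝ V) (η : V [⋀^Fin 4]→ₗ[ℝ] ℝ)
    (x y z w : V) : η ![w, x, y, z] = - η ![x, y, z, w] := by
  rw [alternating_apply_eq_detFour E, alternating_apply_eq_detFour E]
  simp only [detFour]
  ring

end Transverse

/-! ### The future orientation and the sign of the local densities. -/

section Hypersurface

variable {M : Type*} [TopologicalSpace M] [ChartedSpace (EuclideanSpace ℝ (Fin 4)) M]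
  {g : LorentzMetric M}
  {H : Type*} [TopologicalSpace H] {I : ModelWithCorners ℝ (EuclideanSpace ℝ (Fin 3)) H}
  {S : Type*} [TopologicalSpace S] [ChartedSpace H S] {f : S → M}

lemma VolumeForm.toFun_ne_zero (η : VolumeForm g) (p : M) : η.toFun p ≠ 0 := by
  intro h
  obtain ⟨e, he⟩ := g.exists_basis p
  have h1 := η.normalized p e
  have h2 : (Matrix.of fun i j => g.toFun p (e i) (e j)) = Matrix.diagonal minkSign := by
    ext i j
    simp [he, minkMetric, Matrix.diagonal_apply]
  rw [h, h2, Matrix.det_diagonal] at h1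
  simp [Fin.prod_univ_four, minkSign] at h1

lemma span_range_eq_top {q : S} {v : Fin 3 → TangentSpace I q} (hv : LinearIndependent ℝ v) :
    Submodule.span ℝ (Set.range v) = ⊤ := by
  have : FiniteDimensional ℝ (TangentSpace I q) :=
    inferInstanceAs (FiniteDimensional ℝ (EuclideanSpace ℝ (Fin 3)))
  refine hv.span_eq_top_of_card_eq_finrank' ?_
  rw [Fintype.card_fin]
  exact (finrank_euclideanSpace_fin (𝕜 := ℝ) (n := 3)).symm

/-- The 3-form `η(·, ·, ·, t)` on a hypersurface, for a transverse vector field `t`. -/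
def transverseForm (I : ModelWithCorners ℝ (EuclideanSpace ℝ (Fin 3)) H) (η : VolumeForm g)
    (t : ∀ p : M, TangentSpace (𝓡 4) p) (f : S → M) (q : S) :
    (TangentSpace I q) [⋀^Fin 3]→ₗ[ℝ] ℝ :=
  -((η.toFun (f q)).curryLeft (t (f q))).compLinearMap (mfderiv I (𝓡 4) f q).toLinearMap

/-- The minus sign in `transverseForm` comes from moving `t` past three arguments, from the first
slot to the last. -/
lemma transverseForm_apply (η : VolumeForm g) (t : ∀ p : M, TangentSpace (𝓡 4) p) (f : S → M)
    (q : S) (v : Fin 3 → TangentSpace I q) : transverseForm I η t f q v =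
      η.toFun (f q) ![mfderiv I (𝓡 4) f q (v 0), mfderiv I (𝓡 4) f q (v 1),
        mfderiv I (𝓡 4) f q (v 2), t (f q)] := by
  obtain ⟨E, -⟩ := g.exists_basis (f q)
  rw [← neg_neg (η.toFun (f q) _), ← alternating_cons_eq_neg E]
  change -(η.toFun (f q) (Matrix.vecCons (t (f q)) fun i => mfderiv I (𝓡 4) f q (v i))) = _
  congr 2
  ext i
  fin_cases i <;> rfl

variable [IsManifold (𝓡 4) ∞ M] {τ : TimeOrientation g}

lemma transverseForm_apply_ne_zero (η : VolumeForm g) {q : S}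
    (himm : Function.Injective (mfderiv I (𝓡 4) f q))
    (htype : IsSpacelikeAt I g f q ∨ IsNullAt I g f q) {v : Fin 3 → TangentSpace I q}
    (hv : LinearIndependent ℝ v) : transverseForm I η τ.toFun f q v ≠ 0 := by
  obtain ⟨E, hE⟩ := g.exists_basis (f q)
  rw [transverseForm_apply]
  exact alternating_timelike_ne_zero hE (η.toFun_ne_zero (f q))
    (L := (mfderiv I (𝓡 4) f q).toLinearMap) himm hv (span_range_eq_top hv) htype
    (τ.timelike (f q))

/-- The orientation of a spacelike or null hypersurface for which the time orientation points to
its positive side. -/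
def futureOrientation [IsManifold I ∞ S] (η : VolumeForm g) (τ : TimeOrientation g)
    (hf : ContMDiff I (𝓡 4) ∞ f)
    (himm : ∀ q : S, Function.Injective (mfderiv I (𝓡 4) f q))
    (htype : ∀ q : S, IsSpacelikeAt I g f q ∨ IsNullAt I g f q) : OrientationForm I S where
  toFun := transverseForm I η τ.toFun f
  ne_zero q h := transverseForm_apply_ne_zero (τ := τ) η (himm q) (htype q)
    (v := (EuclideanSpace.basisFun (Fin 3) ℝ).toBasis)
    (EuclideanSpace.basisFun (Fin 3) ℝ).toBasis.linearIndependent (by rw [h]; rfl)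
  continuousOn x := by
    simp only [transverseForm_apply]
    intro y hy
    have hc := fun i => continuousOn_mfderiv_coordVec hf x i y hy
    have hτ : ContinuousWithinAt (fun y => (⟨f ((extChartAt I x).symm y),
        τ.toFun (f ((extChartAt I x).symm y))⟩ : TangentBundle (𝓡 4) M))
        (extChartAt I x).target y :=
      (τ.continuous.comp_continuousOn (hf.continuous.comp_continuousOn
        (continuousOn_extChartAt_symm x))) y hy
    refine (η.continuousWithinAt (v := ![fun y => mfderiv I (𝓡 4) f ((extChartAt I x).symm y)
      (coordVec I x y 0), fun y => mfderiv I (𝓡 4) f ((extChartAt I x).symm y)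
      (coordVec I x y 1), fun y => mfderiv I (𝓡 4) f ((extChartAt I x).symm y)
      (coordVec I x y 2), fun y => τ.toFun (f ((extChartAt I x).symm y))])
      (k := fun y => f ((extChartAt I x).symm y)) fun i => ?_).congr (fun z _ => ?_) ?_
    · fin_cases i
      exacts [hc 0, hc 1, hc 2, hτ]
    all_goals
      congr 1
      ext i
      fin_cases i <;> rfl

lemma futureOrientation_isFutureNormal [IsManifold I ∞ S] (η : VolumeForm g)
    (hf : ContMDiff I (𝓡 4) ∞ f)
    (himm : ∀ q : S, Function.Injective (mfderiv I (𝓡 4) f q))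
    (htype : ∀ q : S, IsSpacelikeAt I g f q ∨ IsNullAt I g f q) :
    (futureOrientation η τ hf himm htype).IsFutureNormal τ η f := by
  intro q n hn hnf v hv
  obtain ⟨E, hE⟩ := g.exists_basis (f q)
  change 0 < transverseForm I η τ.toFun f q v ↔ _
  rw [transverseForm_apply]
  exact alternating_pos_iff hE (η.toFun_ne_zero (f q)) (L := (mfderiv I (𝓡 4) f q).toLinearMap)
    (himm q) hv (span_range_eq_top hv) (htype q) (τ.timelike (f q)) hn.2.1 hn.2.2 hnf

/-- The time orientation itself is an admissible transverse vector, so every future-normal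
orientation has the sign of `transverseForm`. -/
lemma OrientationForm.IsFutureNormal.pos_iff {o : OrientationForm I S} {η : VolumeForm g}
    (ho : o.IsFutureNormal τ η f) {q : S} (himm : Function.Injective (mfderiv I (𝓡 4) f q))
    (htype : IsSpacelikeAt I g f q ∨ IsNullAt I g f q) {v : Fin 3 → TangentSpace I q}
    (hv : LinearIndependent ℝ v) : 0 < o.toFun q v ↔ 0 < transverseForm I η τ.toFun f q v := by
  rw [transverseForm_apply]
  refine ho q (τ.toFun (f q)) ⟨?_, (τ.timelike _).le, τ.timelike _⟩ ?_ v hv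
  · intro h
    simpa [h] using τ.timelike (f q)
  · intro h
    apply transverseForm_apply_ne_zero (τ := τ) η himm htype hv
    rw [transverseForm_apply]
    refine alternating_range_eq_zero (η.toFun (f q)) (w := fun i => mfderiv I (𝓡 4) f q (v i)) ?_
    have := span_range_comp_eq_range (mfderiv I (𝓡 4) f q).toLinearMap (span_range_eq_top hv)
    exact this.symm ▸ h

variable {η : VolumeForm g} {u : GlobalFrame M} {a b c : Fin 4}

lemma pullbackForm_belRobinson_nonneg
    (ha : ∀ p : M, τ.IsFutureCausal (u.toBasis p a))
    (hb : ∀ p : M, τ.IsFutureCausal (u.toBasis p b))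
    (hc : ∀ p : M, τ.IsFutureCausal (u.toBasis p c))
    {q : S} (himm : Function.Injective (mfderiv I (𝓡 4) f q))
    (htype : IsSpacelikeAt I g f q ∨ IsNullAt I g f q) {v : Fin 3 → TangentSpace I q}
    (hv : LinearIndependent ℝ v) (hpos : 0 < transverseForm I η τ.toFun f q v) :
    0 ≤ pullbackForm I f (g.belRobinsonForm η u a b c) q v := by
  obtain ⟨E, hE⟩ := g.exists_basis (f q)
  rw [transverseForm_apply] at hpos
  exact belRobinson_nonneg (A := g.frameData η u (f q)) hE (g.sum_riem_mul_gLow η u (f q))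
    (g.riemannForm_antisymm (f q)) (g.riemannForm_antisymm' (f q)) (g.riemannForm_bianchi (f q))
    (L := (mfderiv I (𝓡 4) f q).toLinearMap) himm hv (span_range_eq_top hv) htype
    (τ.timelike (f q)) (ha _).2.1 (ha _).2.2 (hb _).2.1 (hb _).2.2 (hc _).2.1 (hc _).2.2 hpos

/-- The local densities of the Bel-Robinson 3-form are nonnegative. -/
lemma sign_mul_pullbackForm_belRobinson_nonneg
    (ha : ∀ p : M, τ.IsFutureCausal (u.toBasis p a))
    (hb : ∀ p : M, τ.IsFutureCausal (u.toBasis p b))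
    (hc : ∀ p : M, τ.IsFutureCausal (u.toBasis p c))
    {o : OrientationForm I S} (ho : o.IsFutureNormal τ η f)
    {q : S} (himm : Function.Injective (mfderiv I (𝓡 4) f q))
    (htype : IsSpacelikeAt I g f q ∨ IsNullAt I g f q) (v : Fin 3 → TangentSpace I q) :
    0 ≤ Real.sign (o.toFun q v) * pullbackForm I f (g.belRobinsonForm η u a b c) q v := by
  by_cases hv : LinearIndependent ℝ v
  · have hne := transverseForm_apply_ne_zero (τ := τ) η himm htype hv
    have hiff := ho.pos_iff himm htype hv
    rcases lt_or_gt_of_ne hne with h | h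
    -- A negative basis becomes positive on exchanging two vectors, and the 3-form changes sign with
    -- it.
    · have hv' : LinearIndependent ℝ (v ∘ Equiv.swap 0 1) := hv.comp _ (Equiv.injective _)
      have h01 : (0 : Fin 3) ≠ 1 := by decide
      have h1 := pullbackForm_belRobinson_nonneg (η := η) ha hb hc himm htype hv'
        (by rw [AlternatingMap.map_swap _ _ h01]; linarith)
      rw [AlternatingMap.map_swap _ _ h01] at h1
      have h2 : Real.sign (o.toFun q v) ≤ 0 := by
        have h3 : o.toFun q v ≤ 0 := not_lt.1 fun h3 => (hiff.1 h3).not_gt h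
        rcases h3.lt_or_eq with h3 | h3
        · rw [Real.sign_of_neg h3]; norm_num
        · rw [h3, Real.sign_zero]
      exact mul_nonneg_of_nonpos_of_nonpos h2 (by linarith)
    · rw [Real.sign_of_pos (hiff.2 h), one_mul]
      exact pullbackForm_belRobinson_nonneg ha hb hc himm htype hv h
  · rw [(pullbackForm I f (g.belRobinsonForm η u a b c) q).map_linearDependent v hv, mul_zero]

variable [IsManifold I ∞ S] [T2Space S] [SigmaCompactSpace S]

/-- The partition functions are nonnegative, so the negative part has integral zero and the
difference cannot be the undefined `⊤ - ⊤`. -/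
lemma formIntegral_nonneg (o : OrientationForm I S)
    (α : ∀ q : S, (TangentSpace I q) [⋀^Fin 3]→ₗ[ℝ] ℝ)
    (hα : ∀ q (v : Fin 3 → TangentSpace I q), 0 ≤ Real.sign (o.toFun q v) * α q v) :
    0 ≤ formIntegral o α := by
  have h : posIntegral o (fun q => - α q) = 0 := by
    rw [posIntegral]
    refine ENNReal.tsum_eq_zero.2 fun x => ?_
    rw [← MeasureTheory.lintegral_zero]
    congr 1
    ext y
    refine ENNReal.ofReal_eq_zero.2 (mul_nonpos_of_nonneg_of_nonpos
      ((chartPartition I S).nonneg x _) ?_)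
    rw [density, AlternatingMap.neg_apply, mul_neg]
    exact neg_nonpos.2 (hα _ _)
  rw [formIntegral, h, EReal.coe_ennreal_zero, sub_zero]
  exact EReal.coe_ennreal_nonneg _

end Hypersurface

end

theorem mainTheorem5
    {M : Type*} [TopologicalSpace M] [ChartedSpace (EuclideanSpace ℝ (Fin 4)) M]
    [IsManifold (𝓡 4) ∞ M]
    (g : LorentzMetric M) (τ : TimeOrientation g) (η : VolumeForm g) (u : GlobalFrame M)
    (a b c : Fin 4)
    (ha : ∀ p : M, τ.IsFutureCausal (u.toBasis p a))
    (hb : ∀ p : M, τ.IsFutureCausal (u.toBasis p b))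
    (hc : ∀ p : M, τ.IsFutureCausal (u.toBasis p c))
    {H : Type*} [TopologicalSpace H] (I : ModelWithCorners ℝ (EuclideanSpace ℝ (Fin 3)) H)
    {S : Type*} [TopologicalSpace S] [ChartedSpace H S] [IsManifold I ∞ S]
    [T2Space S] [SigmaCompactSpace S]
    (f : S → M) (hf : ContMDiff I (𝓡 4) ∞ f) (hinj : Function.Injective f)
    (himm : ∀ q : S, Function.Injective (mfderiv I (𝓡 4) f q))
    (htype : ∀ q : S, IsSpacelikeAt I g f q ∨ IsNullAt I g f q) :
    (∃ o : OrientationForm I S, o.IsFutureNormal τ η f) ∧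
    ∀ o : OrientationForm I S, o.IsFutureNormal τ η f →
      0 ≤ formIntegral o (pullbackForm I f (g.belRobinsonForm η u a b c)) := by
  refine ⟨⟨futureOrientation η τ hf himm htype, futureOrientation_isFutureNormal η hf himm htype⟩,
    fun o ho => formIntegral_nonneg o _ fun q v => ?_⟩
  exact sign_mul_pullbackForm_belRobinson_nonneg ha hb hc ho (himm q) (htype q) v
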